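/- **Move-to-front search-cost.** For each $n\ge 1$ let $\mathbf w^{(n)}=(w^{(n)}_1,\dots,w^{(n)}_n)$ be a random vector with nonnegative entries, and put $p^{(n)}_i=w^{(n)}_i/\sum_{j=1}^n w^{(n)}_j$ (with $0/0:=0$). Conditionally on $\mathbf w^{(n)}$, objects $1,\dots,n$ are requested at the points of independent Poisson processes on $[0,\infty)$ of rates $p^{(n)}_1,\dots,p^{(n)}_n$. Initially object $i$ is at position $i$ of a list. At each request the requested object is moved to position $1$, the relative order of the others being unchanged. Let $S^{(n)}(t)$ be the position in the list at time $t$ (after the requests made in $[0,t)$) of the object requested first in $[t,\infty)$ (and $S^{(n)}(t)=0$ if no object is ever requested), and let $S^{(n)}_{\mathbf o}(t)$ be equal to $S^{(n)}(t)$ if that object has not been requested in $[0,t)$, and to $0$ otherwise. **Assumptions.** Let $P$ be a Borel probability measure on $\mathbb R_+$ with mean $\mu\in(0,\infty)$. Assume that * there are positive random variables $Z_n$ such that, as $n\to\infty$, the random measures $\frac1n\sum_{i=1}^n\delta_{Z_nw_i^{(n)}}$ converge in law to the deterministic limit $P$ (for the weak topology on probability measures on $\mathbb R_+$) and $\frac1n\sum_{i=1}^n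 Z_nw_i^{(n)}$ converges in law to $\mu$; * for each $n$, the vector $\mathbf w^{(n)}$ is exchangeable. Let $\phi(t)=\int e^{-tx}P(dx)$, $t\ge0$, let $\phi^{-1}$ be the inverse of $\phi:[0,\infty)\to(\mathbf p_0,1]$, where $\mathbf p_0=P(\{0\})$, and put $$f_{S^{(\infty)}}(x)=-\frac1\mu\,\frac{\phi''(\phi^{-1}(1-x))}{\phi'(\phi^{-1}(1-x))}\,\mathbf 1_{[0,1-\mathbf p_0]}(x).$$ **Conclusion.** The function $f_{S^{(\infty)}}$ is a probability density. Let $t>0$, let $S^{(\infty)}$ be a random variable with density $f_{S^{(\infty)}}$, let $U$ be uniform on $[1-\phi(t),1]$ and independent of $S^{(\infty)}$, and let $S(t)$ be any random variable such that $$S(t)\overset{(d)}{=}S^{(\infty)}\mathbf 1_{\{S^{(\infty)}\le 1-\phi(t)\}}+U\,\mathbf 1_{\{S^{(\infty)}>1-\phi(t)\}}.$$ Then: 1. $S^{(n)}(n\mu t)/n$ converges in distribution to $S(t)$ as $n\to\infty$. 2. As $n\to\infty$, $$\mathbb P\bigl(S^{(n)}_{\mathbf o}(n\mu t)>0\bigr)\longrightarrow\mathbb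 P\bigl(S^{(\infty)}>1-\phi(t)\bigr)=\frac{|\phi'(t)|}{\mu}.$$ 3. $S(t)$ has the probability density $$f_{S(t)}(x)=f_{S^{(\infty)}}(x)\mathbf 1_{[0,1-\phi(t)]}(x)+\frac{|\phi'(t)|}{\mu\,\phi(t)}\mathbf 1_{[1-\phi(t),1]}(x).$$ 4. With $\|\cdot\|_{\mathrm{TV}}$ the total variation norm of signed measures (so that $\|Q_1-Q_2\|_{\mathrm{TV}}=2$ for mutually singular probability measures $Q_1,Q_2$), $$\bigl\|\mathrm{law}(S(t))-\mathrm{law}(S^{(\infty)})\bigr\|_{\mathrm{TV}}=\int_{1-\phi(t)}^{1-\mathbf p_0}\Bigl|f_{S^{(\infty)}}(x)-\frac{|\phi'(t)|}{\mu\,\phi(t)}\Bigr|\,dx+\frac{|\phi'(t)|\,\mathbf p_0}{\mu\,\phi(t)}\;\le\;2\,\frac{|\phi'(t)|}{\mu}.$$ -/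

import Mathlib

open MeasureTheory ProbabilityTheory Filter Topology
open scoped NNReal ENNReal BoundedContinuousFunction

noncomputable section

namespace MoveToFront

/-! ### The move-to-front list driven by Poisson requests -/

section Dynamics

variable {n : ℕ}

/-- The popularities `p i = w i / ∑ j, w j`, with the convention `0 / 0 = 0`. -/
def popularity (w : Fin n → ℝ≥0) (i : Fin n) : ℝ≥0 := w i / ∑ j, w j

/-- The instant of the `(k+1)`-st request of object `i`, where `r = (i, k)`: the arrival time of a
Poisson process of rate `p i` whose interarrival times are `e (i, 0) / p i, e (i, 1) / p i, …`
for unit exponential variables `e (i, j)`. It is meaningful only if `0 < p i`: an object with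
`p i = 0` is never requested. -/
def requestTime (p : Fin n → ℝ≥0) (e : Fin n × ℕ → ℝ) (r : Fin n × ℕ) : ℝ :=
  (∑ j ∈ Finset.range (r.2 + 1), e (r.1, j)) / (p r.1 : ℝ)

/-- All the requests that occur in the time interval `[0, t)`. -/
def requestsBefore (p : Fin n → ℝ≥0) (e : Fin n × ℕ → ℝ) (t : ℝ) : Set (Fin n × ℕ) :=
  {r | 0 < p r.1 ∧ requestTime p e r < t}

/-- `N_{t-}`, the total number of requests in `[0, t)`. -/
def requestCount (p : Fin n → ℝ≥0) (e : Fin n × ℕ → ℝ) (t : ℝ) : ℕ :=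
  (requestsBefore p e t).ncard

open Classical in
/-- The `(k+1)`-st requested object in chronological order: the object one of whose requests is
preceded by exactly `k` requests (almost surely there are no ties). It is `none` if there is no
such request, as happens when all popularities vanish. -/
def requested (p : Fin n → ℝ≥0) (e : Fin n × ℕ → ℝ) (k : ℕ) : Option (Fin n) :=
  (List.finRange n).find? fun i =>
    decide (∃ m : ℕ, 0 < p i ∧ requestCount p e (requestTime p e (i, m)) = k)

/-- The move-to-front rule, acting on the positions of the objects (numbered from `1`):
object `i` goes to position `1`, the objects in front of it move one step back, and the
others stay where they are. -/
def moveToFront (pos : Fin n → ℕ) (i : Fin n) : Fin n → ℕ := fun j =>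
  if j = i then 1 else if pos j < pos i then pos j + 1 else pos j

/-- The positions of the objects after the first `k` requests, when object `i` starts at
position `π i` (the elements of `Fin n` stand for `1, …, n`). -/
def positionAfter (π : Equiv.Perm (Fin n)) (p : Fin n → ℝ≥0) (e : Fin n × ℕ → ℝ) :
    ℕ → Fin n → ℕ
  | 0 => fun i => (π i : ℕ) + 1
  | k + 1 => (requested p e k).elim (positionAfter π p e k) (moveToFront (positionAfter π p e k))

/-- The position at time `t` of object `i`. -/
def position (π : Equiv.Perm (Fin n)) (p : Fin n → ℝ≥0) (e : Fin n × ℕ → ℝ) (t : ℝ)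
    (i : Fin n) : ℕ :=
  positionAfter π p e (requestCount p e t) i

/-- The object requested first in `[t, ∞)`. -/
def nextRequested (p : Fin n → ℝ≥0) (e : Fin n × ℕ → ℝ) (t : ℝ) : Option (Fin n) :=
  requested p e (requestCount p e t)

/-- The search-cost at time `t`: the position at time `t` of the next requested object. -/
def searchCost (π : Equiv.Perm (Fin n)) (p : Fin n → ℝ≥0) (e : Fin n × ℕ → ℝ) (t : ℝ) : ℕ :=
  ∑ i, if nextRequested p e t = some i then position π p e t i else 0

/-- `R_t`, the set of the objects requested at least once in `[0, t)`. -/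
def requestedSet (p : Fin n → ℝ≥0) (e : Fin n × ℕ → ℝ) (t : ℝ) : Set (Fin n) :=
  {i | ∃ m : ℕ, (i, m) ∈ requestsBefore p e t}

open Classical in
/-- The out-of-equilibrium part of the search-cost: the search-cost if the next requested object
is not in `R_t`, and `0` otherwise. -/
def searchCostOut (π : Equiv.Perm (Fin n)) (p : Fin n → ℝ≥0) (e : Fin n × ℕ → ℝ) (t : ℝ) : ℕ :=
  if ∃ i, nextRequested p e t = some i ∧ i ∉ requestedSet p e t then searchCost π p e t else 0

/-- The randomness of the requests: the `e r` are i.i.d. exponential variables of parameter `1`,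
and the whole family is independent of the vector `w` of weights. Conditionally on `w`, the request
instants of the objects are then independent Poisson processes of rates `popularity w i`. -/
structure IsRequestClock {Ω : Type*} [MeasurableSpace Ω] (Pr : Measure Ω)
    (w : Ω → Fin n → ℝ≥0) (e : Fin n × ℕ → Ω → ℝ) : Prop where
  hasLaw : ∀ r, HasLaw (e r) (expMeasure 1) Pr
  iIndep : iIndepFun e Pr
  indep : IndepFun w (fun ω r => e r ω) Pr

end Dynamics

/-! ### The law of large numbers condition -/

/-- The empirical measure `n⁻¹ ∑ i, δ_{x i}`. -/
def empiricalMeasure {n : ℕ} [NeZero n] (x : Fin n → ℝ≥0) : ProbabilityMeasure ℝ≥0 :=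
  ⟨(n : ℝ≥0∞)⁻¹ • ∑ i, Measure.dirac (x i), ⟨by
    simp only [Measure.smul_apply, Measure.finsetSum_apply, measure_univ, Finset.sum_const,
      Finset.card_univ, Fintype.card_fin, nsmul_eq_mul, mul_one, smul_eq_mul]
    exact ENNReal.inv_mul_cancel (by exact_mod_cast NeZero.ne n) (ENNReal.natCast_ne_top n)⟩⟩

/-- Convergence in law of the random elements `X n` (on possibly different probability spaces) to
the deterministic element `c`. -/
def TendstoInLawConst {Ω : ℕ+ → Type*} [∀ n, MeasurableSpace (Ω n)] (Pr : ∀ n, Measure (Ω n))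
    {E : Type*} [TopologicalSpace E] (X : ∀ n, Ω n → E) (c : E) : Prop :=
  ∀ Ψ : E →ᵇ ℝ, Tendsto (fun n => ∫ ω, Ψ (X n ω) ∂(Pr n)) atTop (𝓝 (Ψ c))

/-- The mean of a law on `[0, ∞)`. -/
def mean (P : ProbabilityMeasure ℝ≥0) : ℝ := ∫ x : ℝ≥0, (x : ℝ) ∂(P : Measure ℝ≥0)

/-- The random vectors `w n` of weights satisfy the law of large numbers with limiting law `P`:
`P` has a finite nonzero mean and, for some positive random variables `Z n`, the empirical
measures of the rescaled weights converge in law to `P` and their means to the mean of `P`. -/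
structure SatisfiesLLN {Ω : ℕ+ → Type*} [∀ n, MeasurableSpace (Ω n)] (Pr : ∀ n, Measure (Ω n))
    (w : ∀ n : ℕ+, Ω n → Fin n → ℝ≥0) (P : ProbabilityMeasure ℝ≥0) : Prop where
  integrable : Integrable (fun x : ℝ≥0 => (x : ℝ)) (P : Measure ℝ≥0)
  mean_ne_zero : mean P ≠ 0
  exists_scaling : ∃ Z : ∀ n, Ω n → ℝ≥0,
    (∀ n, Measurable (Z n)) ∧ (∀ n, ∀ᵐ ω ∂(Pr n), 0 < Z n ω) ∧
    TendstoInLawConst Pr (fun n ω => empiricalMeasure fun i => Z n ω * w n ω i) P ∧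
    TendstoInLawConst Pr
      (fun (n : ℕ+) ω => (∑ i, (Z n ω : ℝ) * (w n ω i : ℝ)) / ((n : ℕ) : ℝ)) (mean P)

/-- Exchangeability of a random vector. -/
def IsExchangeable {Ω : Type*} [MeasurableSpace Ω] (Pr : Measure Ω) {n : ℕ}
    (w : Ω → Fin n → ℝ≥0) : Prop :=
  ∀ σ : Equiv.Perm (Fin n), IdentDistrib (fun ω i => w ω (σ i)) w Pr Pr

/-! ### The limiting laws -/

/-- The Laplace transform `φ` of `P`; only its values on `[0, ∞)` matter. -/
def laplace (P : ProbabilityMeasure ℝ≥0) (t : ℝ) : ℝ :=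
  ∫ x : ℝ≥0, Real.exp (-(t * (x : ℝ))) ∂(P : Measure ℝ≥0)

/-- The inverse of `φ : [0, ∞) → (P {0}, 1]`. -/
def laplaceInv (P : ProbabilityMeasure ℝ≥0) (y : ℝ) : ℝ :=
  Function.invFunOn (laplace P) (Set.Ici 0) y

/-- The mass `P {0}`. -/
def atomZero (P : ProbabilityMeasure ℝ≥0) : ℝ := (P : Measure ℝ≥0).real {0}

/-- The density of the limiting stationary search-cost. -/
def stationaryDensity (P : ProbabilityMeasure ℝ≥0) : ℝ → ℝ :=
  (Set.Icc 0 (1 - atomZero P)).indicator fun x =>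
    -(1 / mean P) *
      (deriv (deriv (laplace P)) (laplaceInv P (1 - x)) / deriv (laplace P) (laplaceInv P (1 - x)))

/-- The height of the out-of-equilibrium part of the limiting density at time `t`. -/
def outHeight (P : ProbabilityMeasure ℝ≥0) (t : ℝ) : ℝ :=
  |deriv (laplace P) t| / (mean P * laplace P t)

/-- The density of the limiting search-cost at time `t`. -/
def transientDensity (P : ProbabilityMeasure ℝ≥0) (t x : ℝ) : ℝ :=
  (Set.Icc 0 (1 - laplace P t)).indicator (stationaryDensity P) x +
    (Set.Icc (1 - laplace P t) 1).indicator (fun _ => outHeight P t) x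

/-- `f` is a probability density on the real line. -/
structure IsProbabilityDensity (f : ℝ → ℝ) : Prop where
  aemeasurable : AEMeasurable f
  nonneg : 0 ≤ᵐ[volume] f
  lintegral_eq_one : ∫⁻ x, ENNReal.ofReal (f x) = 1

/-- The measure with density `f` with respect to Lebesgue measure. -/
def densityMeasure (f : ℝ → ℝ) : Measure ℝ := volume.withDensity fun x => ENNReal.ofReal (f x)

/-- The total variation norm of `Q₁ - Q₂` (equal to `2` for mutually singular probability
measures). -/
def tvDistance (Q₁ Q₂ : Measure ℝ) [IsFiniteMeasure Q₁] [IsFiniteMeasure Q₂] : ℝ :=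
  ((Q₁.toSignedMeasure - Q₂.toSignedMeasure).totalVariation Set.univ).toReal

end MoveToFront

end

open MeasureTheory ProbabilityTheory Filter Topology
open scoped NNReal ENNReal BoundedContinuousFunction

noncomputable section

namespace MoveToFront

/-! The search-cost is read off from windows of time. A request sends its object to the front, and
no other move lets an object overtake one requested in the window, so the objects requested in `[a,
T)` precede all the others. Hence, if `H` objects are not requested in `[a, T)`, the next requested
object stands beyond place `n - H` exactly when it is itself one of them
(`IsRegular.lt_position_iff`). Near the level `1 - H / n` the tail of the cost is thus the
probability that the next object was not requested in the window.

Given the weights, an object escapes a window of length `s` with probability `exp (-p i * s)`,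
independently of the others, and it is next and escapes with probability `p i * exp (-p i * s)`
(`clockLaw_nextRequested_and_notRequested`). Take `s = n * μ * u`. Popularities do not see the
scaling `Z n`, and the law of large numbers makes the average of `exp (-p i * s)` tend to `φ u` in
mean (`tendsto_integral_abs_avgSurvival_sub`). By exchangeability and a second moment bound, `H / n`
tends to `φ u` in probability (`measureReal_unrequestedCount_far_le`). The sum of the `p i * exp (-p
i * s)` is, up to the factor `-μ`, the derivative in `u` of that convex average, so its expectation
tends to `|φ' u| / μ` (`tendsto_integral_nextSurvival`). The limiting tail at `1 - φ u`, for `0 < u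
≤ t`, is therefore `|φ' u| / μ`. This is the stationary tail, since the substitution `x = 1 - φ s`
turns the stationary density into `φ'' s / μ` on `(u, ∞)` (`lintegral_stationaryDensity_Ioo`).

Beyond `1 - φ t` the window is all of `[0, T)`. Objects never requested keep their initial order,
and exchangeability makes the initial place of the next one uniform: a proportion `r` of the objects
shifts the level to `1 - (1 - r) * φ t` and multiplies the tail by `1 - r` (`lt_jointCost_iff`,
`eventually_jointLaw_cost`). This is the uniform piece. Continuity of the limiting tail absorbs the
randomness of the levels (`tendsto_jointLaw_cost`).

Total variation is the `L¹` distance of the densities (`tvDistance_eq_integral`). They differ only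
beyond `1 - φ t`, where both have mass `|φ' t| / μ`; hence the bound by twice this mass. -/

/-! ### The order of the list -/

section ListOrder

variable {n : ℕ}

/-- The objects requested at some step in `[l, k)`. -/
def seen (p : Fin n → ℝ≥0) (e : Fin n × ℕ → ℝ) (l k : ℕ) : Set (Fin n) :=
  {i | ∃ m, l ≤ m ∧ m < k ∧ requested p e m = some i}

lemma moveToFront_lt_iff {pos : Fin n → ℕ} (hinj : Function.Injective pos) {c i j : Fin n}
    (hi : i ≠ c) (hj : j ≠ c) :
    moveToFront pos c i < moveToFront pos c j ↔ pos i < pos j := by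
  have h1 : pos i ≠ pos c := fun h => hi (hinj h)
  have h2 : pos j ≠ pos c := fun h => hj (hinj h)
  simp only [moveToFront, hi, hj, if_false]
  split_ifs <;> omega

lemma moveToFront_front_lt {pos : Fin n → ℕ} (hinj : Function.Injective pos)
    (hpos : ∀ i, 1 ≤ pos i) {c j : Fin n} (hj : j ≠ c) :
    moveToFront pos c c < moveToFront pos c j := by
  have h2 : pos j ≠ pos c := fun h => hj (hinj h)
  have := hpos c
  have := hpos j
  simp only [moveToFront, hj, if_false, if_true]
  split_ifs <;> omega

lemma moveToFront_injective {pos : Fin n → ℕ} (hinj : Function.Injective pos)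
    (hpos : ∀ i, 1 ≤ pos i) (c : Fin n) : Function.Injective (moveToFront pos c) := by
  intro i j h
  by_contra hij
  by_cases hi : i = c
  · subst hi
    exact (moveToFront_front_lt hinj hpos (Ne.symm hij)).ne h
  by_cases hj : j = c
  · subst hj
    exact (moveToFront_front_lt hinj hpos hij).ne' h
  rcases lt_or_gt_of_ne (fun h' => hij (hinj h') : pos i ≠ pos j) with h' | h'
  · exact ((moveToFront_lt_iff hinj hi hj).2 h').ne h
  · exact ((moveToFront_lt_iff hinj hj hi).2 h').ne' h

lemma moveToFront_mem {pos : Fin n → ℕ} (hpos : ∀ i, 1 ≤ pos i ∧ pos i ≤ n) (c i : Fin n) :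
    1 ≤ moveToFront pos c i ∧ moveToFront pos c i ≤ n := by
  have := hpos c
  have := hpos i
  simp only [moveToFront]
  split_ifs <;> omega

variable (π : Equiv.Perm (Fin n)) (p : Fin n → ℝ≥0) (e : Fin n × ℕ → ℝ)

lemma positionAfter_mem_and_injective (k : ℕ) :
    (∀ i, 1 ≤ positionAfter π p e k i ∧ positionAfter π p e k i ≤ n) ∧
      Function.Injective (positionAfter π p e k) := by
  induction k with
  | zero =>
    refine ⟨fun i => ⟨by simp [positionAfter], by simp only [positionAfter]; omega⟩,
      fun i j h => ?_⟩
    simp only [positionAfter, add_left_inj] at h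
    exact π.injective (Fin.ext h)
  | succ k ih =>
    simp only [positionAfter]
    rcases requested p e k with _ | c
    · exact ih
    · exact ⟨moveToFront_mem ih.1 c, moveToFront_injective ih.2 (fun i => (ih.1 i).1) c⟩

lemma seen_succ {l k : ℕ} (h : l ≤ k) (i : Fin n) :
    i ∈ seen p e l (k + 1) ↔ i ∈ seen p e l k ∨ requested p e k = some i := by
  constructor
  · rintro ⟨m, h1, h2, h3⟩
    rcases Nat.lt_succ_iff_lt_or_eq.1 h2 with h2 | rfl
    · exact Or.inl ⟨m, h1, h2, h3⟩
    · exact Or.inr h3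
  · rintro (⟨m, h1, h2, h3⟩ | h3)
    · exact ⟨m, h1, by omega, h3⟩
    · exact ⟨k, h, by omega, h3⟩

/-- Invariant of the rule: an object becomes seen by jumping to the front, and a move of `c`
preserves the relative order of all objects other than `c`. The start `l` is arbitrary because
windows `[a, t)` with `a > 0` are needed. -/
lemma positionAfter_lt_of_seen {l k : ℕ} (hlk : l ≤ k) {i j : Fin n} (hi : i ∈ seen p e l k)
    (hj : j ∉ seen p e l k) : positionAfter π p e k i < positionAfter π p e k j := by
  induction k, hlk using Nat.le_induction with
  | base => obtain ⟨m, h1, h2, -⟩ := hi; omega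
  | succ k hlk ih =>
    obtain ⟨hmem, hinj⟩ := positionAfter_mem_and_injective π p e k
    rw [seen_succ p e hlk] at hi hj
    push Not at hj
    simp only [positionAfter]
    rcases hc : requested p e k with _ | c
    · simpa [hc] using ih (by simpa [hc] using hi) hj.1
    · have hjc : j ≠ c := fun h => hj.2 (by rw [hc, h])
      by_cases hic : i = c
      · subst hic
        exact moveToFront_front_lt hinj (fun i => (hmem i).1) hjc
      · have hi' : i ∈ seen p e l k := by
          rcases hi with hi | hi
          · exact hi
          · rw [hc] at hi; exact absurd (Option.some.inj hi).symm hic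
        exact (moveToFront_lt_iff hinj hic hjc).2 (ih hi' hj.1)

lemma positionAfter_lt_iff_of_unseen {k : ℕ} {i j : Fin n} (hi : i ∉ seen p e 0 k)
    (hj : j ∉ seen p e 0 k) :
    positionAfter π p e k i < positionAfter π p e k j ↔ π i < π j := by
  induction k with
  | zero => simp [positionAfter]
  | succ k ih =>
    obtain ⟨hmem, hinj⟩ := positionAfter_mem_and_injective π p e k
    rw [seen_succ p e (Nat.zero_le k)] at hi hj
    push Not at hi hj
    simp only [positionAfter]
    rcases hc : requested p e k with _ | c
    · exact ih hi.1 hj.1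
    · have hjc : j ≠ c := fun h => hj.2 (by rw [hc, h])
      have hic : i ≠ c := fun h => hi.2 (by rw [hc, h])
      exact (moveToFront_lt_iff hinj hic hjc).trans (ih hi.1 hj.1)

open Classical in
-- An injection of `n` objects into `{1, …, n}` is onto, so a position is one more than the number
-- of objects in front.
lemma card_filter_lt_eq {pos : Fin n → ℕ} (hpos : ∀ i, 1 ≤ pos i ∧ pos i ≤ n)
    (hinj : Function.Injective pos) (i : Fin n) :
    (Finset.univ.filter fun j => pos j < pos i).card + 1 = pos i := by
  have himage : Finset.univ.image pos = Finset.Icc 1 n := by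
    apply Finset.eq_of_subset_of_card_le
    · intro x hx
      obtain ⟨j, -, rfl⟩ := Finset.mem_image.1 hx
      exact Finset.mem_Icc.2 (hpos j)
    · rw [Finset.card_image_of_injective _ hinj]; simp
  have h2 : (Finset.univ.filter fun j => pos j < pos i).image pos = Finset.Ico 1 (pos i) := by
    ext x
    simp only [Finset.mem_image, Finset.mem_filter, Finset.mem_univ, true_and, Finset.mem_Ico]
    constructor
    · rintro ⟨j, hj, rfl⟩
      exact ⟨(hpos j).1, hj⟩
    · rintro ⟨h1, h2⟩
      have : x ∈ Finset.univ.image pos := by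
        rw [himage, Finset.mem_Icc]
        exact ⟨h1, by have := (hpos i).2; omega⟩
      obtain ⟨j, -, rfl⟩ := Finset.mem_image.1 this
      exact ⟨j, h2, rfl⟩
  rw [← Finset.card_image_of_injective _ hinj, h2, Nat.card_Ico]
  have := (hpos i).1
  omega

open Classical in
-- The seen objects form an initial block of the list, so comparing a position with the size of the
-- block decides membership.
lemma card_seen_lt_positionAfter_iff {l k : ℕ} (hlk : l ≤ k) (i : Fin n) :
    (Finset.univ.filter fun j => j ∈ seen p e l k).card < positionAfter π p e k i ↔
      i ∉ seen p e l k := by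
  obtain ⟨hmem, hinj⟩ := positionAfter_mem_and_injective π p e k
  have hcard := card_filter_lt_eq hmem hinj i
  constructor
  · intro h hi
    have hsub : (Finset.univ.filter fun j => positionAfter π p e k j < positionAfter π p e k i) ⊆
        (Finset.univ.filter fun j => j ∈ seen p e l k).erase i := by
      intro j hj
      simp only [Finset.mem_filter, Finset.mem_univ, true_and, Finset.mem_erase] at hj ⊢
      refine ⟨fun h => by simp [h] at hj, ?_⟩
      by_contra hj'
      exact absurd (positionAfter_lt_of_seen π p e hlk hi hj') (by omega)
    have := Finset.card_le_card hsub
    have h3 := Finset.card_erase_add_one (s := Finset.univ.filter fun j => j ∈ seen p e l k)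
      (a := i) (by simpa using hi)
    omega
  · intro hi
    have hsub : (Finset.univ.filter fun j => j ∈ seen p e l k) ⊆
        (Finset.univ.filter fun j => positionAfter π p e k j < positionAfter π p e k i) := by
      intro j hj
      simp only [Finset.mem_filter, Finset.mem_univ, true_and] at hj ⊢
      exact positionAfter_lt_of_seen π p e hlk hj hi
    have := Finset.card_le_card hsub
    omega

open Classical in
-- An unseen object has in front of it the whole block of seen objects, then the unseen ones that
-- started before it; the `≤` in the second count includes the object itself.
lemma positionAfter_of_unseen {k : ℕ} {i : Fin n} (hi : i ∉ seen p e 0 k) :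
    positionAfter π p e k i = (Finset.univ.filter fun j => j ∈ seen p e 0 k).card +
      (Finset.univ.filter fun j => j ∉ seen p e 0 k ∧ π j ≤ π i).card := by
  obtain ⟨hmem, hinj⟩ := positionAfter_mem_and_injective π p e k
  rw [← card_filter_lt_eq hmem hinj i]
  have h1 : (Finset.univ.filter fun j => positionAfter π p e k j < positionAfter π p e k i) =
      (Finset.univ.filter fun j => j ∈ seen p e 0 k) ∪
        (Finset.univ.filter fun j => j ∉ seen p e 0 k ∧ π j < π i) := by
    ext j
    simp only [Finset.mem_filter, Finset.mem_univ, true_and, Finset.mem_union]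
    by_cases hj : j ∈ seen p e 0 k
    · simpa [hj] using positionAfter_lt_of_seen π p e (Nat.zero_le k) hj hi
    · simpa [hj] using positionAfter_lt_iff_of_unseen π p e hj hi
  have h2 : (Finset.univ.filter fun j => j ∉ seen p e 0 k ∧ π j ≤ π i) =
      insert i (Finset.univ.filter fun j => j ∉ seen p e 0 k ∧ π j < π i) := by
    ext j
    simp only [Finset.mem_filter, Finset.mem_univ, true_and, Finset.mem_insert]
    constructor
    · rintro ⟨h, h'⟩
      rcases h'.lt_or_eq with h' | h'
      · exact Or.inr ⟨h, h'⟩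
      · exact Or.inl (π.injective h')
    · rintro (rfl | ⟨h, h'⟩)
      · exact ⟨hi, le_rfl⟩
      · exact ⟨h, h'.le⟩
  rw [h1, h2, Finset.card_insert_of_notMem (by simp), Finset.card_union_of_disjoint, add_assoc]
  rw [Finset.disjoint_left]
  intro j
  simp only [Finset.mem_filter, Finset.mem_univ, true_and]
  tauto

end ListOrder

/-! ### The requests in chronological order -/

section Requests

variable {n : ℕ} {p : Fin n → ℝ≥0} {e : Fin n × ℕ → ℝ}

/-- The almost sure properties of the request times: the interarrival times are positive, each
object with positive popularity is requested infinitely often and at finitely many times before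
any given time, and no two objects are requested simultaneously. -/
structure IsRegular (p : Fin n → ℝ≥0) (e : Fin n × ℕ → ℝ) : Prop where
  pos : ∀ r, 0 < e r
  unbounded : ∀ (i : Fin n) (N : ℕ), ∃ k, (N : ℝ) ≤ ∑ j ∈ Finset.range (k + 1), e (i, j)
  ne_of_ne : ∀ i j : Fin n, i ≠ j → 0 < p i → 0 < p j → ∀ k l : ℕ,
    requestTime p e (i, k) ≠ requestTime p e (j, l)

namespace IsRegular

variable (h : IsRegular p e)
include h

lemma strictMono_sum (i : Fin n) : StrictMono fun k => ∑ j ∈ Finset.range (k + 1), e (i, j) :=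
  strictMono_nat_of_lt_succ fun k => by
    rw [Finset.sum_range_succ _ (k + 1)]
    linarith [h.pos (i, k + 1)]

lemma strictMono_requestTime {i : Fin n} (hi : 0 < p i) :
    StrictMono fun k => requestTime p e (i, k) := fun _ _ hkl =>
  div_lt_div_of_pos_right (h.strictMono_sum i hkl) (NNReal.coe_pos.2 hi)

lemma requestTime_pos {r : Fin n × ℕ} (hr : 0 < p r.1) : 0 < requestTime p e r :=
  div_pos (Finset.sum_pos (fun j _ => h.pos _) (by simp)) (NNReal.coe_pos.2 hr)

lemma requestTime_injective {r s : Fin n × ℕ} (hr : 0 < p r.1) (hs : 0 < p s.1)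
    (hrs : requestTime p e r = requestTime p e s) : r = s := by
  obtain ⟨i, k⟩ := r
  obtain ⟨j, l⟩ := s
  by_cases hij : i = j
  · subst hij
    rw [(h.strictMono_requestTime hr).injective hrs]
  · exact absurd hrs (h.ne_of_ne i j hij hr hs k l)

lemma exists_le_requestTime {i : Fin n} (hi : 0 < p i) (t : ℝ) :
    ∃ k, t ≤ requestTime p e (i, k) := by
  obtain ⟨N, hN⟩ := exists_nat_ge (t * p i)
  obtain ⟨k, hk⟩ := h.unbounded i N
  exact ⟨k, (le_div_iff₀ (NNReal.coe_pos.2 hi)).2 (hN.trans hk)⟩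

lemma finite_requestsBefore (t : ℝ) : (requestsBefore p e t).Finite := by
  have hK : ∀ i : Fin n, ∃ K : ℕ, 0 < p i → t ≤ requestTime p e (i, K) := fun i => by
    by_cases hi : 0 < p i
    · obtain ⟨K, hK⟩ := h.exists_le_requestTime hi t
      exact ⟨K, fun _ => hK⟩
    · exact ⟨0, fun h => absurd h hi⟩
  choose K hK using hK
  refine (Set.finite_iUnion fun i : Fin n => (Set.finite_Iio (K i)).image (Prod.mk i)).subset ?_
  rintro ⟨i, k⟩ ⟨hi, hk⟩
  refine Set.mem_iUnion.2 ⟨i, k, ?_, rfl⟩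
  exact (h.strictMono_requestTime hi).lt_iff_lt.1 (hk.trans_le (hK i hi))

lemma requestCount_mono {s t : ℝ} (hst : s ≤ t) : requestCount p e s ≤ requestCount p e t :=
  Set.ncard_le_ncard (fun _ (hr : _ ∧ _) => ⟨hr.1, hr.2.trans_le hst⟩) (h.finite_requestsBefore t)

/-- A request at time `s` is counted by `requestCount` just after `s` but not at `s`. So
`requestCount` at a request time is the chronological rank of the request, and ranks compare as
times do. -/
lemma requestCount_lt_iff {r : Fin n × ℕ} (hr : 0 < p r.1) (t : ℝ) :
    requestCount p e (requestTime p e r) < requestCount p e t ↔ requestTime p e r < t := by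
  constructor
  · intro hlt
    by_contra hle
    exact absurd (h.requestCount_mono (not_lt.1 hle)) (by omega)
  · intro hlt
    have hsub : requestsBefore p e (requestTime p e r) ⊆ requestsBefore p e t :=
      fun _ hs => ⟨hs.1, hs.2.trans hlt⟩
    exact Set.ncard_lt_ncard ((Set.ssubset_iff_of_subset hsub).2
      ⟨r, ⟨hr, hlt⟩, fun hr' => lt_irrefl _ hr'.2⟩) (h.finite_requestsBefore t)

lemma requestCount_requestTime_injective {r s : Fin n × ℕ} (hr : 0 < p r.1) (hs : 0 < p s.1)
    (hrs : requestCount p e (requestTime p e r) = requestCount p e (requestTime p e s)) :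
    r = s := by
  apply h.requestTime_injective hr hs
  apply le_antisymm <;> by_contra! hlt
  · have := (h.requestCount_lt_iff hs _).2 hlt
    omega
  · have := (h.requestCount_lt_iff hr _).2 hlt
    omega

/-- Distinct requests have distinct ranks, so at most one object passes the test of `find?` and the
order of the enumeration plays no role. -/
lemma requested_eq_some_iff (k : ℕ) (i : Fin n) :
    requested p e k = some i ↔
      0 < p i ∧ ∃ m, requestCount p e (requestTime p e (i, m)) = k := by
  have key : ∀ j, (∃ m : ℕ, 0 < p j ∧ requestCount p e (requestTime p e (j, m)) = k) →
      (∃ m : ℕ, 0 < p i ∧ requestCount p e (requestTime p e (i, m)) = k) → j = i := by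
    rintro j ⟨m, hj, hm⟩ ⟨l, hi, hl⟩
    exact congrArg Prod.fst (h.requestCount_requestTime_injective (r := (j, m)) (s := (i, l))
      hj hi (hm.trans hl.symm))
  constructor
  · intro hk
    obtain ⟨hi, m, hm⟩ := by simpa using List.find?_some hk
    exact ⟨hi, m, hm⟩
  · rintro ⟨hi, m, hm⟩
    unfold requested
    rcases hf : (List.finRange n).find? _ with _ | j
    · have := List.find?_eq_none.1 hf i (List.mem_finRange i)
      simp only [decide_eq_true_eq] at this
      exact absurd ⟨m, hi, hm⟩ this
    · rw [key j (by simpa only [decide_eq_true_eq] using List.find?_some hf) ⟨m, hi, hm⟩]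

lemma mem_seen_iff {a t : ℝ} (i : Fin n) :
    i ∈ seen p e (requestCount p e a) (requestCount p e t) ↔
      0 < p i ∧ ∃ k, a ≤ requestTime p e (i, k) ∧ requestTime p e (i, k) < t := by
  constructor
  · rintro ⟨m, h1, h2, h3⟩
    obtain ⟨hi, k, rfl⟩ := (h.requested_eq_some_iff m i).1 h3
    refine ⟨hi, k, ?_, (h.requestCount_lt_iff (r := (i, k)) hi t).1 h2⟩
    by_contra! hlt
    have := (h.requestCount_lt_iff (r := (i, k)) hi a).2 hlt
    omega
  · rintro ⟨hi, k, h1, h2⟩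
    exact ⟨_, h.requestCount_mono h1, (h.requestCount_lt_iff (r := (i, k)) hi t).2 h2,
      (h.requested_eq_some_iff _ i).2 ⟨hi, k, rfl⟩⟩

lemma nextRequested_eq_some_iff (t : ℝ) (i : Fin n) :
    nextRequested p e t = some i ↔ 0 < p i ∧ ∃ k, t ≤ requestTime p e (i, k) ∧
      ∀ j l, 0 < p j → t ≤ requestTime p e (j, l) →
        requestTime p e (i, k) ≤ requestTime p e (j, l) := by
  rw [nextRequested, h.requested_eq_some_iff]
  refine and_congr_right fun hi => exists_congr fun k => ?_
  constructor
  · intro hk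
    refine ⟨?_, fun j l hj hl => ?_⟩
    · by_contra! hlt
      have := (h.requestCount_lt_iff (r := (i, k)) hi t).2 hlt
      omega
    · by_contra! hlt
      have := (h.requestCount_lt_iff (r := (j, l)) hj _).2 hlt
      have := h.requestCount_mono hl
      omega
  · rintro ⟨h1, h2⟩
    unfold requestCount
    congr 1
    ext ⟨j, l⟩
    refine and_congr_right fun hj => ⟨fun hlt => ?_, fun hlt => hlt.trans_le h1⟩
    by_contra! hle
    exact absurd (h2 j l hj hle) (not_le.2 hlt)

end IsRegular

/-- Object `i` is not requested in `[a, b)`. -/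
def NotRequested (p : Fin n → ℝ≥0) (e : Fin n × ℕ → ℝ) (a b : ℝ) (i : Fin n) : Prop :=
  0 < p i → ∀ k, a ≤ requestTime p e (i, k) → b ≤ requestTime p e (i, k)

/-! ### Positions in terms of the objects not requested in a window. -/

namespace IsRegular

variable (h : IsRegular p e)
include h

lemma notMem_seen_iff {a t : ℝ} (i : Fin n) :
    i ∉ seen p e (requestCount p e a) (requestCount p e t) ↔ NotRequested p e a t i := by
  rw [h.mem_seen_iff, NotRequested]
  push Not
  rfl

lemma requestCount_zero : requestCount p e 0 = 0 := by
  rw [requestCount, Set.ncard_eq_zero (h.finite_requestsBefore 0), Set.eq_empty_iff_forall_notMem]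
  exact fun r hr => absurd hr.2 (h.requestTime_pos hr.1).not_gt

lemma notMem_requestedSet_iff (t : ℝ) (i : Fin n) :
    i ∉ requestedSet p e t ↔ NotRequested p e 0 t i := by
  have : i ∈ requestedSet p e t ↔ 0 < p i ∧ ∃ k, 0 ≤ requestTime p e (i, k) ∧
      requestTime p e (i, k) < t :=
    ⟨fun ⟨k, hi, hk⟩ => ⟨hi, k, (h.requestTime_pos hi).le, hk⟩,
      fun ⟨hi, k, _, hk⟩ => ⟨k, hi, hk⟩⟩
  rw [this, NotRequested]
  push Not
  rfl

open Classical in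
-- The subtracted cardinality counts the objects untouched in `[a, t)`, so the left-hand bound is
-- the size of the block of objects requested there.
lemma lt_position_iff (π : Equiv.Perm (Fin n)) {a t : ℝ} (hat : a ≤ t) (i : Fin n) :
    n - (Finset.univ.filter fun j => NotRequested p e a t j).card < position π p e t i ↔
      NotRequested p e a t i := by
  rw [← h.notMem_seen_iff, position,
    ← card_seen_lt_positionAfter_iff π p e (h.requestCount_mono hat)]
  have h1 := Finset.card_filter_add_card_filter_not (s := (Finset.univ : Finset (Fin n)))
    (fun j => j ∈ seen p e (requestCount p e a) (requestCount p e t))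
  simp only [h.notMem_seen_iff, Finset.card_univ, Fintype.card_fin] at h1
  rw [show n - (Finset.univ.filter fun j => NotRequested p e a t j).card =
    (Finset.univ.filter fun j => j ∈ seen p e (requestCount p e a) (requestCount p e t)).card by
      omega]

open Classical in
-- With the window starting at `0`, no request precedes it and the initial order of the untouched
-- objects survives. The additive form avoids truncated subtraction.
lemma position_eq_of_notRequested (π : Equiv.Perm (Fin n)) {t : ℝ} {i : Fin n}
    (hi : NotRequested p e 0 t i) :
    position π p e t i + (Finset.univ.filter fun j => NotRequested p e 0 t j).card = n +
      (Finset.univ.filter fun j => NotRequested p e 0 t j ∧ π j ≤ π i).card := by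
  have hseen : ∀ j, j ∉ seen p e 0 (requestCount p e t) ↔ NotRequested p e 0 t j := fun j => by
    rw [← h.notMem_seen_iff, h.requestCount_zero]
  have h1 := Finset.card_filter_add_card_filter_not (s := (Finset.univ : Finset (Fin n)))
    (fun j => j ∈ seen p e 0 (requestCount p e t))
  rw [position, positionAfter_of_unseen π p e ((hseen i).2 hi)]
  simp only [hseen, Finset.card_univ, Fintype.card_fin] at h1 ⊢
  omega

end IsRegular

lemma searchCost_eq (π : Equiv.Perm (Fin n)) {t : ℝ} {i : Fin n}
    (hi : nextRequested p e t = some i) : searchCost π p e t = position π p e t i := by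
  simp [searchCost, hi]

lemma searchCost_le (π : Equiv.Perm (Fin n)) (p : Fin n → ℝ≥0) (e : Fin n × ℕ → ℝ) (t : ℝ) :
    searchCost π p e t ≤ n := by
  rcases hi : nextRequested p e t with _ | i
  · simp [searchCost, hi]
  · simpa [searchCost, hi, position] using ((positionAfter_mem_and_injective π p e _).1 i).2

lemma exists_nextRequested_of_searchCost_pos {π : Equiv.Perm (Fin n)} {p : Fin n → ℝ≥0}
    {e : Fin n × ℕ → ℝ} {t : ℝ} (h : 0 < searchCost π p e t) :
    ∃ i, nextRequested p e t = some i := by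
  rcases hi : nextRequested p e t with _ | i
  · simp [searchCost, hi] at h
  · exact ⟨i, rfl⟩

end Requests

/-! ### Measurability -/

section Measurability

variable {n : ℕ} {α : Type*} [MeasurableSpace α]

lemma measurable_ncard_of_countable {β : Type*} [Countable β] {f : α → Set β}
    (hf : ∀ b, MeasurableSet {x | b ∈ f x}) : Measurable fun x => (f x).ncard := by
  have hF : ∀ F : Finset β, MeasurableSet {x | f x = F} := fun F => by
    have : {x | f x = F} = ⋂ b, {x | b ∈ f x ↔ b ∈ F} := by
      ext x
      simp [Set.ext_iff]
    rw [this]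
    refine MeasurableSet.iInter fun b => ?_
    by_cases hb : b ∈ F
    · simpa [hb] using hf b
    · convert (hf b).compl using 1
      ext x
      simp [hb]
  have hpos : ∀ k : ℕ, k ≠ 0 → MeasurableSet {x | (f x).ncard = k} := fun k hk => by
    have : {x | (f x).ncard = k} = ⋃ F : {F : Finset β // F.card = k}, {x | f x = F} := by
      ext x
      simp only [Set.mem_ofPred_eq, Set.mem_iUnion, Subtype.exists, exists_prop]
      constructor
      · intro hx
        have hfin := Set.finite_of_ncard_ne_zero (hx ▸ hk)
        exact ⟨hfin.toFinset, by rw [← Set.ncard_eq_toFinset_card _ hfin, hx], by simp⟩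
      · rintro ⟨F, hF, hx⟩
        rw [hx, Set.ncard_coe_finset, hF]
    rw [this]
    exact MeasurableSet.iUnion fun F => hF F
  -- `ncard` is `0` both on the empty set and on infinite sets, so the level `0` is obtained as the
  -- complement of all the others.
  refine measurable_to_nat fun y => ?_
  by_cases hy : (f y).ncard = 0
  · have : (fun x => (f x).ncard) ⁻¹' {(f y).ncard} =
        (⋃ k : ℕ, {x | (f x).ncard = k + 1})ᶜ := by
      ext x
      simp only [hy, Set.mem_preimage, Set.mem_singleton_iff, Set.mem_compl_iff, Set.mem_iUnion,
        Set.mem_ofPred_eq, not_exists]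
      exact ⟨fun h k => by omega, fun h => by
        by_contra h0
        exact h _ (Nat.succ_pred_eq_of_ne_zero h0).symm⟩
    rw [this]
    exact (MeasurableSet.iUnion fun k => hpos (k + 1) k.succ_ne_zero).compl
  · exact hpos _ hy

variable {p : α → Fin n → ℝ≥0} {e : α → Fin n × ℕ → ℝ} {t : α → ℝ}

lemma measurable_popularity : Measurable (popularity : (Fin n → ℝ≥0) → Fin n → ℝ≥0) :=
  measurable_pi_lambda _ fun i => by
    unfold popularity
    fun_prop

lemma measurable_requestTime (hp : Measurable p) (he : Measurable e) (r : Fin n × ℕ) :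
    Measurable fun x => requestTime (p x) (e x) r := by
  unfold requestTime
  have := fun r => (measurable_pi_apply r).comp he
  have := fun r => (measurable_pi_apply r).comp hp
  refine Measurable.div (Finset.measurable_fun_sum _ fun j _ => ?_)
    (measurable_coe_nnreal_real.comp ?_) <;> solve_by_elim

lemma measurableSet_popularity_pos (hp : Measurable p) (i : Fin n) :
    MeasurableSet {x | 0 < p x i} :=
  measurableSet_lt measurable_const ((measurable_pi_apply i).comp hp)

lemma measurable_requestCount (hp : Measurable p) (he : Measurable e) (ht : Measurable t) :
    Measurable fun x => requestCount (p x) (e x) (t x) :=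
  measurable_ncard_of_countable fun r => (measurableSet_popularity_pos hp r.1).inter
    (measurableSet_lt (measurable_requestTime hp he r) ht)

attribute [local instance] Classical.propDecidable in
-- The search only sees a vector of `n` truth values; these form a finite space, on which every map
-- is measurable.
lemma measurable_requested (hp : Measurable p) (he : Measurable e) (k : ℕ) :
    Measurable[_, ⊤] fun x => requested (p x) (e x) k := by
  let _ : MeasurableSpace (Option (Fin n)) := ⊤
  have h1 : Measurable fun x (i : Fin n) =>
      ∃ m : ℕ, 0 < p x i ∧ requestCount (p x) (e x) (requestTime (p x) (e x) (i, m)) = k := by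
    refine measurable_pi_lambda _ fun i => measurableSet_setOfPred.1 ?_
    simp only [Set.ofPred_exists]
    exact MeasurableSet.iUnion fun m => (measurableSet_popularity_pos hp i).inter
      (measurable_requestCount hp he (measurable_requestTime hp he (i, m))
        (measurableSet_singleton k))
  have h2 : Measurable fun b : Fin n → Prop => (List.finRange n).find? fun i => decide (b i) :=
    measurable_of_finite _
  convert h2.comp h1 using 1
  funext x
  simp only [requested, Function.comp_def]

lemma measurable_positionAfter (π : Equiv.Perm (Fin n)) (hp : Measurable p) (he : Measurable e)
    (k : ℕ) : Measurable fun x => positionAfter π (p x) (e x) k := by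
  let _ : MeasurableSpace (Option (Fin n)) := ⊤
  have : DiscreteMeasurableSpace (Option (Fin n)) := ⟨fun _ => trivial⟩
  induction k with
  | zero => exact measurable_const
  | succ k ih =>
    have h2 : Measurable fun q : Option (Fin n) × (Fin n → ℕ) =>
        q.1.elim q.2 (moveToFront q.2) := measurable_of_countable _
    exact h2.comp ((measurable_requested hp he k).prodMk ih)

lemma measurableSet_nextRequested (hp : Measurable p) (he : Measurable e) (ht : Measurable t)
    (i : Fin n) : MeasurableSet {x | nextRequested (p x) (e x) (t x) = some i} := by
  have : {x | nextRequested (p x) (e x) (t x) = some i} = ⋃ k : ℕ,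
      {x | requestCount (p x) (e x) (t x) = k} ∩ {x | requested (p x) (e x) k = some i} := by
    ext x
    simp [nextRequested]
  rw [this]
  exact MeasurableSet.iUnion fun k =>
    (measurable_requestCount hp he ht (measurableSet_singleton k)).inter
      (measurable_requested hp he k (t := {some i}) trivial)

lemma measurable_position (π : Equiv.Perm (Fin n)) (hp : Measurable p) (he : Measurable e)
    (ht : Measurable t) (i : Fin n) : Measurable fun x => position π (p x) (e x) (t x) i := by
  have h1 : Measurable fun q : ℕ × α => positionAfter π (p q.2) (e q.2) q.1 i :=
    measurable_from_prod_countable_right fun k =>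
      (measurable_pi_apply i).comp (measurable_positionAfter π hp he k)
  exact h1.comp ((measurable_requestCount hp he ht).prodMk measurable_id)

lemma measurable_searchCost (π : Equiv.Perm (Fin n)) (hp : Measurable p) (he : Measurable e)
    (ht : Measurable t) : Measurable fun x => searchCost π (p x) (e x) (t x) :=
  Finset.measurable_fun_sum _ fun i _ => Measurable.ite (measurableSet_nextRequested hp he ht i)
    (measurable_position π hp he ht i) measurable_const

lemma measurableSet_notRequested (hp : Measurable p) (he : Measurable e) (a b : ℝ) (i : Fin n) :
    MeasurableSet {x | NotRequested (p x) (e x) a b i} := by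
  have : {x | NotRequested (p x) (e x) a b i} = {x | 0 < p x i}ᶜ ∪ ⋂ k,
      ({x | a ≤ requestTime (p x) (e x) (i, k)}ᶜ ∪ {x | b ≤ requestTime (p x) (e x) (i, k)}) := by
    ext x
    simp only [NotRequested, Set.mem_ofPred_eq, Set.mem_union, Set.mem_compl_iff, Set.mem_iInter]
    simp only [imp_iff_not_or]
  rw [this]
  exact (measurableSet_popularity_pos hp i).compl.union <| MeasurableSet.iInter fun k =>
    (measurableSet_le measurable_const (measurable_requestTime hp he _)).compl.union
      (measurableSet_le measurable_const (measurable_requestTime hp he _))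

lemma measurableSet_isRegular (hp : Measurable p) (he : Measurable e) :
    MeasurableSet {x | IsRegular (p x) (e x)} := by
  have : {x | IsRegular (p x) (e x)} = (⋂ r, {x | 0 < e x r}) ∩
      (⋂ (i : Fin n) (N : ℕ), ⋃ k, {x | (N : ℝ) ≤ ∑ j ∈ Finset.range (k + 1), e x (i, j)}) ∩
      ⋂ (i : Fin n) (j : Fin n) (k : ℕ) (l : ℕ), ({x | i = j} ∪ {x | 0 < p x i}ᶜ ∪
        {x | 0 < p x j}ᶜ ∪
        {x | requestTime (p x) (e x) (i, k) = requestTime (p x) (e x) (j, l)}ᶜ) := by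
    ext x
    simp only [Set.mem_inter_iff, Set.mem_iInter, Set.mem_iUnion, Set.mem_union,
      Set.mem_compl_iff, Set.mem_ofPred_eq]
    constructor
    · rintro ⟨h1, h2, h3⟩
      refine ⟨⟨h1, h2⟩, fun i j k l => ?_⟩
      have := h3 i j
      tauto
    · rintro ⟨⟨h1, h2⟩, h3⟩
      refine ⟨h1, h2, fun i j hij hi hj k l => ?_⟩
      have := h3 i j k l
      tauto
  have he' : ∀ r, Measurable fun x => e x r := fun r => (measurable_pi_apply r).comp he
  rw [this]
  refine ((MeasurableSet.iInter fun r => measurableSet_lt measurable_const (he' r)).inter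
    (MeasurableSet.iInter fun i => MeasurableSet.iInter fun N => MeasurableSet.iUnion fun k =>
      measurableSet_le measurable_const (Finset.measurable_fun_sum _ fun j _ => he' _))).inter
    (MeasurableSet.iInter fun i => MeasurableSet.iInter fun j => MeasurableSet.iInter fun k =>
      MeasurableSet.iInter fun l => ?_)
  exact (((MeasurableSet.const _).union (measurableSet_popularity_pos hp i).compl).union
    (measurableSet_popularity_pos hp j).compl).union
    (measurableSet_eq_fun (measurable_requestTime hp he _) (measurable_requestTime hp he _)).compl

end Measurability

/-! ### A renewal computation for the Poisson process -/

section Renewal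

instance : IsProbabilityMeasure (expMeasure 1) := isProbabilityMeasure_expMeasure one_pos

lemma lintegral_expMeasure_one {f : ℝ → ℝ≥0∞} (hf : Measurable f) :
    ∫⁻ x, f x ∂(expMeasure 1) = ∫⁻ x in Set.Ici 0, ENNReal.ofReal (Real.exp (-x)) * f x := by
  have hm : Measurable (exponentialPDF 1) := (measurable_exponentialPDFReal 1).ennreal_ofReal
  rw [show expMeasure 1 = volume.withDensity (exponentialPDF 1) from rfl,
    lintegral_withDensity_eq_lintegral_mul _ hm hf, ← lintegral_indicator measurableSet_Ici]
  congr 1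
  funext x
  by_cases hx : 0 ≤ x
  · simp [Set.indicator_of_mem (Set.mem_Ici.2 hx), exponentialPDF_of_nonneg hx]
  · simp [Set.indicator_of_notMem (fun h => hx (Set.mem_Ici.1 h)),
      exponentialPDF_of_neg (not_le.1 hx)]

/-- The memoryless property of the exponential law. -/
lemma lintegral_expMeasure_one_shift {g : ℝ → ℝ≥0∞} (hg : Measurable g) {c : ℝ} (hc : 0 ≤ c) :
    ∫⁻ x, (Set.Ici c).indicator (fun x => g (x - c)) x ∂(expMeasure 1) =
      ENNReal.ofReal (Real.exp (-c)) * ∫⁻ x, g x ∂(expMeasure 1) := by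
  have hm : Measurable fun x => (Set.Ici c).indicator (fun x => g (x - c)) x :=
    (hg.comp (measurable_id.sub_const c)).indicator measurableSet_Ici
  rw [lintegral_expMeasure_one hm, lintegral_expMeasure_one hg,
    ← lintegral_const_mul _ (by fun_prop), ← lintegral_indicator measurableSet_Ici,
    ← lintegral_indicator measurableSet_Ici]
  refine Eq.trans (lintegral_congr fun x => ?_) (lintegral_sub_right_eq_self _ c)
  by_cases hx : c ≤ x
  · have h0 : 0 ≤ x := hc.trans hx
    simp only [Set.indicator, Set.mem_Ici, hx, h0, sub_nonneg, if_true]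
    rw [← mul_assoc, ← ENNReal.ofReal_mul (Real.exp_nonneg _), ← Real.exp_add]
    ring_nf
  · have : ¬ 0 ≤ x - c := by simpa using hx
    simp [Set.indicator, hx]

lemma expMeasure_one_Ici {c : ℝ} (hc : 0 ≤ c) :
    expMeasure 1 (Set.Ici c) = ENNReal.ofReal (Real.exp (-c)) := by
  have := lintegral_expMeasure_one_shift (g := fun _ => 1) measurable_const hc
  simpa [lintegral_indicator measurableSet_Ici] using this

/-- The law of independent exponential interarrival times. -/
def interarrivalLaw : Measure (ℕ → ℝ) := Measure.infinitePi fun _ => expMeasure 1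

instance : IsProbabilityMeasure interarrivalLaw :=
  inferInstanceAs (IsProbabilityMeasure (Measure.infinitePi fun _ => expMeasure 1))

/-- The time of the `k`-th arrival (with the convention that the `0`-th is at time `0`). -/
def arrival (k : ℕ) (x : ℕ → ℝ) : ℝ := ∑ j ∈ Finset.range k, x j

@[fun_prop]
lemma measurable_arrival (k : ℕ) : Measurable (arrival k) := by
  unfold arrival
  fun_prop

/-- The `k`-th arrival is a sum of the gaps before index `k`, hence independent of gap `k`; Fubini
then integrates the last gap separately. -/
lemma lintegral_arrival_succ {F : ℝ × ℝ → ℝ≥0∞} (hF : Measurable F) (k : ℕ) :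
    ∫⁻ x, F (arrival k x, x k) ∂interarrivalLaw =
      ∫⁻ x, ∫⁻ z, F (arrival k x, z) ∂(expMeasure 1) ∂interarrivalLaw := by
  have hind : iIndepFun (fun (j : ℕ) (x : ℕ → ℝ) => x j) interarrivalLaw :=
    iIndepFun_infinitePi (P := fun _ : ℕ => expMeasure 1) (X := fun _ x => x)
      fun _ => measurable_id
  have hind' : IndepFun (arrival k) (fun x => x k) interarrivalLaw := by
    have := hind.indepFun_finsetSum_of_notMem (fun j => measurable_pi_apply j)
      (s := Finset.range k) (i := k) (by simp)
    convert this using 1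
    funext x
    simp [arrival]
  have hmap := (indepFun_iff_map_prod_eq_prod_map_map (measurable_arrival k).aemeasurable
    (measurable_pi_apply k).aemeasurable).1 hind'
  have hk : interarrivalLaw.map (fun x => x k) = expMeasure 1 :=
    Measure.infinitePi_map_eval (fun _ : ℕ => expMeasure 1) k
  rw [hk] at hmap
  have hpair : Measurable fun x : ℕ → ℝ => (arrival k x, x k) :=
    (measurable_arrival k).prodMk (measurable_pi_apply k)
  rw [← lintegral_map hF hpair, hmap, lintegral_prod _ hF.aemeasurable,
    lintegral_map hF.lintegral_prod_right' (measurable_arrival k)]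

/-- The arrival `k + 1` is the first one at or after `b`, and there is none in `[a, b)`. -/
def FirstArrival (a b : ℝ) (k : ℕ) (x : ℕ → ℝ) : Prop :=
  (k = 0 ∨ arrival k x < a) ∧ b ≤ arrival (k + 1) x

lemma measurableSet_firstArrival (a b : ℝ) (k : ℕ) : MeasurableSet {x | FirstArrival a b k x} :=
  ((MeasurableSet.const _).union (measurableSet_lt (measurable_arrival k) measurable_const)).inter
    (measurableSet_le measurable_const (measurable_arrival _))

lemma measurableSet_arrival_lt (a : ℝ) (k : ℕ) :
    MeasurableSet {x | k = 0 ∨ arrival k x < a} :=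
  (MeasurableSet.const _).union (measurableSet_lt (measurable_arrival k) measurable_const)

/-- Condition on arrival `k`, which lies before `a`. The next gap must exceed `b - arrival k x`,
which costs the exponential factor, and by lack of memory the overshoot beyond `b` is again a unit
exponential variable. -/
lemma lintegral_firstArrival {g : ℝ → ℝ≥0∞} (hg : Measurable g) {a b : ℝ} (ha : 0 ≤ a)
    (hab : a ≤ b) (k : ℕ) :
    ∫⁻ x, {x | FirstArrival a b k x}.indicator (fun x => g (arrival (k + 1) x - b)) x
        ∂interarrivalLaw =
      (∫⁻ x, {x | k = 0 ∨ arrival k x < a}.indicator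
        (fun x => ENNReal.ofReal (Real.exp (-(b - arrival k x)))) x ∂interarrivalLaw) *
      ∫⁻ z, g z ∂(expMeasure 1) := by
  have hE : MeasurableSet {y : ℝ | k = 0 ∨ y < a} :=
    (MeasurableSet.const _).union measurableSet_Iio
  let F : ℝ × ℝ → ℝ≥0∞ := ({q : ℝ × ℝ | k = 0 ∨ q.1 < a} ∩ {q | b ≤ q.1 + q.2}).indicator
    fun q => g (q.1 + q.2 - b)
  have hF : Measurable F := Measurable.indicator (by fun_prop)
    ((measurable_fst hE).inter (measurableSet_le (by fun_prop) (by fun_prop)))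
  have h1 : ∀ x, {x | FirstArrival a b k x}.indicator (fun x => g (arrival (k + 1) x - b)) x =
      F (arrival k x, x k) := fun x => by
    simp only [F, Set.indicator, FirstArrival, Set.mem_inter_iff, Set.mem_ofPred_eq, arrival,
      Finset.sum_range_succ]
  simp_rw [h1]
  rw [lintegral_arrival_succ hF, ← lintegral_mul_const _
    (Measurable.indicator (by fun_prop) (measurableSet_arrival_lt a k))]
  refine lintegral_congr fun x => ?_
  by_cases hx : k = 0 ∨ arrival k x < a
  -- Ensures that the shift `b - arrival k x` is nonnegative. The clause `k = 0` matters when `a =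
  -- 0`, where the conventional arrival at time `0` is not strictly before `a`.
  · have hxa : arrival k x ≤ a := by
      rcases hx with rfl | hx
      · simpa [arrival] using ha
      · exact hx.le
    rw [Set.indicator_of_mem (show x ∈ {x | k = 0 ∨ arrival k x < a} from hx),
      ← lintegral_expMeasure_one_shift hg (by linarith)]
    refine lintegral_congr fun z => ?_
    simp only [F, Set.indicator, Set.mem_inter_iff, Set.mem_ofPred_eq, hx, true_and, Set.mem_Ici,
      sub_le_iff_le_add']
    rw [sub_sub_eq_add_sub, add_comm z]
  · rw [Set.indicator_of_notMem (show x ∉ {x | k = 0 ∨ arrival k x < a} from hx)]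
    simp [F, hx]

/-- The almost sure properties of the interarrival times. -/
def IsRegularRow (x : ℕ → ℝ) : Prop :=
  (∀ j, 0 < x j) ∧ ∀ N : ℕ, ∃ k, (N : ℝ) ≤ arrival (k + 1) x

lemma ae_isRegularRow : ∀ᵐ x ∂interarrivalLaw, IsRegularRow x := by
  have h0 : ∀ᵐ x ∂interarrivalLaw, ∀ j, 0 < x j := by
    refine ae_all_iff.2 fun j => ?_
    have hk : interarrivalLaw.map (fun x => x j) = expMeasure 1 :=
      Measure.infinitePi_map_eval (fun _ : ℕ => expMeasure 1) j
    have : ∀ᵐ z ∂(expMeasure 1), 0 < z := by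
      rw [show expMeasure 1 = volume.withDensity (exponentialPDF 1) from rfl,
        ae_withDensity_iff (show Measurable (exponentialPDF 1) from
          (measurable_exponentialPDFReal 1).ennreal_ofReal)]
      filter_upwards [Measure.ae_ne volume (0 : ℝ)] with z hz hz'
      by_contra hneg
      exact hz' (exponentialPDF_of_neg (lt_of_le_of_ne (not_lt.1 hneg) hz))
    rw [← hk] at this
    exact ae_of_ae_map (measurable_pi_apply j).aemeasurable this
  -- Arrival times are unbounded because single gaps already are: the probability that `m`
  -- independent gaps all stay below `N` is a power `m` of a number less than `1`.
  have h1 : ∀ᵐ x ∂interarrivalLaw, ∀ N : ℕ, ∃ k, (N : ℝ) ≤ x k := by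
    refine ae_all_iff.2 fun N => ?_
    rw [ae_iff]
    have hlt : expMeasure 1 (Set.Iio (N : ℝ)) < 1 := by
      rw [← Set.compl_Ici, prob_compl_eq_one_sub measurableSet_Ici,
        expMeasure_one_Ici (Nat.cast_nonneg N)]
      exact ENNReal.sub_lt_self (by simp) (by simp) (by simpa using Real.exp_pos _)
    refine le_antisymm (ge_of_tendsto' (ENNReal.tendsto_pow_atTop_nhds_zero_of_lt_one hlt)
      fun m => ?_) bot_le
    have := Measure.infinitePi_pi (μ := fun _ : ℕ => expMeasure 1) (s := Finset.range m)
      (t := fun _ => Set.Iio (N : ℝ)) fun _ _ => measurableSet_Iio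
    simp only [Finset.prod_const, Finset.card_range] at this
    rw [← this]
    refine measure_mono fun x hx j _ => ?_
    simp only [Set.mem_ofPred_eq, not_exists, not_le] at hx
    exact hx j
  filter_upwards [h0, h1] with x hx hx'
  refine ⟨hx, fun N => ?_⟩
  obtain ⟨k, hk⟩ := hx' N
  exact ⟨k, hk.trans (Finset.single_le_sum (fun j _ => (hx j).le) (by simp))⟩

lemma IsRegularRow.strictMono {x : ℕ → ℝ} (hx : IsRegularRow x) :
    StrictMono fun k => arrival k x :=
  strictMono_nat_of_lt_succ fun k => by
    rw [arrival, arrival, Finset.sum_range_succ]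
    linarith [hx.1 k]

lemma IsRegularRow.existsUnique_firstArrival {x : ℕ → ℝ} (hx : IsRegularRow x) (a : ℝ) :
    ∃! k, FirstArrival a a k x := by
  classical
  have hex : ∃ k, a ≤ arrival (k + 1) x := by
    obtain ⟨N, hN⟩ := exists_nat_ge a
    exact (hx.2 N).imp fun k hk => hN.trans hk
  refine ⟨Nat.find hex, ⟨?_, Nat.find_spec hex⟩, fun k hk => ?_⟩
  · by_cases h : Nat.find hex = 0
    · exact Or.inl h
    · have := Nat.find_min hex (m := Nat.find hex - 1) (by omega)
      rw [Nat.sub_add_cancel (by omega)] at this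
      exact Or.inr (not_le.1 this)
  · refine le_antisymm ?_ (Nat.find_min' hex hk.2)
    by_contra! hlt
    rcases hk.1 with rfl | hk1
    · omega
    · have := hx.strictMono.monotone (show Nat.find hex + 1 ≤ k by omega)
      have := Nat.find_spec hex
      simp only at *
      linarith

/-- With `b = a` and `g = 1`, the `k`-th term is the probability that arrival `k + 1` is the first
one at or after `a`. Almost surely exactly one `k` qualifies, so no renewal measure has to be
computed. -/
lemma tsum_lintegral_exp_arrival {a : ℝ} (ha : 0 ≤ a) :
    ∑' k : ℕ, ∫⁻ x, {x | k = 0 ∨ arrival k x < a}.indicator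
        (fun x => ENNReal.ofReal (Real.exp (-(a - arrival k x)))) x ∂interarrivalLaw = 1 := by
  have h1 : ∀ k : ℕ, ∫⁻ x, {x | k = 0 ∨ arrival k x < a}.indicator
        (fun x => ENNReal.ofReal (Real.exp (-(a - arrival k x)))) x ∂interarrivalLaw =
      ∫⁻ x, {x | FirstArrival a a k x}.indicator (fun _ => 1) x ∂interarrivalLaw := fun k => by
    rw [lintegral_firstArrival (g := fun _ => 1) measurable_const ha le_rfl]
    simp
  simp_rw [h1]
  rw [← lintegral_tsum fun k =>
    (measurable_const.indicator (measurableSet_firstArrival a a k)).aemeasurable]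
  have : ∀ᵐ x ∂interarrivalLaw,
      ∑' k, {x | FirstArrival a a k x}.indicator (fun _ => (1 : ℝ≥0∞)) x = 1 := by
    filter_upwards [ae_isRegularRow] with x hx
    obtain ⟨k, hk, huniq⟩ := hx.existsUnique_firstArrival a
    rw [tsum_eq_single k fun l hl => Set.indicator_of_notMem (s := {x | FirstArrival a a l x})
      (fun h => hl (huniq l h)) _]
    exact Set.indicator_of_mem (show x ∈ {x | FirstArrival a a k x} from hk) _
  rw [lintegral_congr_ae this]
  simp

/-- The law of the delay before the first arrival after `b`, on the event that there is no arrival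
in `[a, b)`. -/
lemma tsum_lintegral_firstArrival {g : ℝ → ℝ≥0∞} (hg : Measurable g) {a b : ℝ} (ha : 0 ≤ a)
    (hab : a ≤ b) :
    ∑' k : ℕ, ∫⁻ x, {x | FirstArrival a b k x}.indicator (fun x => g (arrival (k + 1) x - b)) x
        ∂interarrivalLaw =
      ENNReal.ofReal (Real.exp (-(b - a))) * ∫⁻ z, g z ∂(expMeasure 1) := by
  simp_rw [lintegral_firstArrival hg ha hab]
  rw [ENNReal.tsum_mul_right]
  congr 1
  -- The factor `exp (-(b - a))` splits off every term, and the remaining sum is the case `b = a`,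
  -- equal to `1`.
  rw [← mul_one (ENNReal.ofReal _), ← tsum_lintegral_exp_arrival ha, ← ENNReal.tsum_mul_left]
  refine tsum_congr fun k => ?_
  rw [← lintegral_const_mul _ (Measurable.indicator (by fun_prop)
    (measurableSet_arrival_lt a k))]
  refine lintegral_congr fun x => ?_
  by_cases hx : x ∈ {x | k = 0 ∨ arrival k x < a}
  · rw [Set.indicator_of_mem hx, Set.indicator_of_mem hx,
      ← ENNReal.ofReal_mul (Real.exp_nonneg _), ← Real.exp_add]
    ring_nf
  · rw [Set.indicator_of_notMem hx, Set.indicator_of_notMem hx, mul_zero]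

/-- Translates the index-wise events, over which the sums run, into the absence of arrivals in `[a,
b)`. -/
lemma IsRegularRow.exists_firstArrival_iff {x : ℕ → ℝ} (hx : IsRegularRow x) {a b : ℝ} :
    (∃ k, FirstArrival a b k x) ↔ ∀ k, a ≤ arrival (k + 1) x → b ≤ arrival (k + 1) x := by
  constructor
  · rintro ⟨k, hk1, hk2⟩ l hl
    refine hk2.trans (hx.strictMono.monotone (Nat.succ_le_succ ?_))
    rcases hk1 with rfl | hk1
    · exact l.zero_le
    · exact Nat.lt_succ_iff.1 (hx.strictMono.lt_iff_lt.1 (hk1.trans_le hl))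
  · intro h
    obtain ⟨k, hk, -⟩ := hx.existsUnique_firstArrival a
    exact ⟨k, hk.1, h k hk.2⟩

lemma FirstArrival.mono {a b : ℝ} {k : ℕ} {x : ℕ → ℝ} (h : FirstArrival a b k x)
    (hab : a ≤ b) : FirstArrival a a k x := ⟨h.1, hab.trans h.2⟩

/-- The probability that the Poisson process has no arrival in `[a, b)`. -/
lemma interarrivalLaw_no_arrival {a b : ℝ} (ha : 0 ≤ a) (hab : a ≤ b) :
    interarrivalLaw {x | ∀ k, a ≤ arrival (k + 1) x → b ≤ arrival (k + 1) x} =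
      ENNReal.ofReal (Real.exp (-(b - a))) := by
  have h1 := tsum_lintegral_firstArrival (g := fun _ => 1) measurable_const ha hab
  simp only [lintegral_const, measure_univ, mul_one] at h1
  rw [← h1, ← lintegral_tsum fun k =>
    (measurable_const.indicator (measurableSet_firstArrival a b k)).aemeasurable,
    ← lintegral_indicator_one]
  · refine lintegral_congr_ae ?_
    filter_upwards [ae_isRegularRow] with x hx
    by_cases hex : ∃ k, FirstArrival a b k x
    · rw [Set.indicator_of_mem (s := {x | ∀ k, a ≤ arrival (k + 1) x → b ≤ arrival (k + 1) x})
        ((hx.exists_firstArrival_iff).1 hex)]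
      obtain ⟨k, hk⟩ := hex
      rw [tsum_eq_single k fun l hl => Set.indicator_of_notMem
        (s := {x | FirstArrival a b l x})
          (fun h => hl ((hx.existsUnique_firstArrival a).unique (FirstArrival.mono h hab) (hk.mono hab))) _,
        Set.indicator_of_mem (show x ∈ {x | FirstArrival a b k x} from hk)]
      rfl
    · rw [Set.indicator_of_notMem
        (s := {x | ∀ k, a ≤ arrival (k + 1) x → b ≤ arrival (k + 1) x})
        (fun h => hex ((hx.exists_firstArrival_iff).2 h))]
      refine (ENNReal.tsum_eq_zero.2 fun k => Set.indicator_of_notMem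
        (s := {x | FirstArrival a b k x}) (fun h => hex ⟨k, h⟩) _).symm
  · simp only [Set.ofPred_forall]
    refine MeasurableSet.iInter fun k => ?_
    exact (MeasurableSet.imp (measurableSet_le measurable_const (measurable_arrival _))
      (measurableSet_le measurable_const (measurable_arrival _)))

end Renewal

/-! ### The requests for fixed popularities -/

lemma _root_.ProbabilityTheory.IndepFun.measure_prodMk_mem {Ω A B : Type*} [MeasurableSpace Ω]
    [MeasurableSpace A] [MeasurableSpace B] {μ : Measure Ω} [IsProbabilityMeasure μ] {X : Ω → A}
    {Y : Ω → B} (h : IndepFun X Y μ) (hX : AEMeasurable X μ) (hY : AEMeasurable Y μ)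
    {S : Set (A × B)} (hS : MeasurableSet S) :
    μ {ω | (X ω, Y ω) ∈ S} = ∫⁻ ω, μ {ω' | (X ω, Y ω') ∈ S} ∂μ := by
  have hmap := (indepFun_iff_map_prod_eq_prod_map_map hX hY).1 h
  have := Measure.isProbabilityMeasure_map hY
  have h1 : μ {ω | (X ω, Y ω) ∈ S} = μ.map (fun ω => (X ω, Y ω)) S :=
    (Measure.map_apply_of_aemeasurable (hX.prodMk hY) hS).symm
  rw [h1, hmap, Measure.prod_apply hS,
    lintegral_map' (measurable_measure_prodMk_left hS).aemeasurable hX]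
  refine lintegral_congr fun ω => ?_
  rw [Measure.map_apply_of_aemeasurable hY (measurable_prodMk_left hS)]
  rfl

section Clock

variable {n : ℕ}

/-- The law of the clock: independent exponential variables of parameter `1`. -/
def clockLaw (n : ℕ) : Measure (Fin n × ℕ → ℝ) := Measure.infinitePi fun _ => expMeasure 1

instance : IsProbabilityMeasure (clockLaw n) :=
  inferInstanceAs (IsProbabilityMeasure (Measure.infinitePi fun _ => expMeasure 1))

/-- The interarrival times of object `i`. -/
def row (i : Fin n) (e : Fin n × ℕ → ℝ) : ℕ → ℝ := fun k => e (i, k)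

@[fun_prop]
lemma measurable_row (i : Fin n) : Measurable (row i) :=
  measurable_pi_lambda _ fun k => measurable_pi_apply (i, k)

lemma map_row_clockLaw :
    (clockLaw n).map (fun e i => row i e) = Measure.infinitePi fun _ => interarrivalLaw :=
  Measure.infinitePi_map_curry fun (_ : Fin n) (_ : ℕ) => expMeasure 1

lemma map_row (i : Fin n) : (clockLaw n).map (row i) = interarrivalLaw := by
  rw [← Measure.infinitePi_map_eval (fun _ : Fin n => interarrivalLaw) i, ← map_row_clockLaw,
    Measure.map_map (measurable_pi_apply i) (measurable_pi_lambda _ measurable_row)]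
  rfl

/-- Currying an infinite product measure gives a product over objects of the laws of the rows. -/
lemma iIndepFun_row : iIndepFun (fun (i : Fin n) => row i) (clockLaw n) := by
  rw [iIndepFun_iff_map_fun_eq_infinitePi_map measurable_row, map_row_clockLaw]
  simp_rw [map_row]

lemma clockLaw_row_mem (i : Fin n) {S : Set (ℕ → ℝ)} (hS : MeasurableSet S) :
    clockLaw n {e | row i e ∈ S} = interarrivalLaw S := by
  rw [← map_row i, Measure.map_apply (measurable_row i) hS]
  rfl

lemma ae_clockLaw_row {Q : (ℕ → ℝ) → Prop} (hQ : ∀ᵐ x ∂interarrivalLaw, Q x) (i : Fin n) :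
    ∀ᵐ e ∂(clockLaw n), Q (row i e) := by
  rw [← map_row i] at hQ
  exact ae_of_ae_map (measurable_row i).aemeasurable hQ

/-- No arrival during `[a, b)` of the process of rate `q`. -/
def noArrival (q : ℝ≥0) (a b : ℝ) : Set (ℕ → ℝ) :=
  {x | 0 < q → ∀ k, q * a ≤ arrival (k + 1) x → q * b ≤ arrival (k + 1) x}

lemma measurableSet_noArrival (q : ℝ≥0) (a b : ℝ) : MeasurableSet (noArrival q a b) := by
  refine MeasurableSet.imp (MeasurableSet.const _) ?_
  simp only [Set.ofPred_forall]
  exact MeasurableSet.iInter fun k => MeasurableSet.imp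
    (measurableSet_le measurable_const (measurable_arrival _))
    (measurableSet_le measurable_const (measurable_arrival _))

lemma interarrivalLaw_noArrival (q : ℝ≥0) {a b : ℝ} (ha : 0 ≤ a) (hab : a ≤ b) :
    interarrivalLaw (noArrival q a b) = ENNReal.ofReal (Real.exp (-(q * (b - a)))) := by
  rcases eq_or_lt_of_le (show 0 ≤ q from q.2) with hq | hq
  · simp [noArrival, ← hq]
  · have := interarrivalLaw_no_arrival (a := q * a) (b := q * b) (by positivity)
      (mul_le_mul_of_nonneg_left hab q.2)
    rw [mul_sub, ← this]
    simp [noArrival, hq]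

variable {p : Fin n → ℝ≥0}

lemma requestTime_eq (e : Fin n × ℕ → ℝ) (i : Fin n) (k : ℕ) :
    requestTime p e (i, k) = arrival (k + 1) (row i e) / p i := rfl

lemma le_requestTime_iff {i : Fin n} (hi : 0 < p i) (e : Fin n × ℕ → ℝ) (k : ℕ) (a : ℝ) :
    a ≤ requestTime p e (i, k) ↔ p i * a ≤ arrival (k + 1) (row i e) := by
  rw [requestTime_eq, le_div_iff₀ (NNReal.coe_pos.2 hi), mul_comm]

lemma notRequested_iff (e : Fin n × ℕ → ℝ) (a b : ℝ) (i : Fin n) :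
    NotRequested p e a b i ↔ row i e ∈ noArrival (p i) a b := by
  refine forall_congr' fun hi => ?_
  simp only [le_requestTime_iff hi]

lemma clockLaw_forall_notRequested (p : Fin n → ℝ≥0) (s : Finset (Fin n)) {a b : ℝ} (ha : 0 ≤ a)
    (hab : a ≤ b) :
    clockLaw n {e | ∀ i ∈ s, NotRequested p e a b i} =
      ∏ i ∈ s, ENNReal.ofReal (Real.exp (-(p i * (b - a)))) := by
  have := iIndepFun_row.measure_inter_preimage_eq_mul s (sets := fun i => noArrival (p i) a b)
    fun i _ => measurableSet_noArrival _ _ _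
  have h2 : {e | ∀ i ∈ s, NotRequested p e a b i} = ⋂ i ∈ s, row i ⁻¹' noArrival (p i) a b := by
    ext e
    simp [notRequested_iff]
  rw [h2, this]
  refine Finset.prod_congr rfl fun i _ => ?_
  exact (clockLaw_row_mem i (measurableSet_noArrival _ _ _)).trans
    (interarrivalLaw_noArrival _ ha hab)

lemma clockLaw_notRequested (p : Fin n → ℝ≥0) (i : Fin n) {a b : ℝ} (ha : 0 ≤ a) (hab : a ≤ b) :
    clockLaw n {e | NotRequested p e a b i} = ENNReal.ofReal (Real.exp (-(p i * (b - a)))) := by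
  simpa using clockLaw_forall_notRequested p {i} ha hab

lemma clockLaw_notRequested_and (p : Fin n → ℝ≥0) {i j : Fin n} (hij : i ≠ j) {a b : ℝ}
    (ha : 0 ≤ a) (hab : a ≤ b) :
    clockLaw n {e | NotRequested p e a b i ∧ NotRequested p e a b j} =
      ENNReal.ofReal (Real.exp (-(p i * (b - a))) * Real.exp (-(p j * (b - a)))) := by
  rw [ENNReal.ofReal_mul (Real.exp_nonneg _)]
  simpa [hij] using clockLaw_forall_notRequested p {i, j} ha hab

/-- Given the earlier arrivals, the last gap would have to take one prescribed value, and its law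
has a density. -/
lemma interarrivalLaw_arrival_eq (k : ℕ) (a : ℝ) :
    interarrivalLaw {x | arrival (k + 1) x = a} = 0 := by
  have hS : MeasurableSet {x | arrival (k + 1) x = a} :=
    measurableSet_eq_fun (measurable_arrival _) measurable_const
  have hT : MeasurableSet {q : ℝ × ℝ | q.1 + q.2 = a} :=
    measurableSet_eq_fun (by fun_prop) measurable_const
  have h1 := lintegral_arrival_succ (F := {q : ℝ × ℝ | q.1 + q.2 = a}.indicator 1)
    (measurable_one.indicator hT) k
  have h2 : ∀ y : ℝ, ∫⁻ z, {q : ℝ × ℝ | q.1 + q.2 = a}.indicator 1 (y, z) ∂(expMeasure 1) = 0 :=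
    fun y => by
      have h3 : ∀ z, {q : ℝ × ℝ | q.1 + q.2 = a}.indicator (1 : ℝ × ℝ → ℝ≥0∞) (y, z) =
          ({a - y} : Set ℝ).indicator 1 z := fun z => by
        simp only [Set.indicator, Set.mem_ofPred_eq, Set.mem_singleton_iff, eq_sub_iff_add_eq']
        rfl
      simp_rw [h3]
      rw [lintegral_indicator_one (measurableSet_singleton _)]
      exact withDensity_absolutelyContinuous _ _ (Real.volume_singleton)
  simp_rw [h2] at h1
  rw [← lintegral_indicator_one hS]
  simp only [lintegral_zero] at h1
  rw [← h1]
  refine lintegral_congr fun x => ?_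
  simp only [Set.indicator, Set.mem_ofPred_eq, arrival, Finset.sum_range_succ]
  rfl

lemma ae_isRegular (p : Fin n → ℝ≥0) : ∀ᵐ e ∂(clockLaw n), IsRegular p e := by
  have h1 : ∀ᵐ e ∂(clockLaw n), ∀ i, IsRegularRow (row i e) :=
    ae_all_iff.2 fun i => ae_clockLaw_row ae_isRegularRow i
  have h2 : ∀ᵐ e ∂(clockLaw n), ∀ q : (Fin n × Fin n) × ℕ × ℕ, q.1.1 ≠ q.1.2 → 0 < p q.1.1 →
      0 < p q.1.2 → requestTime p e (q.1.1, q.2.1) ≠ requestTime p e (q.1.2, q.2.2) := by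
    refine ae_all_iff.2 fun ⟨⟨i, j⟩, k, l⟩ => ?_
    by_cases hij : i = j
    · exact Eventually.of_forall fun e h => absurd hij h
    by_cases hj : 0 < p j
    swap
    · exact Eventually.of_forall fun e _ _ h => absurd h hj
    have hS : MeasurableSet {q : (ℕ → ℝ) × (ℕ → ℝ) |
        arrival (k + 1) q.1 / p i = arrival (l + 1) q.2 / p j} :=
      measurableSet_eq_fun (by fun_prop) (by fun_prop)
    have := (iIndepFun_row.indepFun hij).measure_prodMk_mem (measurable_row i).aemeasurable
      (measurable_row j).aemeasurable hS
    -- A tie prescribes an arrival of `j` once row `i` is frozen, and this has probability zero.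
    have hz : ∀ e, clockLaw n {e' | (row i e, row j e') ∈ {q : (ℕ → ℝ) × (ℕ → ℝ) |
        arrival (k + 1) q.1 / p i = arrival (l + 1) q.2 / p j}} = 0 := fun e => by
      rw [← interarrivalLaw_arrival_eq l (arrival (k + 1) (row i e) / p i * p j),
        ← clockLaw_row_mem j (measurableSet_eq_fun (measurable_arrival _) measurable_const)]
      congr 1
      ext e'
      simp only [Set.mem_ofPred_eq]
      rw [eq_div_iff (NNReal.coe_pos.2 hj).ne']
      exact eq_comm
    simp_rw [hz] at this
    rw [lintegral_zero] at this
    filter_upwards [measure_eq_zero_iff_ae_notMem.1 this] with e he _ _ _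
    exact he
  filter_upwards [h1, h2] with e he he'
  exact ⟨fun r => (he r.1).1 r.2, fun i => (he i).2,
    fun i j hij hi hj k l => he' ((i, j), k, l) hij hi hj⟩

/-- Here `z / q` is the delay until the next request of an object of rate `q`, and the integrand is
the probability that the others, of total rate `1 - q`, stay silent meanwhile. The two exponentials
combine into `exp (-z / q)`, whose mass is read off from the exponential density of rate `q⁻¹`. -/
lemma lintegral_exp_expMeasure_one {q : ℝ} (hq : 0 < q) :
    ∫⁻ z, ENNReal.ofReal (Real.exp (-((1 - q) * (z / q)))) ∂(expMeasure 1) = ENNReal.ofReal q := by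
  have h1 := lintegral_exponentialPDF_eq_one (inv_pos.2 hq)
  have h2 : ∀ x, exponentialPDF q⁻¹ x = (Set.Ici 0).indicator
      (fun x => ENNReal.ofReal q⁻¹ * ENNReal.ofReal (Real.exp (-(q⁻¹ * x)))) x := fun x => by
    by_cases hx : 0 ≤ x
    · rw [Set.indicator_of_mem (Set.mem_Ici.2 hx), exponentialPDF_of_nonneg hx,
        ENNReal.ofReal_mul (inv_nonneg.2 hq.le)]
    · rw [Set.indicator_of_notMem (fun h => hx (Set.mem_Ici.1 h)),
        exponentialPDF_of_neg (not_le.1 hx)]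
  simp_rw [h2] at h1
  rw [lintegral_indicator measurableSet_Ici, lintegral_const_mul _ (by fun_prop)] at h1
  rw [lintegral_expMeasure_one (by fun_prop)]
  have h3 : ∀ x, ENNReal.ofReal (Real.exp (-x)) *
      ENNReal.ofReal (Real.exp (-((1 - q) * (x / q)))) =
      ENNReal.ofReal (Real.exp (-(q⁻¹ * x))) := fun x => by
    rw [← ENNReal.ofReal_mul (Real.exp_nonneg _), ← Real.exp_add]
    congr 2
    field_simp
    ring
  simp_rw [h3]
  rw [ENNReal.ofReal_inv_of_pos hq] at h1
  have h4 := congrArg (ENNReal.ofReal q * ·) h1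
  simp only [mul_one] at h4
  rwa [← mul_assoc, ENNReal.mul_inv_cancel (by simpa using hq) (by simp), one_mul] at h4

lemma measurableSet_firstArrival_and_noArrival (p : Fin n → ℝ≥0) (i : Fin n) (s : Finset (Fin n))
    (a T : ℝ) (k : ℕ) :
    MeasurableSet {q : (ℕ → ℝ) × (s → ℕ → ℝ) | FirstArrival (p i * a) (p i * T) k q.1 ∧
      ∀ j : s, q.2 j ∈ noArrival (p j) T (arrival (k + 1) q.1 / p i)} := by
  refine (measurable_fst (measurableSet_firstArrival _ _ k)).inter ?_
  have hall : {q : (ℕ → ℝ) × (s → ℕ → ℝ) |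
      ∀ j : s, q.2 j ∈ noArrival (p j) T (arrival (k + 1) q.1 / p i)} = ⋂ j : s,
      {q | q.2 j ∈ noArrival (p j) T (arrival (k + 1) q.1 / p i)} := Set.ofPred_forall _
  refine (congrArg MeasurableSet hall).mpr ?_
  refine MeasurableSet.iInter fun j => MeasurableSet.imp (MeasurableSet.const _) ?_
  simp only [Set.ofPred_forall]
  refine MeasurableSet.iInter fun l => ?_
  have h : Measurable fun q : (ℕ → ℝ) × (s → ℕ → ℝ) => arrival (l + 1) (q.2 j) :=
    (measurable_arrival _).comp ((measurable_pi_apply j).comp measurable_snd)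
  have h' : Measurable fun q : (ℕ → ℝ) × (s → ℕ → ℝ) => arrival (k + 1) q.1 :=
    (measurable_arrival _).comp measurable_fst
  exact MeasurableSet.imp (measurableSet_le measurable_const h)
    (measurableSet_le ((h'.div_const _).const_mul _) h)

/-- Freeze row `i`, hence the instant of its next request after `T`. The other rows are independent
of it and each is silent up to that instant with an exponential probability; the rates add up to `1
- p i`. -/
lemma clockLaw_firstArrival (p : Fin n → ℝ≥0) (hp : ∑ j, (p j : ℝ) = 1) {i : Fin n} (hi : 0 < p i)
    {a T : ℝ} (hT : 0 ≤ T) (k : ℕ) :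
    clockLaw n {e | FirstArrival (p i * a) (p i * T) k (row i e) ∧
        ∀ j ∈ Finset.univ.erase i, NotRequested p e T (requestTime p e (i, k)) j} =
      ∫⁻ x, {x | FirstArrival (p i * a) (p i * T) k x}.indicator
        (fun x => ENNReal.ofReal
          (Real.exp (-((1 - p i) * ((arrival (k + 1) x - p i * T) / p i))))) x
        ∂interarrivalLaw := by
  have hi' : (0 : ℝ) < p i := hi
  have hind := iIndepFun_row (n := n).indepFun_finset {i} (Finset.univ.erase i)
    (by simp) measurable_row
  have hind' : IndepFun (row i) (fun e (j : (Finset.univ.erase i : Finset (Fin n))) => row j e)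
      (clockLaw n) :=
    hind.comp (φ := fun x : ({i} : Finset (Fin n)) → ℕ → ℝ => x ⟨i, by simp⟩)
      (ψ := id) (measurable_pi_apply _) measurable_id
  have h1 := hind'.measure_prodMk_mem (measurable_row i).aemeasurable
    (measurable_pi_lambda (fun e (j : (Finset.univ.erase i : Finset (Fin n))) => row (j : Fin n) e)
      fun j => measurable_row _).aemeasurable
    (measurableSet_firstArrival_and_noArrival p i (Finset.univ.erase i) a T k)
  have h2 : {e | FirstArrival (p i * a) (p i * T) k (row i e) ∧
        ∀ j ∈ Finset.univ.erase i, NotRequested p e T (requestTime p e (i, k)) j} =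
      {e | (row i e, fun (j : (Finset.univ.erase i : Finset (Fin n))) => row (j : Fin n) e) ∈
        {q : (ℕ → ℝ) × (↥(Finset.univ.erase i) → ℕ → ℝ) |
          FirstArrival (p i * a) (p i * T) k q.1 ∧
          ∀ j : (Finset.univ.erase i : Finset (Fin n)),
            q.2 j ∈ noArrival (p j) T (arrival (k + 1) q.1 / p i)}} := by
    ext e
    simp only [Set.mem_ofPred_eq, notRequested_iff, requestTime_eq, Subtype.forall]
  rw [h2, h1, ← map_row i, lintegral_map (Measurable.indicator (by fun_prop)
    (measurableSet_firstArrival _ _ k)) (measurable_row i)]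
  refine lintegral_congr fun e => ?_
  by_cases hF : FirstArrival (p i * a) (p i * T) k (row i e)
  · rw [Set.indicator_of_mem (s := {x | FirstArrival (p i * a) (p i * T) k x}) hF]
    have hle : T ≤ arrival (k + 1) (row i e) / p i := by
      rw [le_div_iff₀ hi', mul_comm]
      exact hF.2
    have h3 := clockLaw_forall_notRequested p (Finset.univ.erase i) hT hle
    simp only [notRequested_iff] at h3
    simp only [Set.mem_ofPred_eq, hF, true_and, Subtype.forall]
    rw [h3, ← ENNReal.ofReal_prod_of_nonneg fun _ _ => Real.exp_nonneg _, ← Real.exp_sum,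
      Finset.sum_neg_distrib, ← Finset.sum_mul]
    have h4 := Finset.add_sum_erase Finset.univ (fun j => (p j : ℝ)) (Finset.mem_univ i)
    rw [hp] at h4
    rw [show ∑ j ∈ Finset.univ.erase i, (p j : ℝ) = 1 - p i by linarith, sub_div,
      mul_div_cancel_left₀ _ hi'.ne']
  · rw [Set.indicator_of_notMem (s := {x | FirstArrival (p i * a) (p i * T) k x}) hF]
    simp [hF]

lemma IsRegular.isRegularRow {e : Fin n × ℕ → ℝ} (h : IsRegular p e) (i : Fin n) :
    IsRegularRow (row i e) := ⟨fun j => h.pos (i, j), h.unbounded i⟩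

/-- The index `k` is that of the first request of `i` from `a` on. Being also at or after `T` means
that `i` escapes the window, and silence of the others until then means that `i` is next. -/
lemma IsRegular.nextRequested_and_notRequested_iff {e : Fin n × ℕ → ℝ} (h : IsRegular p e)
    {i : Fin n} (hi : 0 < p i) {a T : ℝ} (haT : a ≤ T) :
    nextRequested p e T = some i ∧ NotRequested p e a T i ↔
      ∃ k, FirstArrival (p i * a) (p i * T) k (row i e) ∧
        ∀ j ∈ Finset.univ.erase i, NotRequested p e T (requestTime p e (i, k)) j := by
  have hi' : (0 : ℝ) < p i := hi
  have haT' : p i * a ≤ p i * T := mul_le_mul_of_nonneg_left haT hi'.le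
  have hmono := h.strictMono_requestTime hi
  have hnot : NotRequested p e a T i ↔ ∃ k, FirstArrival (p i * a) (p i * T) k (row i e) := by
    rw [(h.isRegularRow i).exists_firstArrival_iff, notRequested_iff]
    simp [noArrival, hi]
  rw [h.nextRequested_eq_some_iff, hnot]
  constructor
  · rintro ⟨⟨-, k, hk, hmin⟩, l, hl⟩
    have hkl : k = l := by
      refine le_antisymm ?_ ?_
      · exact hmono.le_iff_le.1 (hmin i l hi ((le_requestTime_iff hi e l T).2 hl.2))
      · by_contra! hlt
        have h1 := (le_requestTime_iff hi e k T).1 hk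
        rcases hl.1 with rfl | hl1
        · omega
        · have := (h.isRegularRow i).strictMono.monotone (show k + 1 ≤ l by omega)
          linarith
    subst hkl
    exact ⟨k, hl, fun j _ hj l hjl => hmin j l hj hjl⟩
  · rintro ⟨k, hk, hj⟩
    have hkT := (le_requestTime_iff hi e k T).2 hk.2
    refine ⟨⟨hi, k, hkT, fun j l hpj hjl => ?_⟩, k, hk⟩
    by_cases hji : j = i
    · subst hji
      refine hmono.monotone ?_
      by_contra! hlt
      rcases hk.1 with rfl | hk1
      · omega
      · have := (h.isRegularRow j).strictMono.monotone (show l + 1 ≤ k by omega)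
        have := (le_requestTime_iff hpj e l T).1 hjl
        linarith
    · exact hj j (by simpa using hji) hpj l hjl

/-- The next requested object is independent of the past, and it is `i` with probability `p i`. -/
lemma clockLaw_nextRequested_and_notRequested (p : Fin n → ℝ≥0) (hp : ∑ j, (p j : ℝ) = 1)
    (i : Fin n) {a T : ℝ} (ha : 0 ≤ a) (haT : a ≤ T) :
    clockLaw n {e | nextRequested p e T = some i ∧ NotRequested p e a T i} =
      ENNReal.ofReal (p i * Real.exp (-(p i * (T - a)))) := by
  by_cases hi : 0 < p i
  swap
  · have hi0 : p i = 0 := by simpa using hi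
    rw [hi0]
    simp only [NNReal.coe_zero, zero_mul, ENNReal.ofReal_zero]
    refine measure_eq_zero_iff_ae_notMem.2 ?_
    filter_upwards [ae_isRegular p] with e he hmem
    exact hi ((he.nextRequested_eq_some_iff T i).1 hmem.1).1
  have hi' : (0 : ℝ) < p i := hi
  have haT' : p i * a ≤ p i * T := mul_le_mul_of_nonneg_left haT hi'.le
  -- On the unit-rate clock of `i` the window is `[p i * a, p i * T)`. The function `g` is the
  -- probability that the others stay silent during the delay; its mean supplies the factor `p i`.
  have h1 := tsum_lintegral_firstArrival
    (g := fun z => ENNReal.ofReal (Real.exp (-((1 - p i) * (z / p i))))) (by fun_prop)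
    (mul_nonneg hi'.le ha) haT'
  rw [lintegral_exp_expMeasure_one hi', ← ENNReal.ofReal_mul (Real.exp_nonneg _)] at h1
  rw [mul_sub, mul_comm, ← h1]
  simp_rw [← clockLaw_firstArrival p hp hi (ha.trans haT)]
  rw [← measure_iUnion₀]
  · refine measure_congr (eventuallyEq_set.2 ?_)
    filter_upwards [ae_isRegular p] with e he
    rw [Set.mem_iUnion]
    exact he.nextRequested_and_notRequested_iff hi haT
  · intro k l hkl
    refine measure_eq_zero_iff_ae_notMem.2 ?_
    filter_upwards [ae_isRegular p] with e he hmem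
    exact hkl (((he.isRegularRow i).existsUnique_firstArrival (p i * a)).unique
      (hmem.1.1.mono haT') (hmem.2.1.mono haT'))
  · intro k
    have h2 : Measurable fun e : Fin n × ℕ → ℝ =>
        (row i e, fun j : (Finset.univ.erase i : Finset (Fin n)) => row j e) :=
      (measurable_row i).prodMk (measurable_pi_lambda _ fun j => measurable_row j.1)
    have := h2 (measurableSet_firstArrival_and_noArrival p i (Finset.univ.erase i) a T k)
    convert this.nullMeasurableSet using 1
    ext e
    simp only [Set.mem_preimage, Set.mem_ofPred_eq, notRequested_iff, requestTime_eq,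
      Subtype.forall]

end Clock

/-! ### Requests with random exchangeable weights -/

section Annealed

variable {n : ℕ}

lemma sum_popularity_eq_one {w : Fin n → ℝ≥0} (hw : ∑ j, w j ≠ 0) :
    ∑ j, (popularity w j : ℝ) = 1 := by
  simp only [popularity, ← NNReal.coe_sum, ← Finset.sum_div, div_self hw, NNReal.coe_one]

lemma popularity_eq_zero {w : Fin n → ℝ≥0} (hw : ∑ j, w j = 0) (i : Fin n) :
    popularity w i = 0 := by
  simp [popularity, hw]

lemma popularity_le_one (w : Fin n → ℝ≥0) (i : Fin n) : popularity w i ≤ 1 :=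
  div_le_one_of_le₀ (Finset.single_le_sum (fun _ _ => bot_le) (Finset.mem_univ i)) bot_le

lemma popularity_comp (w : Fin n → ℝ≥0) (σ : Equiv.Perm (Fin n)) (i : Fin n) :
    popularity (fun j => w (σ j)) i = popularity w (σ i) := by
  simp only [popularity]
  rw [Equiv.sum_comp σ w]

lemma clockLaw_popularity_nextRequested (w : Fin n → ℝ≥0) (i : Fin n) {a T : ℝ} (ha : 0 ≤ a)
    (haT : a ≤ T) :
    clockLaw n {e | nextRequested (popularity w) e T = some i ∧
        NotRequested (popularity w) e a T i} =
      ENNReal.ofReal (popularity w i * Real.exp (-(popularity w i * (T - a)))) := by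
  by_cases hw : ∑ j, w j = 0
  · rw [popularity_eq_zero hw]
    simp only [NNReal.coe_zero, zero_mul, ENNReal.ofReal_zero]
    refine measure_eq_zero_iff_ae_notMem.2 ?_
    filter_upwards [ae_isRegular (popularity w)] with e he hmem
    exact ((he.nextRequested_eq_some_iff T i).1 hmem.1).1.ne' (popularity_eq_zero hw i)
  · exact clockLaw_nextRequested_and_notRequested _ (sum_popularity_eq_one hw) i ha haT

/-- The probability that object `i` is not requested during a time interval of length `s`. -/
def survival (s : ℝ) (i : Fin n) (w : Fin n → ℝ≥0) : ℝ := Real.exp (-(popularity w i * s))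

lemma survival_nonneg (s : ℝ) (i : Fin n) (w : Fin n → ℝ≥0) : 0 ≤ survival s i w :=
  Real.exp_nonneg _

lemma survival_le_one {s : ℝ} (hs : 0 ≤ s) (i : Fin n) (w : Fin n → ℝ≥0) : survival s i w ≤ 1 :=
  Real.exp_le_one_iff.2 (by have := mul_nonneg (popularity w i).2 hs; simpa using this)

@[fun_prop]
lemma measurable_popularity_apply (i : Fin n) :
    Measurable fun w : Fin n → ℝ≥0 => popularity w i :=
  (measurable_pi_apply i).comp measurable_popularity

@[fun_prop]
lemma measurable_survival (s : ℝ) (i : Fin n) : Measurable (survival s i) := by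
  unfold survival
  fun_prop

/-- The expected proportion of the objects that are not requested during a time interval of
length `s`. -/
def avgSurvival (s : ℝ) (w : Fin n → ℝ≥0) : ℝ := (∑ i, survival s i w) / n

/-- The probability that the next requested object is not requested during the preceding time
interval of length `s`. -/
def nextSurvival (s : ℝ) (w : Fin n → ℝ≥0) : ℝ := ∑ i, popularity w i * survival s i w

@[fun_prop]
lemma measurable_avgSurvival (s : ℝ) : Measurable (avgSurvival (n := n) s) := by
  unfold avgSurvival
  fun_prop

@[fun_prop]
lemma measurable_nextSurvival (s : ℝ) : Measurable (nextSurvival (n := n) s) := by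
  unfold nextSurvival
  fun_prop

variable (Λ : Measure (Fin n → ℝ≥0))

/-- The joint law of the weights and the clock. -/
def jointLaw : Measure ((Fin n → ℝ≥0) × (Fin n × ℕ → ℝ)) := Λ.prod (clockLaw n)

instance [IsProbabilityMeasure Λ] : IsProbabilityMeasure (jointLaw Λ) :=
  inferInstanceAs (IsProbabilityMeasure (Λ.prod (clockLaw n)))

/-- The event that object `i` is not requested in `[a, b)`. -/
def notRequestedEvent (a b : ℝ) (i : Fin n) : Set ((Fin n → ℝ≥0) × (Fin n × ℕ → ℝ)) :=
  {x | NotRequested (popularity x.1) x.2 a b i}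

/-- The event that object `i` is the first requested object after `t`. -/
def nextEvent (t : ℝ) (i : Fin n) : Set ((Fin n → ℝ≥0) × (Fin n × ℕ → ℝ)) :=
  {x | nextRequested (popularity x.1) x.2 t = some i}

lemma measurableSet_notRequestedEvent (a b : ℝ) (i : Fin n) :
    MeasurableSet (notRequestedEvent a b i) :=
  measurableSet_notRequested (measurable_popularity.comp measurable_fst) measurable_snd a b i

lemma measurableSet_nextEvent (t : ℝ) (i : Fin n) : MeasurableSet (nextEvent t i) :=
  measurableSet_nextRequested (measurable_popularity.comp measurable_fst) measurable_snd
    measurable_const i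

lemma ae_jointLaw_isRegular : ∀ᵐ x ∂(jointLaw Λ), IsRegular (popularity x.1) x.2 := by
  refine (Measure.ae_prod_iff_ae_ae (measurableSet_isRegular
    (measurable_popularity.comp measurable_fst) measurable_snd)).2 ?_
  exact Eventually.of_forall fun w => ae_isRegular (popularity w)

variable {Λ}

/-- Fubini in the form used below: a conditional probability known for every fixed weight vector is
averaged over the weights. -/
lemma jointLaw_real_eq_integral {S : Set ((Fin n → ℝ≥0) × (Fin n × ℕ → ℝ))}
    (hS : MeasurableSet S) {F : (Fin n → ℝ≥0) → ℝ} (hF : Measurable F) (hF0 : ∀ w, 0 ≤ F w)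
    (h : ∀ w, clockLaw n {e | (w, e) ∈ S} = ENNReal.ofReal (F w)) :
    (jointLaw Λ).real S = ∫ w, F w ∂Λ := by
  rw [measureReal_def, jointLaw, Measure.prod_apply hS,
    integral_eq_lintegral_of_nonneg_ae (Eventually.of_forall hF0) hF.aestronglyMeasurable]
  congr 1
  exact lintegral_congr h

lemma integrable_of_mem_Icc [IsProbabilityMeasure Λ] {F : (Fin n → ℝ≥0) → ℝ} (hF : Measurable F)
    (hF0 : ∀ w, 0 ≤ F w) (hF1 : ∀ w, F w ≤ 1) : Integrable F Λ :=
  Integrable.of_bound hF.aestronglyMeasurable 1 (Eventually.of_forall fun w => by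
    rw [Real.norm_of_nonneg (hF0 w)]
    exact hF1 w)

section

variable {a T : ℝ} (ha : 0 ≤ a) (haT : a ≤ T)
include ha haT

lemma jointLaw_notRequestedEvent (i : Fin n) :
    (jointLaw Λ).real (notRequestedEvent a T i) = ∫ w, survival (T - a) i w ∂Λ :=
  jointLaw_real_eq_integral (measurableSet_notRequestedEvent a T i) (measurable_survival _ _)
    (survival_nonneg _ _) fun w => clockLaw_notRequested (popularity w) i ha haT

lemma jointLaw_notRequestedEvent_inter {i j : Fin n} (hij : i ≠ j) :
    (jointLaw Λ).real (notRequestedEvent a T i ∩ notRequestedEvent a T j) =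
      ∫ w, survival (T - a) i w * survival (T - a) j w ∂Λ :=
  jointLaw_real_eq_integral ((measurableSet_notRequestedEvent a T i).inter
    (measurableSet_notRequestedEvent a T j)) (by fun_prop)
    (fun w => mul_nonneg (survival_nonneg _ _ w) (survival_nonneg _ _ w))
    fun w => clockLaw_notRequested_and (popularity w) hij ha haT

lemma jointLaw_nextEvent_inter (i : Fin n) :
    (jointLaw Λ).real (nextEvent T i ∩ notRequestedEvent a T i) =
      ∫ w, popularity w i * survival (T - a) i w ∂Λ :=
  jointLaw_real_eq_integral ((measurableSet_nextEvent T i).inter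
    (measurableSet_notRequestedEvent a T i)) (by fun_prop)
    (fun w => mul_nonneg (popularity w i).2 (survival_nonneg _ _ w))
    fun w => clockLaw_popularity_nextRequested w i ha haT

end

/-! ### Consequences of exchangeability: first and second moments of the number of unrequested
objects. -/

section Exchangeable

variable (hex : ∀ σ : Equiv.Perm (Fin n), Λ.map (fun w i => w (σ i)) = Λ)
include hex

lemma integral_comp_perm (σ : Equiv.Perm (Fin n)) {F : (Fin n → ℝ≥0) → ℝ} (hF : Measurable F) :
    ∫ w, F (fun i => w (σ i)) ∂Λ = ∫ w, F w ∂Λ := by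
  conv_rhs => rw [← hex σ]
  rw [integral_map (measurable_pi_lambda _ fun i => measurable_pi_apply (σ i)).aemeasurable
    hF.aestronglyMeasurable]

/-- A permutation carries any pair of distinct objects to any other one, so all the off-diagonal
second moments coincide. -/
lemma integral_survival_mul_survival_eq (s : ℝ) {i j k l : Fin n} (hij : i ≠ j) (hkl : k ≠ l) :
    ∫ w, survival s i w * survival s j w ∂Λ = ∫ w, survival s k w * survival s l w ∂Λ := by
  obtain ⟨σ, hσk, hσl⟩ : ∃ σ : Equiv.Perm (Fin n), σ k = i ∧ σ l = j := by
    -- The first swap brings `k` to `i`; the second brings the image of `l` to `j` and leaves `i`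
    -- fixed.
    refine ⟨Equiv.swap (Equiv.swap k i l) j * Equiv.swap k i, ?_, ?_⟩
    · have h1 : Equiv.swap k i l ≠ i := fun h =>
        hkl ((Equiv.swap k i).injective ((Equiv.swap_apply_left k i).trans h.symm))
      rw [Equiv.Perm.mul_apply, Equiv.swap_apply_left, Equiv.swap_apply_of_ne_of_ne h1.symm hij]
    · rw [Equiv.Perm.mul_apply, Equiv.swap_apply_left]
  have := integral_comp_perm hex σ (F := fun w => survival s k w * survival s l w) (by fun_prop)
  rw [← this]
  simp only [survival, popularity_comp, hσk, hσl]

variable [IsProbabilityMeasure Λ]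

lemma integral_survival (hn : n ≠ 0) {s : ℝ} (hs : 0 ≤ s) (i : Fin n) :
    ∫ w, survival s i w ∂Λ = ∫ w, avgSurvival s w ∂Λ := by
  have h1 : ∀ j, ∫ w, survival s j w ∂Λ = ∫ w, survival s i w ∂Λ := fun j => by
    rw [← integral_comp_perm hex (Equiv.swap i j) (measurable_survival s i)]
    simp only [survival, popularity_comp, Equiv.swap_apply_left]
  simp only [avgSurvival]
  rw [integral_div, integral_finsetSum _ fun j _ => integrable_of_mem_Icc
    (measurable_survival s j) (survival_nonneg s j) (survival_le_one hs j)]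
  simp_rw [h1]
  have : (n : ℝ) ≠ 0 := Nat.cast_ne_zero.2 hn
  simp [this]

lemma integral_popularity_mul_survival (hn : n ≠ 0) {s : ℝ} (hs : 0 ≤ s) (i : Fin n) :
    ∫ w, popularity w i * survival s i w ∂Λ = (∫ w, nextSurvival s w ∂Λ) / n := by
  have h1 : ∀ j, ∫ w, popularity w j * survival s j w ∂Λ =
      ∫ w, popularity w i * survival s i w ∂Λ := fun j => by
    have := integral_comp_perm hex (Equiv.swap i j)
      (F := fun w => popularity w i * survival s i w) (by fun_prop)
    rw [← this]
    simp only [survival, popularity_comp, Equiv.swap_apply_left]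
  simp only [nextSurvival]
  have hint : ∀ j, Integrable (fun w => (popularity w j : ℝ) * survival s j w) Λ :=
    fun j => integrable_of_mem_Icc (by fun_prop)
      (fun w => mul_nonneg (popularity w j).2 (survival_nonneg s j w))
      (fun w => mul_le_one₀ (NNReal.coe_le_one.2 (popularity_le_one w j)) (survival_nonneg s j w)
        (survival_le_one hs j w))
  rw [integral_finsetSum _ fun j _ => hint j]
  simp_rw [h1]
  have : (n : ℝ) ≠ 0 := Nat.cast_ne_zero.2 hn
  simp [this]

/-- Expanding the square of the average gives `n * (n - 1)` equal off-diagonal terms and nonnegative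
diagonal ones, which are dropped. -/
lemma integral_survival_mul_survival_le {s : ℝ} (hs : 0 ≤ s) {i j : Fin n} (hij : i ≠ j) :
    ((n : ℝ) - 1) * ∫ w, survival s i w * survival s j w ∂Λ ≤
      n * ∫ w, avgSurvival s w ^ 2 ∂Λ := by
  have hn : (0 : ℝ) < n := Nat.cast_pos.2 (Fin.pos i)
  have hint : ∀ k l : Fin n, Integrable (fun w => survival s k w * survival s l w) Λ :=
    fun k l => integrable_of_mem_Icc (by fun_prop)
      (fun w => mul_nonneg (survival_nonneg s k w) (survival_nonneg s l w))
      (fun w => mul_le_one₀ (survival_le_one hs k w) (survival_nonneg s l w)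
        (survival_le_one hs l w))
  have h1 : ∫ w, avgSurvival s w ^ 2 ∂Λ =
      (∑ k, ∑ l, ∫ w, survival s k w * survival s l w ∂Λ) / n ^ 2 := by
    simp only [avgSurvival, div_pow, sq (∑ i, _), Finset.sum_mul_sum]
    rw [integral_div, integral_finsetSum _ fun k _ => integrable_finsetSum _ fun l _ => hint k l]
    congr 1
    exact Finset.sum_congr rfl fun k _ => integral_finsetSum _ fun l _ => hint k l
  have h2 : ∀ k, ((n : ℝ) - 1) * ∫ w, survival s i w * survival s j w ∂Λ ≤
      ∑ l, ∫ w, survival s k w * survival s l w ∂Λ := fun k => by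
    rw [← Finset.add_sum_erase _ _ (Finset.mem_univ k)]
    have h3 : ∑ l ∈ Finset.univ.erase k, ∫ w, survival s k w * survival s l w ∂Λ =
        ((n : ℝ) - 1) * ∫ w, survival s i w * survival s j w ∂Λ := by
      rw [Finset.sum_congr rfl fun l hl => integral_survival_mul_survival_eq hex s
        (Finset.ne_of_mem_erase hl).symm hij]
      rw [Finset.sum_const, Finset.card_erase_of_mem (Finset.mem_univ k), nsmul_eq_mul,
        Finset.card_univ, Fintype.card_fin, Nat.cast_pred (Fin.pos i)]
    rw [h3]
    exact le_add_of_nonneg_left (integral_nonneg fun w =>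
      mul_nonneg (survival_nonneg s k w) (survival_nonneg s k w))
  have h3 := Finset.sum_le_sum fun k (_ : k ∈ Finset.univ) => h2 k
  rw [Finset.sum_const, nsmul_eq_mul, Finset.card_univ, Fintype.card_fin] at h3
  rw [h1]
  rw [show (n : ℝ) * ((∑ k, ∑ l, ∫ w, survival s k w * survival s l w ∂Λ) / n ^ 2) =
    (∑ k, ∑ l, ∫ w, survival s k w * survival s l w ∂Λ) / n by field_simp, le_div_iff₀ hn]
  linarith

/-- The number of objects of `A` that are not requested in `[a, b)`. -/
def unrequestedCount (A : Finset (Fin n)) (a b : ℝ) (x : (Fin n → ℝ≥0) × (Fin n × ℕ → ℝ)) : ℝ :=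
  ∑ i ∈ A, (notRequestedEvent a b i).indicator 1 x

variable {a T : ℝ} (ha : 0 ≤ a) (haT : a ≤ T)
include ha haT

lemma integral_unrequestedCount (A : Finset (Fin n)) :
    ∫ x, unrequestedCount A a T x ∂(jointLaw Λ) = A.card * ∫ w, avgSurvival (T - a) w ∂Λ := by
  unfold unrequestedCount
  have hint : ∀ i : Fin n, Integrable
      (fun x => (notRequestedEvent a T i).indicator (1 : _ × _ → ℝ) x) (jointLaw Λ) := fun i =>
    (integrable_const (1 : ℝ)).indicator (measurableSet_notRequestedEvent a T i)
  rw [integral_finsetSum _ fun i _ => hint i]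
  have : ∀ i ∈ A, ∫ x, (notRequestedEvent a T i).indicator 1 x ∂(jointLaw Λ) =
      ∫ w, avgSurvival (T - a) w ∂Λ := fun i _ => by
    rw [integral_indicator_one (measurableSet_notRequestedEvent a T i),
      jointLaw_notRequestedEvent ha haT,
      integral_survival hex (Fin.pos i).ne' (sub_nonneg.2 haT)]
  rw [Finset.sum_congr rfl this, Finset.sum_const, nsmul_eq_mul]

/-- The diagonal contributes at most the cardinality of `A`. Off the diagonal, conditional
independence given the weights turns joint escape into a product of survival probabilities, bounded
by the previous comparison. -/
lemma integral_unrequestedCount_sq_le (A : Finset (Fin n)) :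
    ∫ x, unrequestedCount A a T x ^ 2 ∂(jointLaw Λ) ≤
      A.card + A.card ^ 2 * ∫ w, avgSurvival (T - a) w ^ 2 ∂Λ := by
  have hq : 0 ≤ ∫ w, avgSurvival (T - a) w ^ 2 ∂Λ := integral_nonneg fun w => sq_nonneg _
  have hm := measurableSet_notRequestedEvent (n := n) a T
  have hint : ∀ i j : Fin n, Integrable (fun x => (notRequestedEvent a T i ∩
      notRequestedEvent a T j).indicator (1 : _ × _ → ℝ) x) (jointLaw Λ) := fun i j =>
    (integrable_const (1 : ℝ)).indicator ((hm i).inter (hm j))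
  have h1 : ∀ x, unrequestedCount A a T x ^ 2 = ∑ i ∈ A, ∑ j ∈ A,
      (notRequestedEvent a T i ∩ notRequestedEvent a T j).indicator (1 : _ × _ → ℝ) x := fun x => by
    rw [unrequestedCount, sq, Finset.sum_mul_sum]
    refine Finset.sum_congr rfl fun i _ => Finset.sum_congr rfl fun j _ => ?_
    rw [Set.inter_indicator_one]
    rfl
  simp_rw [h1]
  rw [integral_finsetSum _ fun i _ => integrable_finsetSum _ fun j _ => hint i j]
  have h2 : ∀ i ∈ A, ∫ x, ∑ j ∈ A, (notRequestedEvent a T i ∩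
      notRequestedEvent a T j).indicator (1 : _ × _ → ℝ) x ∂(jointLaw Λ) ≤
      1 + A.card * ∫ w, avgSurvival (T - a) w ^ 2 ∂Λ := fun i hi => by
    rw [integral_finsetSum _ fun j _ => hint i j, ← Finset.add_sum_erase _ _ hi]
    refine add_le_add ?_ ?_
    · rw [integral_indicator_one ((hm i).inter (hm i))]
      exact measureReal_le_one
    -- A singleton has no off-diagonal term; otherwise `n ≥ 2` and division by `n - 1` is
    -- legitimate.
    · by_cases hA : A.card ≤ 1
      · have : A.erase i = ∅ := by
          rw [← Finset.card_eq_zero, Finset.card_erase_of_mem hi]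
          omega
        rw [this, Finset.sum_empty]
        positivity
      · have hA' : (1 : ℝ) < A.card := by exact_mod_cast not_le.1 hA
        have hAn : (A.card : ℝ) ≤ n := by
          exact_mod_cast (Finset.card_le_univ A).trans_eq (Fintype.card_fin n)
        have h3 : ∀ j ∈ A.erase i, ∫ x, (notRequestedEvent a T i ∩
            notRequestedEvent a T j).indicator (1 : _ × _ → ℝ) x ∂(jointLaw Λ) ≤
            n / (n - 1) * ∫ w, avgSurvival (T - a) w ^ 2 ∂Λ := fun j hj => by
          have hij := (Finset.ne_of_mem_erase hj).symm
          rw [integral_indicator_one ((hm i).inter (hm j)),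
            jointLaw_notRequestedEvent_inter ha haT hij, div_mul_eq_mul_div,
            le_div_iff₀ (by linarith), mul_comm]
          exact integral_survival_mul_survival_le hex (sub_nonneg.2 haT) hij
        refine (Finset.sum_le_sum h3).trans ?_
        rw [Finset.sum_const, Finset.card_erase_of_mem hi, nsmul_eq_mul,
          Nat.cast_pred (by omega), ← mul_assoc]
        -- The factor `n / (n - 1)` is absorbed because `A` has at most `n` elements.
        refine mul_le_mul_of_nonneg_right ?_ hq
        rw [mul_div_assoc', div_le_iff₀ (by linarith)]
        nlinarith
  refine (Finset.sum_le_sum h2).trans (le_of_eq ?_)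
  rw [Finset.sum_const, nsmul_eq_mul]
  ring

/-- Chebyshev's inequality around the deterministic value. All the error terms vanish in the limit
as soon as the first two moments of `avgSurvival` tend to `y` and `y ^ 2`. -/
lemma measureReal_unrequestedCount_far_le (hn : n ≠ 0) (A : Finset (Fin n)) {y ε : ℝ}
    (hy : 0 ≤ y) (hε : 0 < ε) :
    (jointLaw Λ).real {x | ε ≤ |unrequestedCount A a T x / n - A.card / n * y|} ≤
      (1 / n + |∫ w, avgSurvival (T - a) w ^ 2 ∂Λ - y ^ 2| +
        2 * y * |∫ w, avgSurvival (T - a) w ∂Λ - y|) / ε ^ 2 := by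
  have hn' : (0 : ℝ) < n := Nat.cast_pos.2 (Nat.pos_of_ne_zero hn)
  have hm := measurableSet_notRequestedEvent (n := n) a T
  set q := ∫ w, avgSurvival (T - a) w ^ 2 ∂Λ with hq
  set l := ∫ w, avgSurvival (T - a) w ∂Λ with hl
  have hmeas : Measurable (unrequestedCount A a T) :=
    Finset.measurable_fun_sum _ fun i _ => measurable_one.indicator (hm i)
  have hbd : ∀ x, ‖unrequestedCount A a T x‖ ≤ n := fun x => by
    rw [unrequestedCount,
      Real.norm_of_nonneg (Finset.sum_nonneg fun i _ => Set.indicator_nonneg (by simp) x)]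
    refine (Finset.sum_le_card_nsmul A _ 1 fun i _ =>
      Set.indicator_le_self' (by simp) x).trans ?_
    rw [nsmul_eq_mul, mul_one]
    exact_mod_cast (Finset.card_le_univ A).trans_eq (Fintype.card_fin n)
  have hi1 : Integrable (unrequestedCount A a T) (jointLaw Λ) :=
    Integrable.of_bound hmeas.aestronglyMeasurable n (Eventually.of_forall hbd)
  have hi2 : Integrable (fun x => unrequestedCount A a T x ^ 2) (jointLaw Λ) :=
    Integrable.of_bound (hmeas.pow_const 2).aestronglyMeasurable ((n : ℝ) ^ 2)
      (Eventually.of_forall fun x => by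
        rw [norm_pow]
        exact pow_le_pow_left₀ (norm_nonneg _) (hbd x) 2)
  have hexp : ∀ x, (unrequestedCount A a T x / n - A.card / n * y) ^ 2 =
      (1 / n ^ 2) * unrequestedCount A a T x ^ 2 -
        (2 * (A.card / n ^ 2) * y) * unrequestedCount A a T x + (A.card / n * y) ^ 2 :=
    fun x => by field_simp; ring
  have hi3 : Integrable (fun x => (unrequestedCount A a T x / n - A.card / n * y) ^ 2)
      (jointLaw Λ) := by
    simp_rw [hexp]
    exact ((hi2.const_mul _).sub (hi1.const_mul _)).add (integrable_const _)
  have hcheb := mul_meas_ge_le_integral_of_nonneg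
    (Eventually.of_forall fun x => sq_nonneg _) hi3 (ε ^ 2)
  have hset : {x | ε ≤ |unrequestedCount A a T x / n - A.card / n * y|} =
      {x | ε ^ 2 ≤ (unrequestedCount A a T x / n - A.card / n * y) ^ 2} := by
    ext x
    simp only [Set.mem_ofPred_eq]
    rw [← sq_abs (unrequestedCount A a T x / n - A.card / n * y), sq_le_sq₀ hε.le (abs_nonneg _)]
  rw [le_div_iff₀ (by positivity), hset, mul_comm]
  refine hcheb.trans ?_
  have hval : ∫ x, (unrequestedCount A a T x / n - A.card / n * y) ^ 2 ∂(jointLaw Λ) =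
      (1 / n ^ 2) * ∫ x, unrequestedCount A a T x ^ 2 ∂(jointLaw Λ) -
        (2 * (A.card / n ^ 2) * y) * (A.card * l) + (A.card / n * y) ^ 2 := by
    simp_rw [hexp]
    have hi4 : Integrable (fun x => (1 / n ^ 2) * unrequestedCount A a T x ^ 2 -
        (2 * (A.card / n ^ 2) * y) * unrequestedCount A a T x) (jointLaw Λ) :=
      (hi2.const_mul _).sub (hi1.const_mul _)
    rw [integral_add hi4 (integrable_const _),
      integral_sub (hi2.const_mul _) (hi1.const_mul _), integral_const_mul, integral_const_mul,
      integral_unrequestedCount hex ha haT, ← hl]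
    simp
  rw [hval]
  have hsq := integral_unrequestedCount_sq_le hex ha haT A
  rw [← hq] at hsq
  have hr0 : 0 ≤ (A.card : ℝ) / n := by positivity
  have hr1 : (A.card : ℝ) / n ≤ 1 := div_le_one_of_le₀
    (by exact_mod_cast (Finset.card_le_univ A).trans_eq (Fintype.card_fin n)) hn'.le
  set r := (A.card : ℝ) / n with hr
  have hA : (A.card : ℝ) = r * n := by rw [hr]; field_simp
  rw [hA] at hsq ⊢
  have h1 : 1 / (n : ℝ) ^ 2 * ∫ x, unrequestedCount A a T x ^ 2 ∂(jointLaw Λ) ≤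
      r * (1 / n) + r ^ 2 * q := by
    refine (mul_le_mul_of_nonneg_left hsq (by positivity)).trans (le_of_eq ?_)
    field_simp
  have h2 : 2 * (r * n / (n : ℝ) ^ 2) * y * (r * n * l) = r ^ 2 * (2 * y * l) := by
    field_simp
  rw [h2]
  have h3 : r * (1 / n) ≤ 1 / n := mul_le_of_le_one_left (by positivity) hr1
  have hr2 : r ^ 2 ≤ 1 := pow_le_one₀ hr0 hr1
  have h4 : r ^ 2 * (q - y ^ 2) ≤ |q - y ^ 2| := (mul_le_mul_of_nonneg_left (le_abs_self _)
    (sq_nonneg r)).trans (mul_le_of_le_one_left (abs_nonneg _) hr2)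
  have h5 : r ^ 2 * (2 * y * (y - l)) ≤ 2 * y * |l - y| := by
    rw [abs_sub_comm]
    exact (mul_le_mul_of_nonneg_left (mul_le_mul_of_nonneg_left (le_abs_self _) (by positivity))
      (sq_nonneg r)).trans (mul_le_of_le_one_left (by positivity) hr2)
  nlinarith

/-- Only one object is next, so the events are disjoint; by exchangeability each carries the same
share `1 / n` of the total. -/
lemma jointLaw_biUnion_next (hn : n ≠ 0) (A : Finset (Fin n)) :
    (jointLaw Λ).real (⋃ i ∈ A, nextEvent T i ∩ notRequestedEvent a T i) =
      A.card / n * ∫ w, nextSurvival (T - a) w ∂Λ := by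
  rw [measureReal_biUnion_finset]
  · rw [Finset.sum_congr rfl fun i _ => (jointLaw_nextEvent_inter ha haT i).trans
      (integral_popularity_mul_survival hex hn (sub_nonneg.2 haT) i), Finset.sum_const,
      nsmul_eq_mul]
    ring
  · intro i _ j _ hij
    refine Set.disjoint_left.2 fun x hx hx' => hij ?_
    exact Option.some.inj (hx.1.symm.trans hx'.1)
  · exact fun i _ => (measurableSet_nextEvent T i).inter (measurableSet_notRequestedEvent a T i)

end Exchangeable

end Annealed

/-! ### The Laplace transform of the limiting law -/

section Laplace

variable (P : ProbabilityMeasure ℝ≥0)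

/-- The integral of `x ^ k * exp (-t x)`, which is `(-1) ^ k` times the `k`-th derivative of the
Laplace transform. -/
def laplaceMoment (k : ℕ) (t : ℝ) : ℝ :=
  ∫ x : ℝ≥0, (x : ℝ) ^ k * Real.exp (-(t * (x : ℝ))) ∂(P : Measure ℝ≥0)

lemma laplaceMoment_zero : laplaceMoment P 0 = laplace P := by
  funext t
  simp [laplaceMoment, laplace]

lemma laplaceMoment_nonneg (k : ℕ) (t : ℝ) : 0 ≤ laplaceMoment P k t :=
  integral_nonneg fun x => by positivity

lemma exp_neg_mul_le_one {t : ℝ} (ht : 0 ≤ t) (x : ℝ≥0) : Real.exp (-(t * (x : ℝ))) ≤ 1 :=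
  Real.exp_le_one_iff.2 (by have := mul_nonneg ht x.2; simpa using this)

lemma integrable_exp_neg_mul {t : ℝ} (ht : 0 ≤ t) :
    Integrable (fun x : ℝ≥0 => Real.exp (-(t * (x : ℝ)))) (P : Measure ℝ≥0) :=
  Integrable.of_bound (by fun_prop) 1 (Eventually.of_forall fun x => by
    rw [Real.norm_of_nonneg (Real.exp_nonneg _)]
    exact exp_neg_mul_le_one ht x)

/-- Differentiation under the integral is valid in the interior of the domain of exponential
integrability, which contains every `-t` with `t > 0`; the point `0` may lie on its boundary. -/
lemma hasDerivAt_laplaceMoment (k : ℕ) {t : ℝ} (ht : 0 < t) :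
    HasDerivAt (laplaceMoment P k) (-laplaceMoment P (k + 1) t) t := by
  have hsub : Set.Iic 0 ⊆ integrableExpSet (fun x : ℝ≥0 => (x : ℝ)) (P : Measure ℝ≥0) :=
    fun s hs => by
      have := integrable_exp_neg_mul P (neg_nonneg.2 (Set.mem_Iic.1 hs))
      simpa [integrableExpSet] using this
  have hmem : -t ∈ interior (integrableExpSet (fun x : ℝ≥0 => (x : ℝ)) (P : Measure ℝ≥0)) := by
    refine interior_mono hsub ?_
    rw [interior_Iic]
    simpa using ht
  have h := (hasDerivAt_integral_pow_mul_exp_real hmem k).scomp t (hasDerivAt_neg t)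
  have h1 : laplaceMoment P k =
      (fun t => ∫ x : ℝ≥0, (x : ℝ) ^ k * Real.exp (t * (x : ℝ)) ∂(P : Measure ℝ≥0)) ∘ Neg.neg := by
    funext s
    simp [laplaceMoment]
  rw [h1]
  exact h.congr_deriv (by simp [laplaceMoment])

lemma hasDerivAt_laplace {t : ℝ} (ht : 0 < t) :
    HasDerivAt (laplace P) (-laplaceMoment P 1 t) t := by
  have := hasDerivAt_laplaceMoment P 0 ht
  rwa [laplaceMoment_zero] at this

lemma deriv_laplace {t : ℝ} (ht : 0 < t) : deriv (laplace P) t = -laplaceMoment P 1 t :=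
  (hasDerivAt_laplace P ht).deriv

lemma deriv_deriv_laplace {t : ℝ} (ht : 0 < t) :
    deriv (deriv (laplace P)) t = laplaceMoment P 2 t := by
  have h : deriv (laplace P) =ᶠ[𝓝 t] fun s => -laplaceMoment P 1 s := by
    filter_upwards [lt_mem_nhds ht] with s hs
    exact deriv_laplace P hs
  rw [h.deriv_eq]
  simpa using (hasDerivAt_laplaceMoment P 1 ht).neg.deriv

lemma abs_deriv_laplace {t : ℝ} (ht : 0 < t) : |deriv (laplace P) t| = laplaceMoment P 1 t := by
  rw [deriv_laplace P ht, abs_neg, abs_of_nonneg (laplaceMoment_nonneg P 1 t)]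

lemma laplace_zero : laplace P 0 = 1 := by
  simp [laplace]

lemma laplaceMoment_one_zero : laplaceMoment P 1 0 = mean P := by
  simp [laplaceMoment, mean]

lemma continuousOn_laplace : ContinuousOn (laplace P) (Set.Ici 0) := by
  refine continuousOn_of_dominated (bound := fun _ => 1) (fun t _ => by fun_prop) (fun t ht => ?_)
    (integrable_const 1) (Eventually.of_forall fun x => by fun_prop)
  refine Eventually.of_forall fun x => ?_
  rw [Real.norm_of_nonneg (Real.exp_nonneg _)]
  exact exp_neg_mul_le_one ht x

lemma tendsto_laplace_atTop : Tendsto (laplace P) atTop (𝓝 (atomZero P)) := by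
  have h : ∫ x : ℝ≥0, ({0} : Set ℝ≥0).indicator 1 x ∂(P : Measure ℝ≥0) = atomZero P :=
    integral_indicator_one (measurableSet_singleton _)
  rw [← h]
  refine tendsto_integral_filter_of_dominated_convergence (fun _ => 1)
    (Eventually.of_forall fun t => by fun_prop) ?_ (integrable_const 1)
    (Eventually.of_forall fun x => ?_)
  · filter_upwards [eventually_ge_atTop 0] with t ht
    refine Eventually.of_forall fun x => ?_
    rw [Real.norm_of_nonneg (Real.exp_nonneg _)]
    exact exp_neg_mul_le_one ht x
  · by_cases hx : x = 0
    · simp [hx]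
    · have hx' : (0 : ℝ) < x := NNReal.coe_pos.2 (pos_iff_ne_zero.2 hx)
      simpa [hx] using tendsto_id.atTop_mul_const hx'

lemma norm_laplaceMoment_integrand_le {t : ℝ} (ht : 0 ≤ t) (x : ℝ≥0) :
    ‖(x : ℝ) ^ 1 * Real.exp (-(t * (x : ℝ)))‖ ≤ (x : ℝ) := by
  rw [Real.norm_of_nonneg (by positivity), pow_one]
  exact mul_le_of_le_one_right x.2 (exp_neg_mul_le_one ht x)

/-- The Laplace transform is onto `(P {0}, φ u)`. -/
lemma exists_laplace_eq {P : ProbabilityMeasure ℝ≥0} {u y : ℝ} (hu : 0 ≤ u)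
    (hy : y ∈ Set.Ioo (atomZero P) (laplace P u)) :
    ∃ s, u < s ∧ laplace P s = y := by
  obtain ⟨b, hb, hub⟩ := (((tendsto_order.1 (tendsto_laplace_atTop P)).2 y hy.1).and
    (eventually_gt_atTop u)).exists
  obtain ⟨s, hs, hsy⟩ := intermediate_value_Icc' hub.le ((continuousOn_laplace P).mono
    fun s hs => Set.mem_Ici.2 (hu.trans hs.1)) ⟨hb.le, hy.2.le⟩
  refine ⟨s, lt_of_le_of_ne hs.1 fun h => ?_, hsy⟩
  rw [← h] at hsy
  exact hy.2.ne' hsy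

/-- At the endpoints the formula may involve two-sided derivatives at `0`, or an inverse outside the
range of `φ`. Discarding these two points leaves only meaningful values. -/
lemma stationaryDensity_ae_eq :
    stationaryDensity P =ᵐ[volume]
      (Set.Ioo 0 (1 - atomZero P)).indicator (stationaryDensity P) := by
  filter_upwards [Measure.ae_ne volume (0 : ℝ), Measure.ae_ne volume (1 - atomZero P)]
    with x h0 h1
  by_cases hx : x ∈ Set.Ioo 0 (1 - atomZero P)
  · rw [Set.indicator_of_mem hx]
  · rw [Set.indicator_of_notMem hx, stationaryDensity, Set.indicator_of_notMem]
    rintro ⟨h2, h3⟩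
    exact hx ⟨lt_of_le_of_ne h2 (Ne.symm h0), lt_of_le_of_ne h3 h1⟩

lemma atomZero_nonneg : 0 ≤ atomZero P := measureReal_nonneg

lemma mean_pos {P : ProbabilityMeasure ℝ≥0} (hm : mean P ≠ 0) : 0 < mean P :=
  lt_of_le_of_ne (integral_nonneg fun x => x.2) hm.symm

/-! ### The Laplace transform of a law with finite mean, and the mass of the stationary density. -/

section Integrable

variable {P} (hP : Integrable (fun x : ℝ≥0 => (x : ℝ)) (P : Measure ℝ≥0))
include hP

lemma continuousOn_laplaceMoment_one : ContinuousOn (laplaceMoment P 1) (Set.Ici 0) :=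
  continuousOn_of_dominated (fun t _ => by fun_prop) (fun t ht => Eventually.of_forall
    (norm_laplaceMoment_integrand_le ht)) hP (Eventually.of_forall fun x => by fun_prop)

lemma tendsto_laplaceMoment_one_atTop : Tendsto (laplaceMoment P 1) atTop (𝓝 0) := by
  have h : ∫ x : ℝ≥0, (0 : ℝ) ∂(P : Measure ℝ≥0) = 0 := integral_zero _ _
  rw [← h]
  refine tendsto_integral_filter_of_dominated_convergence _
    (Eventually.of_forall fun t => by fun_prop) ?_ hP
    (Eventually.of_forall fun x => ?_)
  · filter_upwards [eventually_ge_atTop 0] with t ht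
    exact Eventually.of_forall (norm_laplaceMoment_integrand_le ht)
  · by_cases hx : x = 0
    · simp [hx]
    · have hx' : (0 : ℝ) < x := NNReal.coe_pos.2 (pos_iff_ne_zero.2 hx)
      have := (Real.tendsto_exp_neg_atTop_nhds_zero.comp
        (tendsto_id.atTop_mul_const hx')).const_mul ((x : ℝ) ^ 1)
      simpa using this

/-- The integrand is `φ''`, the derivative of `φ'`, and `φ'` vanishes at infinity. Nonnegativity
gives integrability for free, including at `u = 0` where only continuity of `φ'` is available. -/
lemma lintegral_laplaceMoment_two {u : ℝ} (hu : 0 ≤ u) :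
    ∫⁻ s in Set.Ioi u, ENNReal.ofReal (laplaceMoment P 2 s) =
      ENNReal.ofReal (laplaceMoment P 1 u) := by
  have hcont : ContinuousWithinAt (fun s => -laplaceMoment P 1 s) (Set.Ici u) u :=
    (((continuousOn_laplaceMoment_one hP) u hu).mono (Set.Ici_subset_Ici.2 hu)).neg
  have hderiv : ∀ s ∈ Set.Ioi u, HasDerivAt (fun s => -laplaceMoment P 1 s)
      (laplaceMoment P 2 s) s := fun s hs =>
    (hasDerivAt_laplaceMoment P 1 (hu.trans_lt hs)).neg.congr_deriv (neg_neg _)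
  have hlim : Tendsto (fun s => -laplaceMoment P 1 s) atTop (𝓝 0) := by
    simpa using (tendsto_laplaceMoment_one_atTop hP).neg
  have hnn : ∀ s ∈ Set.Ioi u, 0 ≤ laplaceMoment P 2 s := fun s _ => laplaceMoment_nonneg P 2 s
  rw [← ofReal_integral_eq_lintegral_ofReal
    (integrableOn_Ioi_deriv_of_nonneg hcont hderiv hnn hlim)
    (Eventually.of_forall fun s => laplaceMoment_nonneg P 2 s),
    integral_Ioi_of_hasDerivAt_of_nonneg hcont hderiv hnn hlim]
  simp

variable (hm : mean P ≠ 0)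
include hm

lemma laplaceMoment_one_pos {t : ℝ} (ht : 0 ≤ t) : 0 < laplaceMoment P 1 t := by
  have hint : Integrable (fun x : ℝ≥0 => (x : ℝ) ^ 1 * Real.exp (-(t * (x : ℝ))))
      (P : Measure ℝ≥0) :=
    hP.mono' (by fun_prop) (Eventually.of_forall (norm_laplaceMoment_integrand_le ht))
  have hpos := mean_pos hm
  rw [mean, integral_pos_iff_support_of_nonneg (fun x => x.2) hP] at hpos
  rw [laplaceMoment, integral_pos_iff_support_of_nonneg (fun x => by positivity) hint]
  refine hpos.trans_eq (congrArg _ ?_)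
  ext x
  simp [(Real.exp_pos _).ne']

lemma strictAntiOn_laplace : StrictAntiOn (laplace P) (Set.Ici 0) :=
  strictAntiOn_of_deriv_neg (convex_Ici 0) (continuousOn_laplace P) fun t ht => by
    rw [interior_Ici] at ht
    rw [deriv_laplace P ht, neg_lt_zero]
    exact laplaceMoment_one_pos hP hm (le_of_lt ht)

lemma atomZero_lt_laplace {t : ℝ} (ht : 0 ≤ t) : atomZero P < laplace P t := by
  have h1 : atomZero P ≤ laplace P (t + 1) := by
    refine le_of_tendsto (tendsto_laplace_atTop P) ?_
    filter_upwards [eventually_ge_atTop (t + 1)] with s hs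
    exact (strictAntiOn_laplace hP hm).antitoneOn (Set.mem_Ici.2 (by linarith))
      (Set.mem_Ici.2 (by linarith)) hs
  exact h1.trans_lt (strictAntiOn_laplace hP hm ht (Set.mem_Ici.2 (by linarith)) (by linarith))

lemma laplace_lt_one {t : ℝ} (ht : 0 < t) : laplace P t < 1 := by
  rw [← laplace_zero P]
  exact strictAntiOn_laplace hP hm Set.self_mem_Ici ht.le ht

lemma laplaceInv_laplace {t : ℝ} (ht : 0 ≤ t) : laplaceInv P (laplace P t) = t :=
  (strictAntiOn_laplace hP hm).injOn.leftInvOn_invFunOn ht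

lemma image_one_sub_laplace {u : ℝ} (hu : 0 ≤ u) :
    (fun s => 1 - laplace P s) '' Set.Ioi u = Set.Ioo (1 - laplace P u) (1 - atomZero P) := by
  ext x
  constructor
  · rintro ⟨s, hs, rfl⟩
    have hs' : u < s := hs
    have h1 := strictAntiOn_laplace hP hm hu (Set.mem_Ici.2 (hu.trans hs'.le)) hs'
    have h2 := atomZero_lt_laplace hP hm (hu.trans hs'.le)
    exact ⟨by simpa using h1, by simpa using h2⟩
  · rintro ⟨h1, h2⟩
    obtain ⟨s, hs, hsy⟩ := exists_laplace_eq hu (y := 1 - x) ⟨by linarith, by linarith⟩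
    exact ⟨s, hs, by simp [hsy]⟩

lemma stationaryDensity_one_sub_laplace {s : ℝ} (hs : 0 < s) :
    stationaryDensity P (1 - laplace P s) =
      laplaceMoment P 2 s / (mean P * laplaceMoment P 1 s) := by
  have h1 := atomZero_lt_laplace hP hm hs.le
  have h2 := laplace_lt_one hP hm hs
  have h3 := mean_pos hm
  have h4 := laplaceMoment_one_pos hP hm hs.le
  rw [stationaryDensity,
    Set.indicator_of_mem (show 1 - laplace P s ∈ Set.Icc 0 (1 - atomZero P) from
    ⟨by linarith, by linarith⟩)]
  simp only [sub_sub_cancel]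
  rw [laplaceInv_laplace hP hm hs.le, deriv_laplace P hs, deriv_deriv_laplace P hs]
  field_simp

lemma stationaryDensity_nonneg_of_mem {x : ℝ} (hx : x ∈ Set.Ioo 0 (1 - atomZero P)) :
    0 ≤ stationaryDensity P x := by
  have h := image_one_sub_laplace hP hm le_rfl
  rw [laplace_zero, sub_self] at h
  rw [← h] at hx
  obtain ⟨s, hs, rfl⟩ := hx
  simp only
  rw [stationaryDensity_one_sub_laplace hP hm hs]
  exact div_nonneg (laplaceMoment_nonneg P 2 s)
    (mul_nonneg (mean_pos hm).le (laplaceMoment_nonneg P 1 s))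

lemma stationaryDensity_nonneg : 0 ≤ᵐ[volume] stationaryDensity P := by
  filter_upwards [stationaryDensity_ae_eq P] with x hx
  rw [hx]
  exact Set.indicator_nonneg (fun x hx => stationaryDensity_nonneg_of_mem hP hm hx) x

/-- The inverse of `φ` is defined by choice, but it is monotone along the image of `(0, ∞)`, which
suffices for measurability. -/
lemma aemeasurable_stationaryDensity : AEMeasurable (stationaryDensity P) := by
  have hinv : AEMeasurable (fun x => laplaceInv P (1 - x))
      (volume.restrict (Set.Ioo 0 (1 - atomZero P))) := by
    refine aemeasurable_restrict_of_monotoneOn measurableSet_Ioo ?_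
    have h := image_one_sub_laplace hP hm le_rfl
    rw [laplace_zero, sub_self] at h
    rw [← h]
    rintro _ ⟨s, hs, rfl⟩ _ ⟨r, hr, rfl⟩ hsr
    have hs' : 0 ≤ s := le_of_lt hs
    have hr' : 0 ≤ r := le_of_lt hr
    simp only [sub_sub_cancel, laplaceInv_laplace hP hm hs', laplaceInv_laplace hP hm hr']
    simp only [sub_le_sub_iff_left] at hsr
    exact ((strictAntiOn_laplace hP hm).le_iff_ge hr' hs').1 hsr
  refine AEMeasurable.congr ?_ (stationaryDensity_ae_eq P).symm
  refine (aemeasurable_indicator_iff measurableSet_Ioo).2 ?_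
  have h2 : AEMeasurable (fun x => -(1 / mean P) * (deriv (deriv (laplace P))
      (laplaceInv P (1 - x)) / deriv (laplace P) (laplaceInv P (1 - x))))
      (volume.restrict (Set.Ioo 0 (1 - atomZero P))) :=
    (((measurable_deriv _).comp_aemeasurable hinv).div
      ((measurable_deriv _).comp_aemeasurable hinv)).const_mul _
  refine h2.congr ?_
  filter_upwards [ae_restrict_mem measurableSet_Ioo] with x hx
  rw [stationaryDensity, Set.indicator_of_mem (Set.Ioo_subset_Icc_self hx)]

/-- Substitute `x = 1 - φ s`: the Jacobian `-φ' s` cancels the denominator of the density and leaves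
`φ'' s / μ` to integrate over `(u, ∞)`. The case `u = 0` gives total mass `1`. -/
lemma lintegral_stationaryDensity_Ioo {u : ℝ} (hu : 0 ≤ u) :
    ∫⁻ x in Set.Ioo (1 - laplace P u) (1 - atomZero P), ENNReal.ofReal (stationaryDensity P x) =
      ENNReal.ofReal (laplaceMoment P 1 u / mean P) := by
  have hmean := mean_pos hm
  rw [← image_one_sub_laplace hP hm hu, lintegral_image_eq_lintegral_abs_deriv_mul
    (f' := laplaceMoment P 1) measurableSet_Ioi]
  · rw [div_eq_mul_inv, ENNReal.ofReal_mul (laplaceMoment_nonneg P 1 u),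
      ← lintegral_laplaceMoment_two hP hu, ← lintegral_mul_const' _ _ ENNReal.ofReal_ne_top]
    refine setLIntegral_congr_fun measurableSet_Ioi fun s hs => ?_
    have hs' : 0 < s := hu.trans_lt hs
    have h4 := laplaceMoment_one_pos hP hm hs'.le
    rw [stationaryDensity_one_sub_laplace hP hm hs', abs_of_pos h4,
      ← ENNReal.ofReal_mul h4.le, ← ENNReal.ofReal_mul (laplaceMoment_nonneg P 2 s)]
    congr 1
    field_simp
  · intro s hs
    have := (hasDerivAt_laplace P (hu.trans_lt hs)).const_sub 1
    rw [neg_neg] at this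
    exact this.hasDerivWithinAt
  · intro s hs r hr hsr
    exact (strictAntiOn_laplace hP hm).injOn (Set.mem_Ici.2 (hu.trans (le_of_lt hs)))
      (Set.mem_Ici.2 (hu.trans (le_of_lt hr))) (by simpa using hsr)

lemma densityMeasure_stationaryDensity_Ioi {u : ℝ} (hu : 0 ≤ u) :
    densityMeasure (stationaryDensity P) (Set.Ioi (1 - laplace P u)) =
      ENNReal.ofReal (laplaceMoment P 1 u / mean P) := by
  rw [densityMeasure, withDensity_apply _ measurableSet_Ioi,
    ← lintegral_stationaryDensity_Ioo hP hm hu,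
    ← lintegral_indicator measurableSet_Ioi, ← lintegral_indicator measurableSet_Ioo]
  refine lintegral_congr_ae ?_
  filter_upwards [stationaryDensity_ae_eq P] with x hx
  simp only [Set.indicator, Set.mem_Ioi, Set.mem_Ioo] at hx ⊢
  have h1 : laplace P u ≤ 1 := by
    rw [← laplace_zero P]
    exact (strictAntiOn_laplace hP hm).antitoneOn Set.self_mem_Ici hu hu
  by_cases hx1 : 1 - laplace P u < x
  · by_cases hx2 : x < 1 - atomZero P
    · simp [hx1, hx2]
    · rw [hx]
      simp [hx2]
  · simp [hx1]

lemma isProbabilityDensity_stationaryDensity : IsProbabilityDensity (stationaryDensity P) where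
  aemeasurable := aemeasurable_stationaryDensity hP hm
  nonneg := stationaryDensity_nonneg hP hm
  lintegral_eq_one := by
    have h := lintegral_stationaryDensity_Ioo hP hm le_rfl
    rw [laplaceMoment_one_zero, div_self hm, ENNReal.ofReal_one, laplace_zero, sub_self] at h
    rw [← h, ← lintegral_indicator measurableSet_Ioo]
    refine lintegral_congr_ae ?_
    filter_upwards [stationaryDensity_ae_eq P] with x hx
    rw [hx]
    simp only [Set.indicator]
    split_ifs <;> simp

end Integrable

end Laplace

/-! ### Densities and total variation -/

section Density

variable {f g : ℝ → ℝ}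

lemma IsProbabilityDensity.integrable (hf : IsProbabilityDensity f) : Integrable f := by
  refine ⟨hf.aemeasurable.aestronglyMeasurable, ?_⟩
  rw [hasFiniteIntegral_iff_ofReal hf.nonneg, hf.lintegral_eq_one]
  exact ENNReal.one_lt_top

lemma IsProbabilityDensity.isProbabilityMeasure (hf : IsProbabilityDensity f) :
    IsProbabilityMeasure (densityMeasure f) :=
  ⟨by rw [densityMeasure, withDensity_apply _ MeasurableSet.univ, setLIntegral_univ,
    hf.lintegral_eq_one]⟩

lemma IsProbabilityDensity.densityMeasure_real (hf : IsProbabilityDensity f) {s : Set ℝ}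
    (hs : MeasurableSet s) : (densityMeasure f).real s = ∫ x in s, f x := by
  rw [measureReal_def, densityMeasure, withDensity_apply _ hs,
    integral_eq_lintegral_of_nonneg_ae (ae_restrict_of_ae hf.nonneg)
      hf.integrable.aestronglyMeasurable.restrict]

/-- The positive and negative parts of `f - g` are densities of two mutually singular measures,
hence form the Jordan decomposition of the difference; their masses add up to the `L¹` norm. -/
lemma tvDistance_eq_integral (hf : IsProbabilityDensity f) (hg : IsProbabilityDensity g)
    {Q₁ Q₂ : Measure ℝ} [IsFiniteMeasure Q₁] [IsFiniteMeasure Q₂] (h₁ : Q₁ = densityMeasure f)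
    (h₂ : Q₂ = densityMeasure g) : tvDistance Q₁ Q₂ = ∫ x, |f x - g x| := by
  subst h₁ h₂
  have hint : Integrable (fun x => f x - g x) := hf.integrable.sub hg.integrable
  have : IsFiniteMeasure (volume.withDensity fun x => ENNReal.ofReal (f x - g x)) :=
    isFiniteMeasure_withDensity_ofReal hint.2
  have : IsFiniteMeasure (volume.withDensity fun x => ENNReal.ofReal (-(f x - g x))) :=
    isFiniteMeasure_withDensity_ofReal hint.neg.2
  -- Mutual singularity is proved for a genuinely measurable representative and transferred back.
  obtain ⟨h, hh, hae⟩ := hint.aestronglyMeasurable.aemeasurable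
  have hms : (volume.withDensity fun x => ENNReal.ofReal (f x - g x)) ⟂ₘ
      (volume.withDensity fun x => ENNReal.ofReal (-(f x - g x))) := by
    have e1 : (fun x => ENNReal.ofReal (f x - g x)) =ᵐ[volume] fun x => ENNReal.ofReal (h x) :=
      hae.fun_comp ENNReal.ofReal
    have e2 : (fun x => ENNReal.ofReal (-(f x - g x))) =ᵐ[volume]
        fun x => ENNReal.ofReal (-h x) := hae.fun_comp fun y => ENNReal.ofReal (-y)
    rw [withDensity_congr_ae e1, withDensity_congr_ae e2]
    exact withDensity_ofReal_mutuallySingular hh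
  let J : JordanDecomposition ℝ := ⟨_, _, hms⟩
  have hJ : (densityMeasure f).toSignedMeasure - (densityMeasure g).toSignedMeasure =
      J.toSignedMeasure := by
    ext s hs
    rw [JordanDecomposition.toSignedMeasure, Measure.toSignedMeasure_sub_apply hs,
      Measure.toSignedMeasure_sub_apply hs, hf.densityMeasure_real hs, hg.densityMeasure_real hs,
      ← integral_sub hf.integrable.integrableOn hg.integrable.integrableOn,
      integral_eq_lintegral_pos_part_sub_lintegral_neg_part hint.integrableOn,
      measureReal_def, measureReal_def, withDensity_apply _ hs, withDensity_apply _ hs]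
  rw [tvDistance, SignedMeasure.totalVariation, SignedMeasure.toJordanDecomposition_eq hJ]
  simp only [J, Measure.add_apply, withDensity_apply _ MeasurableSet.univ, setLIntegral_univ]
  rw [← lintegral_add_left' hint.aestronglyMeasurable.aemeasurable.ennreal_ofReal,
    integral_eq_lintegral_of_nonneg_ae (Eventually.of_forall fun x => abs_nonneg _)
      hint.abs.aestronglyMeasurable]
  congr 1
  refine lintegral_congr fun x => ?_
  rcases le_total 0 (f x - g x) with h0 | h0
  · rw [abs_of_nonneg h0, ENNReal.ofReal_of_nonpos (neg_nonpos.2 h0), add_zero]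
  · rw [abs_of_nonpos h0, ENNReal.ofReal_of_nonpos h0, zero_add]

end Density

/-! ### The limiting law of the search-cost -/

section LimitLaw

variable {P : ProbabilityMeasure ℝ≥0} (hP : Integrable (fun x : ℝ≥0 => (x : ℝ)) (P : Measure ℝ≥0))
  (hm : mean P ≠ 0) {t : ℝ} (ht : 0 < t)

include hP hm in
lemma laplace_pos (ht : 0 ≤ t) : 0 < laplace P t :=
  (atomZero_nonneg P).trans_lt (atomZero_lt_laplace hP hm ht)

lemma outHeight_nonneg (t : ℝ) : 0 ≤ outHeight P t := by
  refine div_nonneg (abs_nonneg _) (mul_nonneg ?_ ?_)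
  · exact integral_nonneg fun x => x.2
  · exact integral_nonneg fun x => Real.exp_nonneg _

include hP hm

lemma integrableOn_abs_stationaryDensity_sub :
    IntegrableOn (fun x => |stationaryDensity P x - outHeight P t|)
      (Set.Ioc (1 - laplace P t) (1 - atomZero P)) :=
  (((isProbabilityDensity_stationaryDensity hP hm).integrable.integrableOn).sub
    (integrableOn_const (by simp))).abs

include ht

lemma outHeight_mul_laplace :
    outHeight P t * laplace P t = |deriv (laplace P) t| / mean P := by
  have := laplace_pos hP hm ht.le
  rw [outHeight]
  field_simp

lemma densityMeasure_stationaryDensity_Ioi' :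
    densityMeasure (stationaryDensity P) (Set.Ioi (1 - laplace P t)) =
      ENNReal.ofReal (|deriv (laplace P) t| / mean P) := by
  rw [densityMeasure_stationaryDensity_Ioi hP hm ht.le, abs_deriv_laplace P ht]

/-- The stationary density vanishes on negative reals, so `Icc` may be replaced by a half-line in
its first piece. -/
lemma ofReal_transientDensity_ae_eq :
    (fun x => ENNReal.ofReal (transientDensity P t x)) =ᵐ[volume] fun x =>
      (Set.Iic (1 - laplace P t)).indicator (fun x => ENNReal.ofReal (stationaryDensity P x)) x +
      (Set.Icc (1 - laplace P t) 1).indicator (fun _ => ENNReal.ofReal (outHeight P t)) x := by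
  have hc := laplace_lt_one hP hm ht
  filter_upwards [stationaryDensity_nonneg hP hm] with x hx
  have h1 : (Set.Icc 0 (1 - laplace P t)).indicator (stationaryDensity P) x =
      (Set.Iic (1 - laplace P t)).indicator (stationaryDensity P) x := by
    by_cases h0 : 0 ≤ x
    · simp [Set.indicator, h0]
    · have : stationaryDensity P x = 0 := Set.indicator_of_notMem (fun h => h0 h.1) _
      simp [Set.indicator, this]
  rw [transientDensity, h1, ENNReal.ofReal_add]
  · simp only [Set.indicator]
    split_ifs <;> simp
  · simp only [Set.indicator]
    split_ifs
    · exact hx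
    · exact le_rfl
  · exact Set.indicator_nonneg (fun _ _ => outHeight_nonneg t) x

lemma densityMeasure_transientDensity_apply {B : Set ℝ} (hB : MeasurableSet B) :
    densityMeasure (transientDensity P t) B =
      densityMeasure (stationaryDensity P) (B ∩ Set.Iic (1 - laplace P t)) +
        ENNReal.ofReal (outHeight P t) * volume (B ∩ Set.Icc (1 - laplace P t) 1) := by
  rw [densityMeasure, withDensity_apply _ hB,
    lintegral_congr_ae (ae_restrict_of_ae (ofReal_transientDensity_ae_eq hP hm ht)),
    lintegral_add_right _ (measurable_const.indicator measurableSet_Icc),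
    setLIntegral_indicator measurableSet_Iic, setLIntegral_indicator measurableSet_Icc,
    setLIntegral_const, densityMeasure, withDensity_apply _ (hB.inter measurableSet_Iic),
    Set.inter_comm B, Set.inter_comm B]

/-- The height of the uniform piece is such that it carries exactly the stationary mass beyond `1 -
φ t`. -/
lemma ofReal_outHeight_mul_volume :
    ENNReal.ofReal (outHeight P t) * volume (Set.Icc (1 - laplace P t) 1) =
      ENNReal.ofReal (|deriv (laplace P) t| / mean P) := by
  rw [Real.volume_Icc, ← ENNReal.ofReal_mul (outHeight_nonneg t), sub_sub_cancel,
    outHeight_mul_laplace hP hm ht]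

lemma isProbabilityDensity_transientDensity :
    IsProbabilityDensity (transientDensity P t) where
  aemeasurable := by
    refine AEMeasurable.add ?_ ?_
    · exact (aemeasurable_stationaryDensity hP hm).indicator measurableSet_Icc
    · exact aemeasurable_const.indicator measurableSet_Icc
  nonneg := by
    filter_upwards [stationaryDensity_nonneg hP hm] with x hx
    refine add_nonneg ?_ (Set.indicator_nonneg (fun _ _ => outHeight_nonneg t) x)
    simp only [Set.indicator]
    split_ifs
    · exact hx
    · exact le_rfl
  lintegral_eq_one := by
    have h := densityMeasure_transientDensity_apply hP hm ht MeasurableSet.univ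
    rw [densityMeasure, withDensity_apply _ MeasurableSet.univ, setLIntegral_univ] at h
    have := (isProbabilityDensity_stationaryDensity hP hm).isProbabilityMeasure
    rw [h, Set.univ_inter, Set.univ_inter, ofReal_outHeight_mul_volume hP hm ht,
      ← densityMeasure_stationaryDensity_Ioi' hP hm ht, ← Set.compl_Iic,
      measure_add_measure_compl measurableSet_Iic, measure_univ]

lemma hasLaw_transient {Ω' : Type*} [MeasurableSpace Ω'] {Pr' : Measure Ω'}
    [IsProbabilityMeasure Pr'] {Sinf U St : Ω' → ℝ}
    (hS : HasLaw Sinf (densityMeasure (stationaryDensity P)) Pr')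
    (hU : pdf.IsUniform U (Set.Icc (1 - laplace P t) 1) Pr') (hind : IndepFun Sinf U Pr')
    (hSt : IdentDistrib St (fun ω => {ω | Sinf ω ≤ 1 - laplace P t}.indicator Sinf ω +
      {ω | 1 - laplace P t < Sinf ω}.indicator U ω) Pr' Pr') :
    HasLaw St (densityMeasure (transientDensity P t)) Pr' := by
  refine ⟨hSt.aemeasurable_fst, ?_⟩
  rw [hSt.map_eq]
  have hφ := laplace_pos hP hm ht.le
  set c := 1 - laplace P t with hc
  have hvol : volume (Set.Icc c 1) = ENNReal.ofReal (laplace P t) := by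
    rw [Real.volume_Icc, hc, sub_sub_cancel]
  have hvol0 : volume (Set.Icc c 1) ≠ 0 := by simpa [hvol] using hφ
  have hvolt : volume (Set.Icc c 1) ≠ ∞ := by simp [hvol]
  have hUm := hU.aemeasurable hvol0 hvolt
  have hD := (isProbabilityDensity_stationaryDensity hP hm).isProbabilityMeasure
  let v : ℝ × ℝ → ℝ := fun q => if q.1 ≤ c then q.1 else q.2
  have hv : Measurable v :=
    Measurable.ite (measurableSet_le measurable_fst measurable_const) measurable_fst measurable_snd
  have hveq : (fun ω => {ω | Sinf ω ≤ c}.indicator Sinf ω + {ω | c < Sinf ω}.indicator U ω) =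
      fun ω => v (Sinf ω, U ω) := by
    funext ω
    by_cases h : Sinf ω ≤ c
    · simp [v, h, not_lt.2 h]
    · simp [v, h, not_le.1 h]
  have hmap := (indepFun_iff_map_prod_eq_prod_map_map hS.aemeasurable hUm).1 hind
  have hUprob : IsProbabilityMeasure (Pr'.map U) := Measure.isProbabilityMeasure_map hUm
  rw [hveq, show (fun ω => v (Sinf ω, U ω)) = v ∘ fun ω => (Sinf ω, U ω) from rfl,
    ← AEMeasurable.map_map_of_aemeasurable hv.aemeasurable (hS.aemeasurable.prodMk hUm), hmap,
    hS.map_eq]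
  ext B hB
  rw [densityMeasure_transientDensity_apply hP hm ht hB, Measure.map_apply hv hB,
    Measure.prod_apply (hv hB)]
  -- Freeze the value `s` of the stationary variable: up to `c` the result is `s` itself and the
  -- section is everything or nothing; beyond `c` it is the uniform variable.
  have hsec : ∀ s, Pr'.map U (Prod.mk s ⁻¹' (v ⁻¹' B)) =
      (B ∩ Set.Iic c).indicator 1 s + (Set.Ioi c).indicator (fun _ => Pr'.map U B) s :=
    fun s => by
      by_cases hs : s ≤ c
      · by_cases hsB : s ∈ B
        · have : Prod.mk s ⁻¹' (v ⁻¹' B) = Set.univ := by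
            ext u
            simp [v, hs, hsB]
          simp [this, hs, hsB]
        · have : Prod.mk s ⁻¹' (v ⁻¹' B) = ∅ := by
            ext u
            simp [v, hs, hsB]
          simp [this, hs, hsB]
      · have : Prod.mk s ⁻¹' (v ⁻¹' B) = B := by
          ext u
          simp [v, hs]
        simp [this, hs, not_le.1 hs]
  simp_rw [hsec]
  rw [lintegral_add_left (measurable_one.indicator (hB.inter measurableSet_Iic)),
    lintegral_indicator_one (hB.inter measurableSet_Iic),
    lintegral_indicator_const measurableSet_Ioi, hc,
    densityMeasure_stationaryDensity_Ioi' hP hm ht, ← ofReal_outHeight_mul_volume hP hm ht, ← hc,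
    Measure.map_apply_of_aemeasurable hUm hB, hU.measure_preimage hvol0 hvolt hB, mul_comm,
    mul_assoc, ENNReal.mul_div_cancel hvol0 hvolt, Set.inter_comm B (Set.Icc c 1)]

/-- The densities agree below `1 - φ t`, and beyond `1 - P {0}` only the uniform piece survives. The
point `1 - φ t`, where both pieces of the transient density are present, is excluded. -/
lemma abs_transientDensity_sub_ae_eq :
    (fun x => |transientDensity P t x - stationaryDensity P x|) =ᵐ[volume] fun x =>
      (Set.Ioc (1 - laplace P t) (1 - atomZero P)).indicator
        (fun x => |stationaryDensity P x - outHeight P t|) x +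
      (Set.Ioc (1 - atomZero P) 1).indicator (fun _ => outHeight P t) x := by
  have h1 := atomZero_lt_laplace hP hm ht.le
  have h2 := laplace_lt_one hP hm ht
  have h3 := atomZero_nonneg P
  filter_upwards [Measure.ae_ne volume (1 - laplace P t)] with x hx
  have hzero : x ∉ Set.Icc 0 (1 - atomZero P) → stationaryDensity P x = 0 :=
    fun h => Set.indicator_of_notMem h _
  rw [transientDensity]
  by_cases ha : x < 1 - laplace P t
  · have e1 : x ∉ Set.Icc (1 - laplace P t) 1 := fun h => ha.not_ge h.1
    have e2 : x ∉ Set.Ioc (1 - laplace P t) (1 - atomZero P) := fun h => ha.not_gt h.1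
    have e3 : x ∉ Set.Ioc (1 - atomZero P) 1 := fun h => by linarith [h.1]
    rw [Set.indicator_of_notMem e1, Set.indicator_of_notMem e2, Set.indicator_of_notMem e3]
    by_cases h0 : 0 ≤ x
    · rw [Set.indicator_of_mem (show x ∈ Set.Icc 0 (1 - laplace P t) from ⟨h0, ha.le⟩)]
      simp
    · rw [hzero fun h => h0 h.1, Set.indicator_of_notMem fun h => h0 h.1]
      simp
  · have ha' : 1 - laplace P t < x := lt_of_le_of_ne (not_lt.1 ha) (Ne.symm hx)
    have e0 : x ∉ Set.Icc 0 (1 - laplace P t) := fun h => ha'.not_ge h.2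
    rw [Set.indicator_of_notMem e0, zero_add]
    by_cases hb : x ≤ 1 - atomZero P
    · have e3 : x ∉ Set.Ioc (1 - atomZero P) 1 := fun h => hb.not_gt h.1
      rw [Set.indicator_of_mem (show x ∈ Set.Icc (1 - laplace P t) 1 from ⟨ha'.le, by linarith⟩),
        Set.indicator_of_mem (show x ∈ Set.Ioc (1 - laplace P t) (1 - atomZero P) from ⟨ha', hb⟩),
        Set.indicator_of_notMem e3, add_zero, abs_sub_comm]
    · have hb' := not_le.1 hb
      have e2 : x ∉ Set.Ioc (1 - laplace P t) (1 - atomZero P) := fun h => hb h.2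
      rw [hzero fun h => hb h.2, sub_zero, Set.indicator_of_notMem e2, zero_add]
      by_cases hd : x ≤ 1
      · rw [Set.indicator_of_mem (show x ∈ Set.Icc (1 - laplace P t) 1 from ⟨ha'.le, hd⟩),
          Set.indicator_of_mem (show x ∈ Set.Ioc (1 - atomZero P) 1 from ⟨hb', hd⟩),
          abs_of_nonneg (outHeight_nonneg t)]
      · rw [Set.indicator_of_notMem (fun h => hd h.2), Set.indicator_of_notMem (fun h => hd h.2),
          abs_zero]

lemma integral_abs_transientDensity_sub :
    ∫ x, |transientDensity P t x - stationaryDensity P x| =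
      (∫ x in (1 - laplace P t)..(1 - atomZero P), |stationaryDensity P x - outHeight P t|) +
        |deriv (laplace P) t| * atomZero P / (mean P * laplace P t) := by
  have h1 := atomZero_lt_laplace hP hm ht.le
  have h3 := atomZero_nonneg P
  rw [integral_congr_ae (abs_transientDensity_sub_ae_eq hP hm ht), integral_add
    ((integrable_indicator_iff measurableSet_Ioc).2
      (integrableOn_abs_stationaryDensity_sub hP hm))
    ((integrable_indicator_iff measurableSet_Ioc).2 (integrableOn_const (by simp))),
    integral_indicator measurableSet_Ioc, integral_indicator_const _ measurableSet_Ioc,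
    intervalIntegral.integral_of_le (by linarith), Real.volume_real_Ioc_of_le (by linarith),
    outHeight, smul_eq_mul]
  ring

lemma integral_stationaryDensity_Ioc :
    ∫ x in Set.Ioc (1 - laplace P t) (1 - atomZero P), stationaryDensity P x =
      |deriv (laplace P) t| / mean P := by
  have hmean := mean_pos hm
  rw [integral_Ioc_eq_integral_Ioo, integral_eq_lintegral_of_nonneg_ae
    (ae_restrict_of_ae (stationaryDensity_nonneg hP hm))
    (aemeasurable_stationaryDensity hP hm).aestronglyMeasurable.restrict,
    lintegral_stationaryDensity_Ioo hP hm ht.le, abs_deriv_laplace P ht,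
    ENNReal.toReal_ofReal (div_nonneg (laplaceMoment_nonneg P 1 t) hmean.le)]

/-- Bound `|f - h|` by `f + h` between `1 - φ t` and `1 - P {0}`. With the remaining part up to `1`,
the constants `h` integrate to `h * φ t`, which equals the stationary mass of `f`. -/
lemma integral_abs_transientDensity_sub_le :
    ∫ x, |transientDensity P t x - stationaryDensity P x| ≤
      2 * (|deriv (laplace P) t| / mean P) := by
  have h1 := atomZero_lt_laplace hP hm ht.le
  have h3 := outHeight_mul_laplace hP hm ht
  rw [integral_abs_transientDensity_sub hP hm ht, intervalIntegral.integral_of_le (by linarith)]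
  have hint := (isProbabilityDensity_stationaryDensity hP hm).integrable.integrableOn
    (s := Set.Ioc (1 - laplace P t) (1 - atomZero P))
  have hle : ∫ x in Set.Ioc (1 - laplace P t) (1 - atomZero P),
      |stationaryDensity P x - outHeight P t| ≤
      ∫ x in Set.Ioc (1 - laplace P t) (1 - atomZero P),
        (stationaryDensity P x + outHeight P t) := by
    refine integral_mono_ae (integrableOn_abs_stationaryDensity_sub hP hm)
      (hint.add (integrableOn_const (by simp)))
      (ae_restrict_of_ae ?_)
    filter_upwards [stationaryDensity_nonneg hP hm] with x hx
    have h0 := outHeight_nonneg (P := P) t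
    have hx' : 0 ≤ stationaryDensity P x := hx
    rw [abs_le]
    constructor <;> linarith
  rw [integral_add hint (integrableOn_const (by simp)), integral_stationaryDensity_Ioc hP hm ht,
    setIntegral_const, Real.volume_real_Ioc_of_le (by linarith), smul_eq_mul] at hle
  have h4 : |deriv (laplace P) t| * atomZero P / (mean P * laplace P t) =
      atomZero P * outHeight P t := by
    rw [outHeight]
    ring
  rw [h4]
  linarith

end LimitLaw

/-! ### The law of large numbers -/

section LLN

lemma continuous_laplace_measure {u : ℝ} (hu : 0 ≤ u) :
    Continuous fun ν : ProbabilityMeasure ℝ≥0 => laplace ν u := by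
  refine continuous_iff_continuousAt.2 fun ν => ?_
  let f : ℝ≥0 →ᵇ ℝ := BoundedContinuousFunction.ofNormedAddCommGroup
    (fun x : ℝ≥0 => Real.exp (-(u * (x : ℝ)))) (by fun_prop) 1 fun _ => by
      rw [Real.norm_of_nonneg (Real.exp_nonneg _)]
      exact exp_neg_mul_le_one hu _
  exact ProbabilityMeasure.tendsto_iff_forall_integral_tendsto.1 tendsto_id f

lemma laplace_nonneg (ν : ProbabilityMeasure ℝ≥0) (u : ℝ) : 0 ≤ laplace ν u :=
  integral_nonneg fun _ => Real.exp_nonneg _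

lemma laplace_le_one (ν : ProbabilityMeasure ℝ≥0) {u : ℝ} (hu : 0 ≤ u) : laplace ν u ≤ 1 := by
  have := integral_mono (integrable_exp_neg_mul ν hu) (integrable_const 1)
    fun x => exp_neg_mul_le_one hu x
  simpa [laplace] using this

lemma laplace_empiricalMeasure {n : ℕ} [NeZero n] (x : Fin n → ℝ≥0) (u : ℝ) :
    laplace (empiricalMeasure x) u = (∑ i, Real.exp (-(u * (x i : ℝ)))) / n := by
  rw [laplace, empiricalMeasure, ProbabilityMeasure.coe_mk, integral_smul_measure,
    integral_finsetSum_measure fun i _ => integrable_dirac (by simp)]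
  simp only [integral_dirac, smul_eq_mul, ENNReal.toReal_inv, ENNReal.toReal_natCast]
  rw [div_eq_inv_mul]

lemma abs_exp_neg_sub_exp_neg_le {a b : ℝ} (ha : 0 ≤ a) (hb : 0 ≤ b) :
    |Real.exp (-a) - Real.exp (-b)| ≤ |a - b| := by
  have key : ∀ {a b : ℝ}, 0 ≤ a → a ≤ b → Real.exp (-a) - Real.exp (-b) ≤ b - a := by
    intro a b ha hab
    have h1 : Real.exp (-b) = Real.exp (-a) * Real.exp (-(b - a)) := by
      rw [← Real.exp_add]
      ring_nf
    have h2 := Real.add_one_le_exp (-(b - a))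
    have h3 : Real.exp (-a) ≤ 1 := Real.exp_le_one_iff.2 (by linarith)
    have h4 := Real.exp_pos (-a)
    rw [h1]
    nlinarith
  rcases le_total a b with h | h
  · rw [abs_of_nonneg (sub_nonneg.2 (Real.exp_le_exp.2 (by linarith))), abs_of_nonpos (by linarith)]
    linarith [key ha h]
  · rw [abs_of_nonpos (sub_nonpos.2 (Real.exp_le_exp.2 (by linarith))), abs_of_nonneg (by linarith)]
    linarith [key hb h]

lemma avgSurvival_nonneg {n : ℕ} (s : ℝ) (w : Fin n → ℝ≥0) : 0 ≤ avgSurvival s w :=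
  div_nonneg (Finset.sum_nonneg fun i _ => survival_nonneg s i w) (Nat.cast_nonneg n)

lemma avgSurvival_le_one {n : ℕ} {s : ℝ} (hs : 0 ≤ s) (w : Fin n → ℝ≥0) : avgSurvival s w ≤ 1 := by
  refine div_le_one_of_le₀ ((Finset.sum_le_card_nsmul _ _ 1 fun i _ =>
    survival_le_one hs i w).trans_eq ?_) (Nat.cast_nonneg n)
  simp

/-- This is what makes the unknown scaling `Z n` harmless: the dynamics depends only on
popularities. -/
lemma popularity_smul {n : ℕ} {z : ℝ≥0} (hz : 0 < z) (w : Fin n → ℝ≥0) (i : Fin n) :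
    popularity (fun j => z * w j) i = popularity w i := by
  simp only [popularity]
  rw [← Finset.mul_sum, mul_div_mul_left _ _ hz.ne']

/-- The survival probabilities at rescaled times are close to those obtained by replacing the
empirical mean by its limit. -/
lemma abs_avgSurvival_sub_laplace_le {n : ℕ} [NeZero n] (x : Fin n → ℝ≥0) {m u : ℝ} (hm : 0 ≤ m)
    (hu : 0 ≤ u) :
    |avgSurvival (n * m * u) x - laplace (empiricalMeasure x) u| ≤
      min 1 (u * |(∑ i, (x i : ℝ)) / n - m|) := by
  have hn : (0 : ℝ) < n := Nat.cast_pos.2 (Nat.pos_of_ne_zero (NeZero.ne n))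
  refine le_min ?_ ?_
  · have h1 := avgSurvival_nonneg (n * m * u) x
    have h2 := avgSurvival_le_one (s := n * m * u) (by positivity) x
    have h3 := laplace_nonneg (empiricalMeasure x) u
    have h4 := laplace_le_one (empiricalMeasure x) hu
    rw [abs_le]
    constructor <;> linarith
  · have hsub : avgSurvival (n * m * u) x - laplace (empiricalMeasure x) u =
        (∑ i, (survival (n * m * u) i x - Real.exp (-(u * (x i : ℝ))))) / n := by
      rw [laplace_empiricalMeasure, avgSurvival, Finset.sum_sub_distrib, sub_div]
    rw [hsub, abs_div, abs_of_pos hn, div_le_iff₀ hn]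
    refine (Finset.abs_sum_le_sum_abs _ _).trans ?_
    set S := ∑ i, (x i : ℝ) with hS
    have hS0 : 0 ≤ S := Finset.sum_nonneg fun i _ => (x i).2
    -- If all weights vanish, the convention `0 / 0 = 0` makes both exponentials equal to `1`.
    rcases eq_or_lt_of_le hS0 with h0 | hpos
    · have hx : ∀ i, x i = 0 := fun i => by
        have := (Finset.sum_eq_zero_iff_of_nonneg fun i _ => (x i).2).1 h0.symm i
          (Finset.mem_univ i)
        exact NNReal.coe_eq_zero.1 this
      have : ∀ i, survival (n * m * u) i x - Real.exp (-(u * (x i : ℝ))) = 0 := fun i => by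
        simp [survival, popularity, hx]
      simp only [this, abs_zero, Finset.sum_const_zero]
      positivity
    · have hp : ∀ i, (popularity x i : ℝ) = x i / S := fun i => by
        simp [popularity, hS]
      have hle : ∀ i, |survival (n * m * u) i x - Real.exp (-(u * (x i : ℝ)))| ≤
          x i * (u * |n * m / S - 1|) := fun i => by
        rw [survival, hp]
        refine (abs_exp_neg_sub_exp_neg_le (by positivity) (by positivity)).trans (le_of_eq ?_)
        rw [show (x i : ℝ) / S * (n * m * u) - u * x i = x i * (u * (n * m / S - 1)) by ring,
          abs_mul, abs_mul, abs_of_nonneg hu, abs_of_nonneg (NNReal.coe_nonneg (x i))]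
      refine (Finset.sum_le_sum fun i _ => hle i).trans (le_of_eq ?_)
      rw [← Finset.sum_mul, ← hS]
      have e1 : S * |n * m / S - 1| = |S / n - m| * n := by
        calc S * |n * m / S - 1| = |S * (n * m / S - 1)| := by rw [abs_mul, abs_of_pos hpos]
          _ = |(S / n - m) * n| := by
            rw [← abs_neg]
            congr 1
            field_simp
            ring
          _ = _ := by rw [abs_mul, abs_of_pos hn]
      rw [mul_left_comm, e1, mul_assoc]

/-- The Laplace transforms of the empirical measures are convex in time. -/
lemma avgSurvival_sub_ge {n : ℕ} (hn : n ≠ 0) (w : Fin n → ℝ≥0) (m u v : ℝ) :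
    -(v - u) * (m * nextSurvival (n * m * u) w) ≤
      avgSurvival (n * m * v) w - avgSurvival (n * m * u) w := by
  have hn' : (0 : ℝ) < n := Nat.cast_pos.2 (Nat.pos_of_ne_zero hn)
  rw [avgSurvival, avgSurvival, nextSurvival, ← sub_div, ← Finset.sum_sub_distrib,
    le_div_iff₀ hn', Finset.mul_sum, Finset.mul_sum, Finset.sum_mul]
  refine Finset.sum_le_sum fun i _ => ?_
  rw [survival, survival]
  set q := (popularity w i : ℝ) with hq
  have h1 : Real.exp (-(q * (n * m * v))) =
      Real.exp (-(q * (n * m * u))) * Real.exp (-(q * (n * m * (v - u)))) := by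
    rw [← Real.exp_add]
    ring_nf
  -- Each exponential lies above its tangent at `u`; the sum of the slopes is `-m` times
  -- `nextSurvival`.
  have h2 := Real.add_one_le_exp (-(q * (n * m * (v - u))))
  have h3 := Real.exp_pos (-(q * (n * m * u)))
  rw [h1]
  nlinarith

variable {Ω : ℕ+ → Type*} [∀ n, MeasurableSpace (Ω n)] {Pr : ∀ n, Measure (Ω n)}
  [∀ n, IsProbabilityMeasure (Pr n)] {w : ∀ n : ℕ+, Ω n → Fin n → ℝ≥0}
  (hw : ∀ n, Measurable (w n)) {P : ProbabilityMeasure ℝ≥0} (hLLN : SatisfiesLLN Pr w P)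

include hw hLLN

/-- Compare the average with the Laplace transform of the empirical measure, then that with `φ u`.
Each error is a bounded continuous functional of a quantity converging in law to a constant at which
the functional vanishes. -/
lemma tendsto_integral_abs_avgSurvival_sub {u : ℝ} (hu : 0 ≤ u) :
    Tendsto (fun n : ℕ+ => ∫ ω, |avgSurvival ((n : ℕ) * mean P * u) (w n ω) - laplace P u| ∂(Pr n))
      atTop (𝓝 0) := by
  obtain ⟨Z, hZm, hZ, h1, h2⟩ := hLLN.exists_scaling
  have hmean := mean_pos hLLN.mean_ne_zero
  let Ψ₁ : ProbabilityMeasure ℝ≥0 →ᵇ ℝ := BoundedContinuousFunction.ofNormedAddCommGroup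
    (fun ν => |laplace ν u - laplace P u|)
    ((continuous_laplace_measure hu).sub continuous_const).abs 1 fun ν => by
      have := laplace_nonneg ν u
      have := laplace_le_one ν hu
      have := laplace_nonneg P u
      have := laplace_le_one P hu
      rw [Real.norm_eq_abs, abs_abs, abs_le]
      constructor <;> linarith
  -- The truncation at `1` turns the error due to the empirical mean into a bounded test function.
  let Ψ₂ : ℝ →ᵇ ℝ := BoundedContinuousFunction.ofNormedAddCommGroup
    (fun y => min 1 (u * |y - mean P|)) (by fun_prop) 1 fun y => by
      rw [Real.norm_of_nonneg (by positivity)]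
      exact min_le_left _ _
  have h1' := h1 Ψ₁
  have h2' := h2 Ψ₂
  have hlim := h1'.add h2'
  simp only [Ψ₁, Ψ₂, BoundedContinuousFunction.coe_ofNormedAddCommGroup, sub_self, abs_zero,
    mul_zero, zero_le_one, min_eq_right, add_zero] at hlim
  refine squeeze_zero (fun n => integral_nonneg fun ω => abs_nonneg _) (fun n => ?_) hlim
  have hmx : ∀ i, Measurable fun ω => Z n ω * w n ω i := fun i =>
    (hZm n).mul ((measurable_pi_apply i).comp (hw n))
  have hi1 : Integrable (fun ω => |laplace (empiricalMeasure fun i => Z n ω * w n ω i) u -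
      laplace P u|) (Pr n) := by
    refine Integrable.of_bound (C := 1) ?_ (Eventually.of_forall fun ω => Ψ₁.norm_coe_le_norm
      (empiricalMeasure fun i => Z n ω * w n ω i) |>.trans
        (BoundedContinuousFunction.norm_ofNormedAddCommGroup_le _ zero_le_one _))
    simp only [laplace_empiricalMeasure]
    refine Measurable.aestronglyMeasurable ?_
    have : Measurable fun ω => ∑ i, Real.exp (-(u * ((Z n ω * w n ω i : ℝ≥0) : ℝ))) :=
      Finset.measurable_fun_sum _ fun i _ => by
        have := hmx i
        fun_prop
    fun_prop
  have hi2 : Integrable (fun ω => min 1 (u * |(∑ i, (Z n ω : ℝ) * (w n ω i : ℝ)) / ((n : ℕ) : ℝ) -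
      mean P|)) (Pr n) := by
    refine Integrable.of_bound (C := 1) ?_ (Eventually.of_forall fun ω => Ψ₂.norm_coe_le_norm
      ((∑ i, (Z n ω : ℝ) * (w n ω i : ℝ)) / ((n : ℕ) : ℝ)) |>.trans
        (BoundedContinuousFunction.norm_ofNormedAddCommGroup_le _ zero_le_one _))
    refine Measurable.aestronglyMeasurable ?_
    have : Measurable fun ω => ∑ i, (Z n ω : ℝ) * (w n ω i : ℝ) :=
      Finset.measurable_fun_sum _ fun i _ => (measurable_coe_nnreal_real.comp (hZm n)).mul
        (measurable_coe_nnreal_real.comp ((measurable_pi_apply i).comp (hw n)))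
    fun_prop
  rw [← integral_add hi1 hi2]
  refine integral_mono_of_nonneg (Eventually.of_forall fun ω => abs_nonneg _) (hi1.add hi2) ?_
  filter_upwards [hZ n] with ω hω
  have h3 := abs_avgSurvival_sub_laplace_le (fun i => Z n ω * w n ω i) hmean.le hu
  have h4 : avgSurvival ((n : ℕ) * mean P * u) (fun i => Z n ω * w n ω i) =
      avgSurvival ((n : ℕ) * mean P * u) (w n ω) := by
    simp only [avgSurvival, survival, popularity_smul hω]
  rw [h4] at h3
  simp only [NNReal.coe_mul] at h3
  have h5 := abs_sub_le (avgSurvival ((n : ℕ) * mean P * u) (w n ω))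
    (laplace (empiricalMeasure fun i => Z n ω * w n ω i) u) (laplace P u)
  linarith

omit hLLN in
lemma integrable_avgSurvival {m u : ℝ} (hm : 0 ≤ m) (hu : 0 ≤ u) (n : ℕ+) :
    Integrable (fun ω => avgSurvival ((n : ℕ) * m * u) (w n ω)) (Pr n) :=
  Integrable.of_bound ((measurable_avgSurvival _).comp (hw n)).aestronglyMeasurable 1
    (Eventually.of_forall fun ω => by
      rw [Real.norm_of_nonneg (avgSurvival_nonneg _ _)]
      exact avgSurvival_le_one (by positivity) _)

lemma tendsto_integral_avgSurvival {u : ℝ} (hu : 0 ≤ u) :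
    Tendsto (fun n : ℕ+ => ∫ ω, avgSurvival ((n : ℕ) * mean P * u) (w n ω) ∂(Pr n))
      atTop (𝓝 (laplace P u)) := by
  rw [tendsto_iff_dist_tendsto_zero]
  refine squeeze_zero (fun n => dist_nonneg) (fun n => ?_)
    (tendsto_integral_abs_avgSurvival_sub hw hLLN hu)
  have hi := integrable_avgSurvival (Pr := Pr) hw (mean_pos hLLN.mean_ne_zero).le hu n
  have h1 : ∫ ω, avgSurvival ((n : ℕ) * mean P * u) (w n ω) ∂(Pr n) - laplace P u =
      ∫ ω, (avgSurvival ((n : ℕ) * mean P * u) (w n ω) - laplace P u) ∂(Pr n) := by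
    rw [integral_sub hi (integrable_const _)]
    simp
  rw [Real.dist_eq, h1]
  exact abs_integral_le_integral_abs

/-- Values in `[0, 1]` make squaring Lipschitz with constant `2`, so the convergence in mean carries
over. -/
lemma tendsto_integral_avgSurvival_sq {u : ℝ} (hu : 0 ≤ u) :
    Tendsto (fun n : ℕ+ => ∫ ω, avgSurvival ((n : ℕ) * mean P * u) (w n ω) ^ 2 ∂(Pr n))
      atTop (𝓝 (laplace P u ^ 2)) := by
  have hmean := mean_pos hLLN.mean_ne_zero
  rw [tendsto_iff_dist_tendsto_zero]
  have h0 := (tendsto_integral_abs_avgSurvival_sub hw hLLN hu).const_mul 2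
  rw [mul_zero] at h0
  refine squeeze_zero (fun n => dist_nonneg) (fun n => ?_) h0
  have hi := integrable_avgSurvival (Pr := Pr) hw hmean.le hu n
  have hi2 : Integrable (fun ω => avgSurvival ((n : ℕ) * mean P * u) (w n ω) ^ 2) (Pr n) :=
    Integrable.of_bound (((measurable_avgSurvival _).comp (hw n)).pow_const 2).aestronglyMeasurable
      1 (Eventually.of_forall fun ω => by
        rw [norm_pow, Real.norm_of_nonneg (avgSurvival_nonneg _ _)]
        exact pow_le_one₀ (avgSurvival_nonneg _ _) (avgSurvival_le_one (by positivity) _))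
  have h1 : ∫ ω, avgSurvival ((n : ℕ) * mean P * u) (w n ω) ^ 2 ∂(Pr n) - laplace P u ^ 2 =
      ∫ ω, (avgSurvival ((n : ℕ) * mean P * u) (w n ω) ^ 2 - laplace P u ^ 2) ∂(Pr n) := by
    rw [integral_sub hi2 (integrable_const _)]
    simp
  rw [Real.dist_eq, h1, ← integral_const_mul]
  refine abs_integral_le_integral_abs.trans (integral_mono ((hi2.sub (integrable_const _)).abs)
    ((hi.sub (integrable_const _)).abs.const_mul 2) fun ω => ?_)
  simp only
  have h2 := avgSurvival_nonneg ((n : ℕ) * mean P * u) (w n ω)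
  have h3 := avgSurvival_le_one (s := (n : ℕ) * mean P * u) (by positivity) (w n ω)
  have h4 := laplace_nonneg P u
  have h5 := laplace_le_one P hu
  rw [sq_sub_sq, abs_mul, abs_of_nonneg (add_nonneg h2 h4)]
  exact mul_le_mul_of_nonneg_right (by linarith) (abs_nonneg _)

/-- Pointwise convergence of convex functions to a differentiable limit forces convergence of the
derivatives: chords on either side of `u` bracket the slope. -/
lemma tendsto_integral_nextSurvival {u : ℝ} (hu : 0 < u) :
    Tendsto (fun n : ℕ+ => ∫ ω, nextSurvival ((n : ℕ) * mean P * u) (w n ω) ∂(Pr n))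
      atTop (𝓝 (|deriv (laplace P) u| / mean P)) := by
  have hmean := mean_pos hLLN.mean_ne_zero
  have hint : ∀ n : ℕ+, Integrable (fun ω => nextSurvival ((n : ℕ) * mean P * u) (w n ω)) (Pr n) :=
    fun n => Integrable.of_bound
      ((measurable_nextSurvival _).comp (hw n)).aestronglyMeasurable ((n : ℕ) : ℝ)
      (Eventually.of_forall fun ω => by
        rw [nextSurvival, Real.norm_of_nonneg (Finset.sum_nonneg fun i _ =>
          mul_nonneg (NNReal.coe_nonneg _) (survival_nonneg _ i _))]
        refine (Finset.sum_le_card_nsmul _ _ 1 fun i _ => mul_le_one₀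
          (NNReal.coe_le_one.2 (popularity_le_one _ i)) (survival_nonneg _ i _)
          (survival_le_one (by positivity) i _)).trans_eq ?_
        simp)
  have hconv : ∀ v, 0 ≤ v → ∀ n : ℕ+,
      -(v - u) * (mean P * ∫ ω, nextSurvival ((n : ℕ) * mean P * u) (w n ω) ∂(Pr n)) ≤
      ∫ ω, avgSurvival ((n : ℕ) * mean P * v) (w n ω) ∂(Pr n) -
        ∫ ω, avgSurvival ((n : ℕ) * mean P * u) (w n ω) ∂(Pr n) := fun v hv n => by
    have hiv := integrable_avgSurvival (Pr := Pr) hw hmean.le hv n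
    have hiu := integrable_avgSurvival (Pr := Pr) hw hmean.le hu.le n
    rw [← integral_sub hiv hiu, ← integral_const_mul, ← integral_const_mul]
    exact integral_mono (((hint n).const_mul _).const_mul _) (hiv.sub hiu) fun ω =>
      avgSurvival_sub_ge n.ne_zero (w n ω) (mean P) u v
  have hslope := (hasDerivAt_iff_tendsto_slope.1 (hasDerivAt_laplace P hu))
  rw [abs_deriv_laplace P hu]
  suffices h : Tendsto (fun n : ℕ+ => mean P *
      ∫ ω, nextSurvival ((n : ℕ) * mean P * u) (w n ω) ∂(Pr n)) atTop
      (𝓝 (laplaceMoment P 1 u)) by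
    refine (h.div_const (mean P)).congr fun n => ?_
    rw [mul_div_cancel_left₀ _ hmean.ne']
  refine tendsto_order.2 ⟨fun c hc => ?_, fun c hc => ?_⟩
  -- A chord to the right of `u` bounds the decay rate from below; the other case uses a chord to
  -- the left, with `0 < v`, to bound it from above.
  · have hev : ∀ᶠ v in 𝓝[>] u, slope (laplace P) u v < -c :=
      (hslope.mono_left (nhdsWithin_mono u fun v hv => ne_of_gt hv)).eventually_lt_const
        (by linarith)
    obtain ⟨v, hv, huv⟩ := (hev.and self_mem_nhdsWithin).exists
    have huv' : 0 < v - u := sub_pos.2 huv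
    have hlim := (tendsto_integral_avgSurvival hw hLLN (hu.trans huv).le).sub
      (tendsto_integral_avgSurvival hw hLLN hu.le)
    rw [slope_def_field, div_lt_iff₀ huv'] at hv
    filter_upwards [hlim.eventually_lt_const hv] with n hn
    have := (hconv v (hu.trans huv).le n).trans_lt hn
    nlinarith
  · have hev : ∀ᶠ v in 𝓝[<] u, -c < slope (laplace P) u v :=
      (hslope.mono_left (nhdsWithin_mono u fun v hv => ne_of_lt hv)).eventually_const_lt
        (by linarith)
    obtain ⟨v, hv, huv, hv0⟩ := (hev.and (eventually_mem_nhdsWithin.and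
      (eventually_nhdsWithin_of_eventually_nhds (lt_mem_nhds hu)))).exists
    have huv' : v - u < 0 := sub_neg.2 huv
    have hlim := (tendsto_integral_avgSurvival hw hLLN hv0.le).sub
      (tendsto_integral_avgSurvival hw hLLN hu.le)
    rw [slope_def_field, lt_div_iff_of_neg huv'] at hv
    filter_upwards [hlim.eventually_lt_const hv] with n hn
    have := (hconv v hv0.le n).trans_lt hn
    nlinarith

end LLN

/-! ### Tails of the search-cost -/

section Tails

/-- If `V n` tends to `v` in probability and the probability of `V n < X n` tends to `g`, then so
does, up to arbitrarily small changes of `v`, the probability of `v < X n`. -/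
lemma eventually_measureReal_lt {ι : Type*} {l : Filter ι} {α : ι → Type*}
    [∀ n, MeasurableSpace (α n)] {μ : ∀ n, Measure (α n)} [∀ n, IsFiniteMeasure (μ n)]
    {X V : ∀ n, α n → ℝ} {v g : ℝ}
    (hV : ∀ ε > 0, Tendsto (fun n => (μ n).real {z | ε ≤ |V n z - v|}) l (𝓝 0))
    (hg : Tendsto (fun n => (μ n).real {z | V n z < X n z}) l (𝓝 g)) (x : ℝ) :
    (v < x → ∀ c > g, ∀ᶠ n in l, (μ n).real {z | x < X n z} < c) ∧
      (x < v → ∀ c < g, ∀ᶠ n in l, c < (μ n).real {z | x < X n z}) := by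
  constructor
  · intro hx c hc
    have hlim := hg.add (hV (x - v) (sub_pos.2 hx))
    rw [add_zero] at hlim
    filter_upwards [hlim.eventually_lt_const hc] with n hn
    refine lt_of_le_of_lt ((measureReal_mono fun z (hz : x < X n z) => ?_).trans
      (measureReal_union_le _ _)) hn
    by_cases h : V n z < X n z
    · exact Or.inl h
    · refine Or.inr (?_ : x - v ≤ |V n z - v|)
      exact le_trans (by linarith) (le_abs_self _)
  · intro hx c hc
    have hlim := hg.sub (hV (v - x) (sub_pos.2 hx))
    rw [sub_zero] at hlim
    filter_upwards [hlim.eventually_const_lt hc] with n hn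
    have h1 : (μ n).real {z | V n z < X n z} ≤
        (μ n).real ({z | x < X n z} ∪ {z | v - x ≤ |V n z - v|}) :=
      measureReal_mono fun z (hz : V n z < X n z) => by
        by_cases h : x < X n z
        · exact Or.inl h
        · refine Or.inr (?_ : v - x ≤ |V n z - v|)
          exact le_trans (by linarith) (neg_le_abs _)
    have h2 := measureReal_union_le (μ := μ n) {z | x < X n z} {z | v - x ≤ |V n z - v|}
    linarith

variable {n : ℕ}

/-- The search-cost as a function of the weights and the clock. -/
def jointCost (T : ℝ) (x : (Fin n → ℝ≥0) × (Fin n × ℕ → ℝ)) : ℕ :=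
  searchCost (Equiv.refl (Fin n)) (popularity x.1) x.2 T

lemma measurable_jointCost (T : ℝ) : Measurable (jointCost (n := n) T) :=
  measurable_searchCost _ (measurable_popularity.comp measurable_fst) measurable_snd
    measurable_const

open Classical in
lemma unrequestedCount_eq_card (A : Finset (Fin n)) (a b : ℝ)
    (x : (Fin n → ℝ≥0) × (Fin n × ℕ → ℝ)) :
    unrequestedCount A a b x =
      (A.filter fun j => NotRequested (popularity x.1) x.2 a b j).card := by
  rw [unrequestedCount, Finset.card_filter, Nat.cast_sum]
  refine Finset.sum_congr rfl fun i _ => ?_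
  by_cases h : NotRequested (popularity x.1) x.2 a b i
  · rw [Set.indicator_of_mem (show x ∈ notRequestedEvent a b i from h)]
    simp [h]
  · rw [Set.indicator_of_notMem (show x ∉ notRequestedEvent a b i from h)]
    simp [h]

lemma unrequestedCount_nonneg (A : Finset (Fin n)) (a b : ℝ)
    (x : (Fin n → ℝ≥0) × (Fin n × ℕ → ℝ)) : 0 ≤ unrequestedCount A a b x := by
  rw [unrequestedCount_eq_card]
  positivity

lemma unrequestedCount_le (A : Finset (Fin n)) (a b : ℝ)
    (x : (Fin n → ℝ≥0) × (Fin n × ℕ → ℝ)) : unrequestedCount A a b x ≤ n := by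
  classical
  rw [unrequestedCount_eq_card]
  exact_mod_cast (Finset.card_le_univ _).trans_eq (Fintype.card_fin n)

/-- The objects not requested in `[a, T)` occupy the last places of the list, and among the objects
not requested in `[0, T)` the initial order is preserved. -/
lemma lt_jointCost_iff {x : (Fin n → ℝ≥0) × (Fin n × ℕ → ℝ)} (hx : IsRegular (popularity x.1) x.2)
    {a T : ℝ} (haT : a ≤ T) {k : ℕ} (hak : a = 0 ∨ k = 0) :
    n - unrequestedCount Finset.univ a T x +
        unrequestedCount (Finset.univ.filter fun i : Fin n => (i : ℕ) < k) a T x < jointCost T x ↔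
      x ∈ ⋃ i ∈ Finset.univ.filter fun i : Fin n => ¬ (i : ℕ) < k,
        nextEvent T i ∩ notRequestedEvent a T i := by
  classical
  have hB := unrequestedCount_nonneg (Finset.univ.filter fun i : Fin n => (i : ℕ) < k) a T x
  have hH := unrequestedCount_le Finset.univ a T x
  simp only [Set.mem_iUnion, Finset.mem_filter, Finset.mem_univ, true_and, exists_prop]
  by_cases hnext : ∃ i, nextRequested (popularity x.1) x.2 T = some i
  · obtain ⟨i, hi⟩ := hnext
    have hcost : jointCost T x = position (Equiv.refl _) (popularity x.1) x.2 T i :=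
      searchCost_eq _ hi
    have huniq : (∃ j : Fin n, ¬ (j : ℕ) < k ∧ x ∈ nextEvent T j ∩ notRequestedEvent a T j) ↔
        ¬ (i : ℕ) < k ∧ NotRequested (popularity x.1) x.2 a T i := by
      constructor
      · rintro ⟨j, hjk, hj1, hj2⟩
        obtain rfl : i = j := Option.some.inj (hi.symm.trans hj1)
        exact ⟨hjk, hj2⟩
      · exact fun h => ⟨i, h.1, hi, h.2⟩
    rw [huniq, hcost]
    have hlt := hx.lt_position_iff (Equiv.refl _) haT i
    have hcard : (Finset.univ.filter fun j => NotRequested (popularity x.1) x.2 a T j).card ≤ n :=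
      (Finset.card_le_univ _).trans_eq (Fintype.card_fin n)
    rw [unrequestedCount_eq_card] at hB hH ⊢
    rw [unrequestedCount_eq_card]
    by_cases hreq : NotRequested (popularity x.1) x.2 a T i
    -- For `a = 0`, the position of `i` past the requested block is its rank among the unrequested
    -- objects in the initial order, which exceeds the number of those with index below `k` exactly
    -- when the index of `i` is at least `k`. For `k = 0` that number is zero and the block
    -- structure alone suffices.
    · rcases hak with rfl | rfl
      · have hpos : position (Equiv.refl _) (popularity x.1) x.2 T i +
            (Finset.univ.filter fun j => NotRequested (popularity x.1) x.2 0 T j).card = n +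
              (Finset.univ.filter fun j => NotRequested (popularity x.1) x.2 0 T j ∧
                j ≤ i).card := by
          convert hx.position_eq_of_notRequested (Equiv.refl _) hreq <;> rfl
        have hpos' : (position (Equiv.refl _) (popularity x.1) x.2 T i : ℝ) =
            n - (Finset.univ.filter fun j => NotRequested (popularity x.1) x.2 0 T j).card +
              (Finset.univ.filter fun j => NotRequested (popularity x.1) x.2 0 T j ∧
                j ≤ i).card := by
          have := congrArg (Nat.cast : ℕ → ℝ) hpos
          push_cast at this
          linarith
        rw [hpos', add_lt_add_iff_left, Nat.cast_lt, Finset.filter_filter]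
        simp only [hreq, and_true]
        constructor
        · intro h hik
          refine absurd (Finset.card_le_card fun j hj => ?_) (not_le.2 h)
          simp only [Finset.mem_filter, Finset.mem_univ, true_and] at hj ⊢
          exact ⟨lt_of_le_of_lt hj.2 hik, hj.1⟩
        · intro hik
          refine Finset.card_lt_card ((Finset.ssubset_iff_of_subset fun j hj => ?_).2
            ⟨i, by simpa using hreq, by simp [hik]⟩)
          simp only [Finset.mem_filter, Finset.mem_univ, true_and] at hj ⊢
          exact ⟨hj.2, Fin.le_def.2 (by omega)⟩
      · have := hlt.2 hreq
        simp only [Nat.not_lt_zero, Finset.filter_false, Finset.filter_empty, Finset.card_empty,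
          Nat.cast_zero, add_zero, not_false_eq_true, hreq, and_true, iff_true]
        rw [← Nat.cast_sub hcard]
        exact_mod_cast this
    · have h1 := not_lt.1 (mt hlt.1 hreq)
      have h2 : (position (Equiv.refl _) (popularity x.1) x.2 T i : ℝ) ≤
          n - (Finset.univ.filter fun j => NotRequested (popularity x.1) x.2 a T j).card := by
        rw [← Nat.cast_sub hcard]
        exact_mod_cast h1
      simp only [hreq, and_false, iff_false, not_lt]
      linarith
  · have hcost : jointCost T x = 0 := by
      by_contra h
      exact hnext (exists_nextRequested_of_searchCost_pos (Nat.pos_of_ne_zero h))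
    rw [hcost]
    refine iff_of_false (by push_cast; linarith) ?_
    rintro ⟨i, -, hi, -⟩
    exact hnext ⟨i, hi⟩

end Tails

/-! ### Limits of the levels and of the tail probabilities as the number of objects grows. -/

section Limits

variable {Λ : ∀ n : ℕ+, Measure (Fin n → ℝ≥0)} [∀ n, IsProbabilityMeasure (Λ n)]
  (hex : ∀ (n : ℕ+) (σ : Equiv.Perm (Fin n)), (Λ n).map (fun w i => w (σ i)) = Λ n)
  {m t u : ℝ} (hm : 0 ≤ m) (hut : u ≤ t) (hu : 0 ≤ u)

include hex hm hut hu

lemma tendsto_measureReal_unrequestedCount_far {y : ℝ} (hy : 0 ≤ y)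
    (h1 : Tendsto (fun n : ℕ+ => ∫ w, avgSurvival ((n : ℕ) * m * u) w ∂(Λ n)) atTop (𝓝 y))
    (h2 : Tendsto (fun n : ℕ+ => ∫ w, avgSurvival ((n : ℕ) * m * u) w ^ 2 ∂(Λ n)) atTop
      (𝓝 (y ^ 2))) (A : ∀ n : ℕ+, Finset (Fin n)) {ε : ℝ} (hε : 0 < ε) :
    Tendsto (fun n : ℕ+ => (jointLaw (Λ n)).real {x | ε ≤
      |unrequestedCount (A n) ((n : ℕ) * m * (t - u)) ((n : ℕ) * m * t) x / (n : ℕ) -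
        (A n).card / (n : ℕ) * y|}) atTop (𝓝 0) := by
  have hinv : Tendsto (fun n : ℕ+ => 1 / ((n : ℕ) : ℝ)) atTop (𝓝 0) :=
    tendsto_one_div_atTop_nhds_zero_nat.comp tendsto_PNat_val_atTop_atTop
  have h1' := ((h1.sub_const y).abs.const_mul (2 * y))
  have h2' := (h2.sub_const (y ^ 2)).abs
  have hlim := ((hinv.add h2').add h1').div_const (ε ^ 2)
  simp only [sub_self, abs_zero, mul_zero, add_zero, zero_div] at hlim
  refine squeeze_zero (fun n => measureReal_nonneg) (fun n => ?_) hlim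
  have ha : 0 ≤ (n : ℕ) * m * (t - u) := mul_nonneg (by positivity) (sub_nonneg.2 hut)
  have haT : (n : ℕ) * m * (t - u) ≤ (n : ℕ) * m * t :=
    mul_le_mul_of_nonneg_left (by linarith) (by positivity)
  have := measureReal_unrequestedCount_far_le (hex n) ha haT n.ne_zero (A n) hy hε
  rwa [show (n : ℕ) * m * t - (n : ℕ) * m * (t - u) = (n : ℕ) * m * u by ring] at this

lemma tendsto_jointLaw_biUnion_next {d r : ℝ}
    (h : Tendsto (fun n : ℕ+ => ∫ w, nextSurvival ((n : ℕ) * m * u) w ∂(Λ n)) atTop (𝓝 d))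
    {A : ∀ n : ℕ+, Finset (Fin n)}
    (hA : Tendsto (fun n : ℕ+ => ((A n).card : ℝ) / (n : ℕ)) atTop (𝓝 r)) :
    Tendsto (fun n : ℕ+ => (jointLaw (Λ n)).real (⋃ i ∈ A n, nextEvent ((n : ℕ) * m * t) i ∩
      notRequestedEvent ((n : ℕ) * m * (t - u)) ((n : ℕ) * m * t) i)) atTop (𝓝 (r * d)) := by
  refine (hA.mul h).congr fun n => ?_
  have ha : 0 ≤ (n : ℕ) * m * (t - u) := mul_nonneg (by positivity) (sub_nonneg.2 hut)
  have haT : (n : ℕ) * m * (t - u) ≤ (n : ℕ) * m * t :=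
    mul_le_mul_of_nonneg_left (by linarith) (by positivity)
  rw [jointLaw_biUnion_next (hex n) ha haT n.ne_zero,
    show (n : ℕ) * m * t - (n : ℕ) * m * (t - u) = (n : ℕ) * m * u by ring]

/-- The tail of the rescaled search-cost near `1 - (1 - r) * y`. -/
lemma eventually_jointLaw_cost {y d r : ℝ} (hy : 0 ≤ y)
    (h1 : Tendsto (fun n : ℕ+ => ∫ w, avgSurvival ((n : ℕ) * m * u) w ∂(Λ n)) atTop (𝓝 y))
    (h2 : Tendsto (fun n : ℕ+ => ∫ w, avgSurvival ((n : ℕ) * m * u) w ^ 2 ∂(Λ n)) atTop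
      (𝓝 (y ^ 2)))
    (h : Tendsto (fun n : ℕ+ => ∫ w, nextSurvival ((n : ℕ) * m * u) w ∂(Λ n)) atTop (𝓝 d))
    (hr0 : 0 ≤ r) (hr1 : r ≤ 1) (hur : u = t ∨ r = 0) (x : ℝ) :
    (1 - (1 - r) * y < x → ∀ c > (1 - r) * d, ∀ᶠ n : ℕ+ in atTop, (jointLaw (Λ n)).real
      {z | x < (jointCost ((n : ℕ) * m * t) z : ℝ) / (n : ℕ)} < c) ∧
    (x < 1 - (1 - r) * y → ∀ c < (1 - r) * d, ∀ᶠ n : ℕ+ in atTop, c < (jointLaw (Λ n)).real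
      {z | x < (jointCost ((n : ℕ) * m * t) z : ℝ) / (n : ℕ)}) := by
  -- The first `⌊r * n⌋` objects of the initial list, asymptotically a proportion `r`.
  set B : ∀ n : ℕ+, Finset (Fin n) := fun n =>
    Finset.univ.filter fun i => (i : ℕ) < ⌊r * (n : ℕ)⌋₊ with hB
  set A : ∀ n : ℕ+, Finset (Fin n) := fun n =>
    Finset.univ.filter fun i => ¬ (i : ℕ) < ⌊r * (n : ℕ)⌋₊ with hA
  have hfloor : ∀ n : ℕ+, ⌊r * (n : ℕ)⌋₊ ≤ n := fun n =>
    Nat.floor_le_of_le (mul_le_of_le_one_left (Nat.cast_nonneg _) hr1)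
  have hBcard : ∀ n, (B n).card = ⌊r * (n : ℕ)⌋₊ := fun n => by
    simp [hB, Fin.card_filter_val_lt, hfloor n]
  have hAB : ∀ n, ((A n).card : ℝ) / (n : ℕ) = 1 - ((B n).card : ℝ) / (n : ℕ) := fun n => by
    have := Finset.card_filter_add_card_filter_not (s := (Finset.univ : Finset (Fin n)))
      (fun i => (i : ℕ) < ⌊r * (n : ℕ)⌋₊)
    rw [Finset.card_univ, Fintype.card_fin] at this
    have h3 : ((B n).card : ℝ) + (A n).card = (n : ℕ) := by exact_mod_cast this
    have : ((n : ℕ) : ℝ) ≠ 0 := Nat.cast_ne_zero.2 n.ne_zero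
    field_simp
    linarith
  have hBlim : Tendsto (fun n : ℕ+ => ((B n).card : ℝ) / (n : ℕ)) atTop (𝓝 r) := by
    simp_rw [hBcard]
    exact (tendsto_nat_floor_mul_div_atTop hr0).comp
      (tendsto_natCast_atTop_atTop.comp tendsto_PNat_val_atTop_atTop)
  have hAlim : Tendsto (fun n : ℕ+ => ((A n).card : ℝ) / (n : ℕ)) atTop (𝓝 (1 - r)) := by
    simp_rw [hAB]
    exact hBlim.const_sub 1
  have hnext := tendsto_jointLaw_biUnion_next hex hm hut hu h hAlim
  -- The random level converges to `1 - y + r * y`: the unrequested objects have density `y` in the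
  -- whole list and in `B` alike.
  refine eventually_measureReal_lt (V := fun (n : ℕ+) z =>
    1 - unrequestedCount Finset.univ ((n : ℕ) * m * (t - u)) ((n : ℕ) * m * t) z / (n : ℕ) +
      unrequestedCount (B n) ((n : ℕ) * m * (t - u)) ((n : ℕ) * m * t) z / (n : ℕ))
    (fun ε hε => ?_) (hnext.congr fun n => ?_) x
  · have hε3 : 0 < ε / 3 := by positivity
    have hf1 := tendsto_measureReal_unrequestedCount_far hex hm hut hu hy h1 h2
      (fun _ => Finset.univ) hε3
    have hf2 := tendsto_measureReal_unrequestedCount_far hex hm hut hu hy h1 h2 B hε3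
    have hlim := hf1.add hf2
    rw [add_zero] at hlim
    -- Two thirds of `ε` go to the fluctuations of the two counts, the last third to the rounding of
    -- `r * n`.
    have hsmall : ∀ᶠ n : ℕ+ in atTop, |((B n).card : ℝ) / (n : ℕ) - r| * y < ε / 3 := by
      have := ((hBlim.sub_const r).abs).mul_const y
      rw [sub_self, abs_zero, zero_mul] at this
      exact this.eventually_lt_const hε3
    refine tendsto_of_tendsto_of_tendsto_of_le_of_le' tendsto_const_nhds hlim
      (Eventually.of_forall fun n => measureReal_nonneg) ?_
    filter_upwards [hsmall] with n hn
    refine (measureReal_mono fun z hz => ?_).trans (measureReal_union_le _ _)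
    by_contra hcon
    rw [Set.mem_union, not_or] at hcon
    obtain ⟨hc1, hc2⟩ := hcon
    simp only [Set.mem_ofPred_eq, not_le, Finset.card_univ, Fintype.card_fin] at hc1 hc2 hz
    have hn0 : ((n : ℕ) : ℝ) ≠ 0 := Nat.cast_ne_zero.2 n.ne_zero
    rw [div_self hn0, one_mul] at hc1
    have hn' : |(((B n).card : ℝ) / (n : ℕ) - r) * y| < ε / 3 := by
      rwa [abs_mul, abs_of_nonneg hy]
    rw [abs_lt] at hc1 hc2 hn'
    refine absurd hz (not_le.2 (abs_lt.2 ⟨?_, ?_⟩)) <;> nlinarith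
  · refine measureReal_congr (eventuallyEq_set.2 ?_)
    filter_upwards [ae_jointLaw_isRegular (Λ n)] with z hz
    have hn0 : (0 : ℝ) < (n : ℕ) := Nat.cast_pos.2 n.pos
    have haT : (n : ℕ) * m * (t - u) ≤ (n : ℕ) * m * t :=
      mul_le_mul_of_nonneg_left (by linarith) (by positivity)
    -- `u = t` makes the window start at time `0`, while `r = 0` makes `B` empty.
    have hak : (n : ℕ) * m * (t - u) = 0 ∨ ⌊r * ((n : ℕ) : ℝ)⌋₊ = 0 :=
      hur.imp (fun h => by rw [h, sub_self, mul_zero]) (fun h => by rw [h, zero_mul]; simp)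
    rw [← lt_jointCost_iff hz haT hak, lt_div_iff₀ hn0, add_mul, sub_mul,
      div_mul_cancel₀ _ hn0.ne', div_mul_cancel₀ _ hn0.ne', one_mul]

end Limits

/-! ### Convergence in distribution -/

section Convergence

/-- Half-open intervals form a π-system containing small neighbourhoods of every point, and their
masses are differences of tails; convergence on such a family implies weak convergence. -/
lemma tendsto_probabilityMeasure_of_tendsto_Ioi {ι : Type*} {l : Filter ι}
    [l.IsCountablyGenerated] {Q : ι → ProbabilityMeasure ℝ} {ν : ProbabilityMeasure ℝ}
    (h : ∀ x, Tendsto (fun i => (Q i : Measure ℝ).real (Set.Ioi x)) l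
      (𝓝 ((ν : Measure ℝ).real (Set.Ioi x)))) : Tendsto Q l (𝓝 ν) := by
  have hIoc : ∀ (κ : ProbabilityMeasure ℝ) {a b : ℝ}, a < b → ((κ (Set.Ioc a b) : ℝ≥0) : ℝ) =
      (κ : Measure ℝ).real (Set.Ioi a) - (κ : Measure ℝ).real (Set.Ioi b) := fun κ a b hab => by
    rw [← measureReal_sdiff (Set.Ioi_subset_Ioi hab.le) measurableSet_Ioi, Set.Ioi_sdiff_Ioi]
    rfl
  refine (isPiSystem_Ioc (id : ℝ → ℝ) id).tendsto_probabilityMeasure_of_tendsto_of_mem ?_ ?_ ?_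
  · rintro _ ⟨a, b, -, rfl⟩
    exact measurableSet_Ioc
  · intro G hG x hx
    obtain ⟨ε, hε, hball⟩ := Metric.isOpen_iff.1 hG x hx
    refine ⟨Set.Ioc (x - ε / 2) (x + ε / 2), ⟨x - ε / 2, x + ε / 2, by simp; linarith, rfl⟩,
      Ioc_mem_nhds (by linarith) (by linarith), fun y hy => hball ?_⟩
    rw [Metric.mem_ball, Real.dist_eq, abs_lt]
    constructor <;> linarith [hy.1, hy.2]
  · rintro _ ⟨a, b, hab, rfl⟩
    rw [← NNReal.tendsto_coe]
    simp only [id_eq] at hab ⊢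
    simp_rw [hIoc _ hab]
    exact (h a).sub (h b)

lemma IsProbabilityDensity.continuous_measureReal_Ioi {f : ℝ → ℝ} (hf : IsProbabilityDensity f) :
    Continuous fun x => (densityMeasure f).real (Set.Ioi x) := by
  have h : ∀ x, (densityMeasure f).real (Set.Ioi x) =
      (∫ y in Set.Ioi 0, f y) - ∫ y in (0 : ℝ)..x, f y := fun x => by
    rw [hf.densityMeasure_real measurableSet_Ioi,
      ← intervalIntegral.integral_interval_add_Ioi hf.integrable.integrableOn
        hf.integrable.integrableOn (a := 0) (b := x)]
    ring
  simp_rw [h]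
  exact continuous_const.sub (intervalIntegral.continuous_primitive
    (fun a b => hf.integrable.intervalIntegrable) 0)

variable {P : ProbabilityMeasure ℝ≥0}

/-! ### Tails of the limiting law at the levels produced by the windows. -/

section Limit

variable (hP : Integrable (fun x : ℝ≥0 => (x : ℝ)) (P : Measure ℝ≥0)) (hm : mean P ≠ 0)
  {t : ℝ} (ht : 0 < t)
include hP hm ht

/-- Beyond `1 - φ t` the transient law only redistributes the stationary mass, so at a level below
`1 - φ t` its tail is the stationary one. -/
lemma densityMeasure_transientDensity_real_Ioi {u : ℝ} (hu : 0 ≤ u) (hut : u < t) :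
    (densityMeasure (transientDensity P t)).real (Set.Ioi (1 - laplace P u)) =
      laplaceMoment P 1 u / mean P := by
  have hlt : laplace P t < laplace P u := strictAntiOn_laplace hP hm hu ht.le hut
  have hφ := laplace_pos hP hm ht.le
  have hpos := div_nonneg (laplaceMoment_nonneg P 1 u) (mean_pos hm).le
  have hsub : Set.Ioi (1 - laplace P u) ∩ Set.Icc (1 - laplace P t) 1 =
      Set.Icc (1 - laplace P t) 1 :=
    Set.inter_eq_right.2 fun x hx => Set.mem_Ioi.2 (lt_of_lt_of_le (by linarith) hx.1)
  rw [measureReal_def, densityMeasure_transientDensity_apply hP hm ht measurableSet_Ioi,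
    hsub, ofReal_outHeight_mul_volume hP hm ht, ← densityMeasure_stationaryDensity_Ioi' hP hm ht,
    Set.Ioi_inter_Iic, ← measure_union Set.Ioc_disjoint_Ioi_same measurableSet_Ioi,
    Set.Ioc_union_Ioi_eq_Ioi (by linarith), densityMeasure_stationaryDensity_Ioi hP hm hu,
    ENNReal.toReal_ofReal hpos]

lemma densityMeasure_transientDensity_real_Ioi' {y : ℝ} (hy0 : 0 ≤ y) (hy1 : y ≤ 1) :
    (densityMeasure (transientDensity P t)).real (Set.Ioi (1 - y * laplace P t)) =
      y * (|deriv (laplace P) t| / mean P) := by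
  have hφ := laplace_pos hP hm ht.le
  have hle : y * laplace P t ≤ laplace P t := mul_le_of_le_one_left hφ.le hy1
  have h1 : Set.Ioi (1 - y * laplace P t) ∩ Set.Iic (1 - laplace P t) = ∅ := by
    rw [Set.Ioi_inter_Iic, Set.Ioc_eq_empty (by linarith)]
  have h2 : volume (Set.Ioi (1 - y * laplace P t) ∩ Set.Icc (1 - laplace P t) 1) =
      ENNReal.ofReal (y * laplace P t) := by
    have : Set.Ioi (1 - y * laplace P t) ∩ Set.Icc (1 - laplace P t) 1 =
        Set.Ioc (1 - y * laplace P t) 1 := by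
      ext x
      simp only [Set.mem_inter_iff, Set.mem_Ioi, Set.mem_Icc, Set.mem_Ioc]
      exact ⟨fun h => ⟨h.1, h.2.2⟩, fun h => ⟨h.1, by linarith [h.1], h.2⟩⟩
    rw [this, Real.volume_Ioc]
    congr 1
    ring
  rw [measureReal_def, densityMeasure_transientDensity_apply hP hm ht measurableSet_Ioi, h1, h2,
    measure_empty, zero_add, ← ENNReal.ofReal_mul (outHeight_nonneg t),
    ENNReal.toReal_ofReal (mul_nonneg (outHeight_nonneg t) (mul_nonneg hy0 hφ.le)),
    ← outHeight_mul_laplace hP hm ht]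
  ring

lemma densityMeasure_transientDensity_real_Ioi_of_nonpos {x : ℝ} (hx : x ≤ 0) :
    (densityMeasure (transientDensity P t)).real (Set.Ioi x) = 1 := by
  have := (isProbabilityDensity_transientDensity hP hm ht).isProbabilityMeasure
  refine le_antisymm measureReal_le_one ?_
  have h := densityMeasure_transientDensity_real_Ioi hP hm ht le_rfl ht
  have h1 : laplaceMoment P 1 0 = mean P := by simp [laplaceMoment, mean]
  rw [h1, div_self hm, laplace_zero, sub_self] at h
  rw [← h]
  exact measureReal_mono (Set.Ioi_subset_Ioi hx)

end Limit

variable {Ω : ℕ+ → Type*} [∀ n, MeasurableSpace (Ω n)] {Pr : ∀ n, Measure (Ω n)}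
  [∀ n, IsProbabilityMeasure (Pr n)] {w : ∀ n : ℕ+, Ω n → Fin n → ℝ≥0}

/-- Moves every probability to the canonical product of the law of the weights and the law of the
clock. -/
lemma IsRequestClock.hasLaw_jointLaw {n : ℕ} {Ω : Type*} [MeasurableSpace Ω] {Pr : Measure Ω}
    [IsProbabilityMeasure Pr] {w : Ω → Fin n → ℝ≥0} (hw : Measurable w)
    {e : Fin n × ℕ → Ω → ℝ} (he : IsRequestClock Pr w e) :
    HasLaw (fun ω => (w ω, fun r => e r ω)) (jointLaw (Pr.map w)) Pr := by
  have hem : AEMeasurable (fun ω r => e r ω) Pr :=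
    aemeasurable_pi_iff.2 fun r => (he.hasLaw r).aemeasurable
  refine ⟨hw.aemeasurable.prodMk hem, ?_⟩
  rw [(indepFun_iff_map_prod_eq_prod_map_map hw.aemeasurable hem).1 he.indep,
    (he.iIndep.hasLaw_infinitePi he.hasLaw hem).map_eq]
  rfl

lemma IsExchangeable.map_map_perm {n : ℕ} {Ω : Type*} [MeasurableSpace Ω] {Pr : Measure Ω}
    {w : Ω → Fin n → ℝ≥0} (hw : Measurable w) (h : IsExchangeable Pr w)
    (σ : Equiv.Perm (Fin n)) : (Pr.map w).map (fun w i => w (σ i)) = Pr.map w := by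
  rw [Measure.map_map (measurable_pi_lambda _ fun i => measurable_pi_apply (σ i)) hw]
  exact (h σ).map_eq

variable (hw : ∀ n, Measurable (w n)) (hLLN : SatisfiesLLN Pr w P)
  (hex : ∀ n, IsExchangeable (Pr n) (w n))
include hw hLLN hex

lemma eventually_map_jointLaw_cost {t u r : ℝ} (hu : 0 < u) (hut : u ≤ t) (hr0 : 0 ≤ r)
    (hr1 : r ≤ 1) (hur : u = t ∨ r = 0) (x : ℝ) :
    (1 - (1 - r) * laplace P u < x → ∀ c > (1 - r) * (|deriv (laplace P) u| / mean P),
      ∀ᶠ n : ℕ+ in atTop, (jointLaw ((Pr n).map (w n))).real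
        {z | x < (jointCost ((n : ℕ) * mean P * t) z : ℝ) / (n : ℕ)} < c) ∧
    (x < 1 - (1 - r) * laplace P u → ∀ c < (1 - r) * (|deriv (laplace P) u| / mean P),
      ∀ᶠ n : ℕ+ in atTop, c < (jointLaw ((Pr n).map (w n))).real
        {z | x < (jointCost ((n : ℕ) * mean P * t) z : ℝ) / (n : ℕ)}) := by
  have := fun n => Measure.isProbabilityMeasure_map (μ := Pr n) (hw n).aemeasurable
  refine eventually_jointLaw_cost (fun n => (hex n).map_map_perm (hw n))
    (mean_pos hLLN.mean_ne_zero).le hut hu.le (laplace_nonneg P u) ?_ ?_ ?_ hr0 hr1 hur x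
  · refine (tendsto_integral_avgSurvival hw hLLN hu.le).congr fun n => ?_
    rw [integral_map (hw n).aemeasurable (measurable_avgSurvival _).aestronglyMeasurable]
  · refine (tendsto_integral_avgSurvival_sq hw hLLN hu.le).congr fun n => ?_
    rw [integral_map (hw n).aemeasurable
      ((measurable_avgSurvival _).pow_const 2).aestronglyMeasurable]
  · refine (tendsto_integral_nextSurvival hw hLLN hu).congr fun n => ?_
    rw [integral_map (hw n).aemeasurable (measurable_nextSurvival _).aestronglyMeasurable]

/-- The tails of the rescaled search-cost converge to those of the limiting law. -/
lemma tendsto_jointLaw_cost {t : ℝ} (ht : 0 < t) (x : ℝ) :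
    Tendsto (fun n : ℕ+ => (jointLaw ((Pr n).map (w n))).real
        {z | x < (jointCost ((n : ℕ) * mean P * t) z : ℝ) / (n : ℕ)}) atTop
      (𝓝 ((densityMeasure (transientDensity P t)).real (Set.Ioi x))) := by
  have := fun n => Measure.isProbabilityMeasure_map (μ := Pr n) (hw n).aemeasurable
  have hP := hLLN.integrable
  have hm := hLLN.mean_ne_zero
  have hφ := laplace_pos hP hm ht.le
  have hden := isProbabilityDensity_transientDensity hP hm ht
  have hν := hden.isProbabilityMeasure
  have hcost : ∀ (n : ℕ+) z, 0 ≤ (jointCost ((n : ℕ) * mean P * t) z : ℝ) / (n : ℕ) ∧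
      (jointCost ((n : ℕ) * mean P * t) z : ℝ) / (n : ℕ) ≤ 1 := fun n z =>
    ⟨by positivity, div_le_one_of_le₀ (Nat.cast_le.2 (searchCost_le _ _ _ _)) (by positivity)⟩
  -- The level `v` is compared with `x ≠ v` according to its place. For `0 < v < 1 - φ t` it is `1 -
  -- φ u` with `0 < u < t` and `r = 0`; from `1 - φ t` to `1` it comes from `u = t` with `r = 1 - (1
  -- - v) / φ t`; outside `(0, 1]` the bounds `0 ≤ cost / n ≤ 1` suffice.
  have key : ∀ v x : ℝ,
      (v < x → ∀ c > (densityMeasure (transientDensity P t)).real (Set.Ioi v),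
        ∀ᶠ n : ℕ+ in atTop, (jointLaw ((Pr n).map (w n))).real
          {z | x < (jointCost ((n : ℕ) * mean P * t) z : ℝ) / (n : ℕ)} < c) ∧
      (x < v → ∀ c < (densityMeasure (transientDensity P t)).real (Set.Ioi v),
        ∀ᶠ n : ℕ+ in atTop, c < (jointLaw ((Pr n).map (w n))).real
          {z | x < (jointCost ((n : ℕ) * mean P * t) z : ℝ) / (n : ℕ)}) := by
    intro v x
    rcases le_or_gt v 0 with hv0 | hv0
    · rw [densityMeasure_transientDensity_real_Ioi_of_nonpos hP hm ht hv0]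
      refine ⟨fun _ c hc => Eventually.of_forall fun n => measureReal_le_one.trans_lt hc,
        fun hx c hc => Eventually.of_forall fun n => ?_⟩
      have : {z | x < (jointCost ((n : ℕ) * mean P * t) z : ℝ) / (n : ℕ)} = Set.univ :=
        Set.eq_univ_of_forall fun z => lt_of_lt_of_le (hx.trans_le hv0) (hcost n z).1
      rwa [this, probReal_univ]
    rcases le_or_gt v (1 - laplace P t) with hv1 | hv1
    · rcases eq_or_lt_of_le hv1 with rfl | hv1
      · have h := eventually_map_jointLaw_cost hw hLLN hex ht le_rfl le_rfl zero_le_one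
          (Or.inl rfl) x
        have h' := densityMeasure_transientDensity_real_Ioi' hP hm ht zero_le_one le_rfl
        rw [sub_zero, ← h'] at h
        simpa only [one_mul] using h
      · obtain ⟨u, hu, huv⟩ := intermediate_value_Icc' ht.le ((continuousOn_laplace P).mono
          fun s hs => Set.mem_Ici.2 hs.1) (show 1 - v ∈ Set.Icc (laplace P t) (laplace P 0) by
            rw [laplace_zero]; constructor <;> linarith)
        have hu0 : 0 < u := lt_of_le_of_ne hu.1 fun h => by
          rw [← h, laplace_zero] at huv
          linarith
        have hut : u < t := lt_of_le_of_ne hu.2 fun h => by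
          rw [h] at huv
          linarith
        have h := eventually_map_jointLaw_cost hw hLLN hex hu0 hut.le le_rfl zero_le_one
          (Or.inr rfl) x
        have h' := densityMeasure_transientDensity_real_Ioi hP hm ht hu.1 hut
        rw [← abs_deriv_laplace P hu0] at h'
        obtain rfl : v = 1 - laplace P u := by linarith
        simpa only [sub_zero, one_mul, ← h'] using h
    rcases le_or_gt v 1 with hv2 | hv2
    · have hy0 : 0 ≤ (1 - v) / laplace P t := div_nonneg (by linarith) hφ.le
      have hy1 : (1 - v) / laplace P t ≤ 1 := (div_le_one hφ).2 (by linarith)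
      have h := eventually_map_jointLaw_cost hw hLLN hex ht le_rfl (sub_nonneg.2 hy1)
        (sub_le_self 1 hy0) (Or.inl rfl) x
      have h' := densityMeasure_transientDensity_real_Ioi' hP hm ht hy0 hy1
      rw [sub_sub_cancel, ← h', div_mul_cancel₀ _ hφ.ne', sub_sub_cancel] at h
      exact h
    · have h0 : (densityMeasure (transientDensity P t)).real (Set.Ioi v) ≥ 0 := measureReal_nonneg
      have h0' : (densityMeasure (transientDensity P t)).real (Set.Ioi v) ≤ 0 := by
        have h' := densityMeasure_transientDensity_real_Ioi' hP hm ht le_rfl zero_le_one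
        rw [zero_mul, zero_mul, sub_zero] at h'
        rw [← h']
        exact measureReal_mono (Set.Ioi_subset_Ioi hv2.le)
      refine ⟨fun hx c hc => Eventually.of_forall fun n => ?_,
        fun _ c hc => Eventually.of_forall fun n => (hc.trans_le h0').trans_le measureReal_nonneg⟩
      have : {z | x < (jointCost ((n : ℕ) * mean P * t) z : ℝ) / (n : ℕ)} = ∅ :=
        Set.eq_empty_of_forall_notMem fun z hz =>
          absurd (hv2.trans hx) (not_lt.2 ((le_of_lt hz).trans (hcost n z).2))
      rw [this, measureReal_empty]
      exact h0.trans_lt hc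
  -- The limiting law has no atom, so `v` can be taken close to `x` on the side required, at an
  -- arbitrarily small cost in the tail.
  have hcont := hden.continuous_measureReal_Ioi.tendsto x
  refine tendsto_order.2 ⟨fun c hc => ?_, fun c hc => ?_⟩
  · obtain ⟨v, hv, hxv⟩ := (((hcont.mono_left nhdsWithin_le_nhds).eventually_const_lt hc).and
      (self_mem_nhdsWithin (s := Set.Ioi x))).exists
    exact (key v x).2 hxv c hv
  · obtain ⟨v, hv, hxv⟩ := (((hcont.mono_left nhdsWithin_le_nhds).eventually_lt_const hc).and
      (self_mem_nhdsWithin (s := Set.Iio x))).exists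
    exact (key v x).1 hxv c hv

variable {e : ∀ n : ℕ+, Fin n × ℕ → Ω n → ℝ} (he : ∀ n, IsRequestClock (Pr n) (w n) (e n))
include he

/-- Positions start at `1`, so the cost is positive exactly when the next object was never
requested. This is the window `[0, T)`, that is `u = t`, with all the objects. -/
lemma tendsto_measureReal_searchCostOut_pos {t : ℝ} (ht : 0 < t) :
    Tendsto (fun n : ℕ+ => (Pr n).real {ω | 0 < searchCostOut (Equiv.refl (Fin n))
      (popularity (w n ω)) (fun r => e n r ω) ((n : ℕ) * mean P * t)}) atTop
      (𝓝 (|deriv (laplace P) t| / mean P)) := by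
  have := fun n => Measure.isProbabilityMeasure_map (μ := Pr n) (hw n).aemeasurable
  have hnext := tendsto_jointLaw_biUnion_next (fun n => (hex n).map_map_perm (hw n))
    (mean_pos hLLN.mean_ne_zero).le (le_refl t) ht.le (r := 1)
    (A := fun _ => Finset.univ) (d := |deriv (laplace P) t| / mean P)
    ((tendsto_integral_nextSurvival hw hLLN ht).congr fun n => by
      rw [integral_map (hw n).aemeasurable (measurable_nextSurvival _).aestronglyMeasurable])
    (tendsto_const_nhds.congr fun n => by
      rw [Finset.card_univ, Fintype.card_fin, div_self (Nat.cast_ne_zero.2 n.ne_zero)])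
  rw [one_mul] at hnext
  refine hnext.congr fun n => ?_
  have hlaw := (he n).hasLaw_jointLaw (hw n)
  have hreg : ∀ᵐ ω ∂(Pr n), IsRegular (popularity (w n ω)) (fun r => e n r ω) :=
    ae_of_ae_map hlaw.aemeasurable (hlaw.map_eq ▸ ae_jointLaw_isRegular ((Pr n).map (w n)))
  have hmeas : MeasurableSet (⋃ i ∈ (Finset.univ : Finset (Fin n)),
      nextEvent ((n : ℕ) * mean P * t) i ∩
      notRequestedEvent ((n : ℕ) * mean P * (t - t)) ((n : ℕ) * mean P * t) i) :=
    Finset.measurableSet_biUnion _ fun i _ =>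
      (measurableSet_nextEvent _ i).inter (measurableSet_notRequestedEvent _ _ i)
  rw [← hlaw.map_eq, map_measureReal_apply_of_aemeasurable hlaw.aemeasurable hmeas]
  refine measureReal_congr (eventuallyEq_set.2 ?_)
  filter_upwards [hreg] with ω hω
  simp only [sub_self, mul_zero, Set.mem_preimage, Set.mem_iUnion, Finset.mem_univ,
    exists_true_left, searchCostOut]
  have hiff : (∃ i, (w n ω, fun r => e n r ω) ∈ nextEvent ((n : ℕ) * mean P * t) i ∩
      notRequestedEvent 0 ((n : ℕ) * mean P * t) i) ↔
      ∃ i, nextRequested (popularity (w n ω)) (fun r => e n r ω) ((n : ℕ) * mean P * t) = some i ∧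
        i ∉ requestedSet (popularity (w n ω)) (fun r => e n r ω) ((n : ℕ) * mean P * t) :=
    exists_congr fun i => and_congr_right fun _ => (hω.notMem_requestedSet_iff _ i).symm
  rw [hiff]
  split_ifs with h
  · refine iff_of_true h ?_
    obtain ⟨i, hi, -⟩ := h
    rw [searchCost_eq _ hi]
    exact ((positionAfter_mem_and_injective _ _ _ _).1 i).1
  · exact iff_of_false h (lt_irrefl 0)

lemma tendstoInDistribution_searchCost {t : ℝ} (ht : 0 < t) {Ω' : Type*} [MeasurableSpace Ω']
    {Pr' : Measure Ω'} [IsProbabilityMeasure Pr'] {St : Ω' → ℝ}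
    (hSt : HasLaw St (densityMeasure (transientDensity P t)) Pr') :
    TendstoInDistribution (fun (n : ℕ+) ω => (searchCost (Equiv.refl (Fin n))
      (popularity (w n ω)) (fun r => e n r ω) ((n : ℕ) * mean P * t) : ℝ) / (n : ℕ))
      atTop St Pr Pr' := by
  have hmc : ∀ n : ℕ+, Measurable fun z : (Fin n → ℝ≥0) × (Fin n × ℕ → ℝ) =>
      (jointCost ((n : ℕ) * mean P * t) z : ℝ) / (n : ℕ) := fun n =>
    (measurable_from_nat.comp (measurable_jointCost _)).div_const _
  have hlaw := fun n => (he n).hasLaw_jointLaw (hw n)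
  have hae : ∀ n : ℕ+, AEMeasurable (fun ω => (searchCost (Equiv.refl (Fin n))
      (popularity (w n ω)) (fun r => e n r ω) ((n : ℕ) * mean P * t) : ℝ) / (n : ℕ)) (Pr n) :=
    fun n => by
      have h := (hmc n).comp_aemeasurable (hlaw n).aemeasurable
      simpa only [jointCost, Function.comp_def] using h
  refine ⟨hae, hSt.aemeasurable, tendsto_probabilityMeasure_of_tendsto_Ioi fun x => ?_⟩
  have hx := tendsto_jointLaw_cost hw hLLN hex ht x
  rw [← hSt.map_eq] at hx
  refine hx.congr fun n => ?_
  rw [ProbabilityMeasure.coe_mk, map_measureReal_apply_of_aemeasurable (hae n) measurableSet_Ioi]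
  exact ((hlaw n).measureReal_eq (measurableSet_lt measurable_const (hmc n))).symm

end Convergence

end MoveToFront

end

/-! ### The theorem. -/

theorem mainTheorem4
    {Ω : ℕ+ → Type*} [∀ n, MeasurableSpace (Ω n)]
    (Pr : ∀ n, Measure (Ω n)) [∀ n, IsProbabilityMeasure (Pr n)]
    (w : ∀ n : ℕ+, Ω n → Fin n → ℝ≥0) (hw : ∀ n, Measurable (w n))
    (e : ∀ n : ℕ+, Fin n × ℕ → Ω n → ℝ)
    (he : ∀ n, MoveToFront.IsRequestClock (Pr n) (w n) (e n))
    (P : ProbabilityMeasure ℝ≥0)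
    (hLLN : MoveToFront.SatisfiesLLN Pr w P)
    (hex : ∀ n, MoveToFront.IsExchangeable (Pr n) (w n)) :
    MoveToFront.IsProbabilityDensity (MoveToFront.stationaryDensity P) ∧
    ∀ t : ℝ, 0 < t →
      MoveToFront.IsProbabilityDensity (MoveToFront.transientDensity P t) ∧
      Tendsto
        (fun n : ℕ+ => (Pr n).real {ω | 0 < MoveToFront.searchCostOut (Equiv.refl (Fin n))
          (MoveToFront.popularity (w n ω)) (fun r => e n r ω)
          (((n : ℕ) : ℝ) * MoveToFront.mean P * t)})
        atTop (𝓝 (|deriv (MoveToFront.laplace P) t| / MoveToFront.mean P)) ∧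
      ∀ (Ω' : Type*) [MeasurableSpace Ω'] (Pr' : Measure Ω') [IsProbabilityMeasure Pr']
        (Sinf U St : Ω' → ℝ),
        HasLaw Sinf (MoveToFront.densityMeasure (MoveToFront.stationaryDensity P)) Pr' →
        pdf.IsUniform U (Set.Icc (1 - MoveToFront.laplace P t) 1) Pr' →
        IndepFun Sinf U Pr' →
        IdentDistrib St
          (fun ω => {ω | Sinf ω ≤ 1 - MoveToFront.laplace P t}.indicator Sinf ω +
            {ω | 1 - MoveToFront.laplace P t < Sinf ω}.indicator U ω) Pr' Pr' →
        TendstoInDistribution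
          (fun (n : ℕ+) ω => (MoveToFront.searchCost (Equiv.refl (Fin n))
            (MoveToFront.popularity (w n ω)) (fun r => e n r ω)
            (((n : ℕ) : ℝ) * MoveToFront.mean P * t) : ℝ) / ((n : ℕ) : ℝ))
          atTop St Pr Pr' ∧
        Pr'.real {ω | 1 - MoveToFront.laplace P t < Sinf ω} =
          |deriv (MoveToFront.laplace P) t| / MoveToFront.mean P ∧
        HasLaw St (MoveToFront.densityMeasure (MoveToFront.transientDensity P t)) Pr' ∧
        MoveToFront.tvDistance (Pr'.map St) (Pr'.map Sinf) =
          (∫ x in (1 - MoveToFront.laplace P t)..(1 - MoveToFront.atomZero P),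
            |MoveToFront.stationaryDensity P x - MoveToFront.outHeight P t|) +
            |deriv (MoveToFront.laplace P) t| * MoveToFront.atomZero P /
              (MoveToFront.mean P * MoveToFront.laplace P t) ∧
        MoveToFront.tvDistance (Pr'.map St) (Pr'.map Sinf) ≤
          2 * (|deriv (MoveToFront.laplace P) t| / MoveToFront.mean P) := by
  have hP := hLLN.integrable
  have hm := hLLN.mean_ne_zero
  refine ⟨MoveToFront.isProbabilityDensity_stationaryDensity hP hm, fun t ht =>
    ⟨MoveToFront.isProbabilityDensity_transientDensity hP hm ht,
      MoveToFront.tendsto_measureReal_searchCostOut_pos hw hLLN hex he ht, ?_⟩⟩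
  intro Ω' _ Pr' _ Sinf U St hS hU hind hSt
  have hlaw := MoveToFront.hasLaw_transient hP hm ht hS hU hind hSt
  have htv := MoveToFront.tvDistance_eq_integral
    (MoveToFront.isProbabilityDensity_transientDensity hP hm ht)
    (MoveToFront.isProbabilityDensity_stationaryDensity hP hm) hlaw.map_eq hS.map_eq
  refine ⟨MoveToFront.tendstoInDistribution_searchCost hw hLLN hex he ht hlaw, ?_, hlaw, ?_, ?_⟩
  · refine (hS.measureReal_eq measurableSet_Ioi).trans ?_
    rw [measureReal_def]
    refine (congrArg ENNReal.toReal
      (MoveToFront.densityMeasure_stationaryDensity_Ioi' hP hm ht)).trans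
      (ENNReal.toReal_ofReal (div_nonneg (abs_nonneg _) (MoveToFront.mean_pos hm).le))
  · rw [htv, MoveToFront.integral_abs_transientDensity_sub hP hm ht]
  · rw [htv]
    exact MoveToFront.integral_abs_transientDensity_sub_le hP hm ht
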